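/- Let $\mathbb K=\mathbb R$ or $\mathbb C$, let $n$ be a natural number, and consider the linear equation $$y^{(n)}+a_1y^{(n-1)}+\dots+a_ny=0,\qquad a_j=a_j(x)\text{ smooth}.\tag{1}$$ A local change of variables $\tau:\ x=\xi(z),\ y=\eta(z)w$ (with $\xi,\eta$ smooth, $\xi'\neq0$, $\eta\ne0$) carries (1) to an equation $w^{(n)}+A_1w^{(n-1)}+\dots+A_nw=0$ with $A_j=A_j(z)$; these changes of variables form the equivalence group $G$. For a function $F$ of finitely many of the quantities $a_j^{(k)}$, $1\le j\le n$, $k\ge0$, write $F_\tau(z)=F(A(z),A'(z),\dots)$, and evaluate $F=F(a,a',\dots)$ at $x=\xi(z)$. $F$ is a *relative invariant* if $F_\tau=\mathbf w(\tau)F$ for all $a$ and all $\tau\in G$, wherever both sides are defined, where the weight function $\mathbf w$ is multiplicative under composition of transformations. It is an *absolute invariant* if $\mathbf w\equiv1$. It has order at most $r$ if it involves only derivatives $a_j^{(k)}$ with $k\le r$. A polynomial in the $a_j^{(k)}$ has weight $m$ if all its terms have weight $m$, where $a_j^{(k)}$ has weight $j+k$. A set $B$ of rational functions of the $a_j^{(k)}$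 is called a *fundamental set of absolute invariants* if its elements are absolute invariants and, for every $r\ge0$, the elements of $B$ of order at most $r$ are finite in number, say $I_1,\dots,I_s$, and there is a dense open set $V_r$ in the space of jets $(a_j^{(k)})_{1\le j\le n,\,0\le k\le r}$ such that, at every point of $V_r$, the $I_i$ are defined and functionally independent (their differentials are linearly independent) and every smooth absolute invariant of order at most $r$ that is defined on an open set containing this point is, near it, a smooth function $\Phi(I_1,\dots,I_s)$. **Theorem.** Equation (1) has a fundamental set of absolute invariants consisting of rational functions, in which every element is a quotient $F=S_1/S_2$ of two polynomial relative invariants $S_1$ and $S_2\neq0$ of the same weight $m$, each of which satisfies $$S_\tau=\xi'(z)^m\,S\qquad\text{for every }\tau\in G.$$ -/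

import Mathlib

open scoped ContDiff Topology

/-- The left-hand side `y⁽ⁿ⁾ + a₁ y⁽ⁿ⁻¹⁾ + ⋯ + aₙ y` at the point `x`.  The coefficient `a_{j+1}` of
the equation is `a j` (indices in `Fin n` start at `0`). -/
noncomputable def linearODE {𝕜 : Type*} [RCLike 𝕜] {n : ℕ} (a : Fin n → 𝕜 → 𝕜) (y : 𝕜 → 𝕜)
    (x : 𝕜) : 𝕜 :=
  iteratedDeriv n y x + ∑ j : Fin n, a j x * iteratedDeriv (n - (j.val + 1)) y x

/-- The change of variables `x = ξ(z)`, `y = η(z) w`, for `z` in the open set `J` and `x` in the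
open set `D`, with `ξ' ≠ 0` and `η ≠ 0`, carries the linear equation with coefficients `a` (on `D`)
to the linear equation with coefficients `A` (on `J`): substituting `y = η w` in the first equation
gives the second one, up to the factor that makes it monic. -/
structure IsTransform {𝕜 : Type*} [RCLike 𝕜] {n : ℕ} (J D : Set 𝕜) (ξ η : 𝕜 → 𝕜)
    (a A : Fin n → 𝕜 → 𝕜) : Prop where
  isOpen_J : IsOpen J
  isOpen_D : IsOpen D
  smooth_xi : ContDiffOn 𝕜 ∞ ξ J
  deriv_xi_ne : ∀ z ∈ J, deriv ξ z ≠ 0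
  mapsTo_xi : Set.MapsTo ξ J D
  smooth_eta : ContDiffOn 𝕜 ∞ η J
  eta_ne : ∀ z ∈ J, η z ≠ 0
  smooth_a : ∀ j, ContDiffOn 𝕜 ∞ (a j) D
  smooth_A : ∀ j, ContDiffOn 𝕜 ∞ (A j) J
  subst_eq : ∀ y w : 𝕜 → 𝕜, ContDiffOn 𝕜 ∞ y D → ContDiffOn 𝕜 ∞ w J →
    (∀ z ∈ J, y (ξ z) = η z * w z) →
    ∀ z ∈ J, linearODE A w z = deriv ξ z ^ n / η z * linearODE a y (ξ z)

/-- All derivatives of the coefficients at `x`: the coordinate `(j, k)` is the `k`-th derivative of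
`a j`. -/
noncomputable def coeffJet {𝕜 : Type*} [RCLike 𝕜] {n : ℕ} (a : Fin n → 𝕜 → 𝕜) (x : 𝕜) :
    Fin n × ℕ → 𝕜 :=
  fun p => iteratedDeriv p.2 (a p.1) x

/-- The space of jets of order `r` of the coefficients. -/
abbrev Jet (𝕜 : Type*) (n r : ℕ) : Type _ := Fin n × Fin (r + 1) → 𝕜

/-- Forget the derivatives of order greater than `r`. -/
def truncJet {𝕜 : Type*} {n : ℕ} (r : ℕ) (p : Fin n × ℕ → 𝕜) : Jet 𝕜 n r :=
  fun q => p (q.1, q.2.val)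

/-- Extend a jet of order `r` by zeros (used only to evaluate expressions of order at most `r`). -/
def extendJet {𝕜 : Type*} [Zero 𝕜] {n r : ℕ} (q : Jet 𝕜 n r) : Fin n × ℕ → 𝕜 :=
  fun p => if h : p.2 < r + 1 then q (p.1, ⟨p.2, h⟩) else 0

/-- A weight function `wt ξ η z` is a character of the equivalence group: it is multiplicative
under the composition of `x = ξ₁(z), y = η₁(z) w` with `z = ξ₂(t), w = η₂(t) v`. -/
def IsCharacter {𝕜 : Type*} [RCLike 𝕜] (wt : (𝕜 → 𝕜) → (𝕜 → 𝕜) → 𝕜 → 𝕜) : Prop :=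
  ∀ (ξ₁ η₁ ξ₂ η₂ : 𝕜 → 𝕜) (t : 𝕜),
    ContDiffAt 𝕜 ∞ ξ₂ t → deriv ξ₂ t ≠ 0 → ContDiffAt 𝕜 ∞ η₂ t → η₂ t ≠ 0 →
    ContDiffAt 𝕜 ∞ ξ₁ (ξ₂ t) → deriv ξ₁ (ξ₂ t) ≠ 0 → ContDiffAt 𝕜 ∞ η₁ (ξ₂ t) → η₁ (ξ₂ t) ≠ 0 →
    wt (fun s => ξ₁ (ξ₂ s)) (fun s => η₁ (ξ₂ s) * η₂ s) t = wt ξ₁ η₁ (ξ₂ t) * wt ξ₂ η₂ t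

/-- The differential function `F`, defined on the set `U` of jets, is a relative invariant with
weight function `wt`: `F(A, A', …)(z) = wt(τ) F(a, a', …)(ξ(z))` for every transformation `τ`. -/
def IsRelativeInvariantOn {𝕜 : Type*} [RCLike 𝕜] {n : ℕ}
    (wt : (𝕜 → 𝕜) → (𝕜 → 𝕜) → 𝕜 → 𝕜) (U : Set (Fin n × ℕ → 𝕜)) (F : (Fin n × ℕ → 𝕜) → 𝕜) :
    Prop :=
  IsCharacter wt ∧
  ∀ (J D : Set 𝕜) (ξ η : 𝕜 → 𝕜) (a A : Fin n → 𝕜 → 𝕜), IsTransform J D ξ η a A →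
    ∀ z ∈ J, coeffJet a (ξ z) ∈ U → coeffJet A z ∈ U →
      F (coeffJet A z) = wt ξ η z * F (coeffJet a (ξ z))

/-- An absolute invariant: the weight function is identically `1`. -/
def IsAbsoluteInvariantOn {𝕜 : Type*} [RCLike 𝕜] {n : ℕ}
    (U : Set (Fin n × ℕ → 𝕜)) (F : (Fin n × ℕ → 𝕜) → 𝕜) : Prop :=
  IsRelativeInvariantOn (fun _ _ _ => 1) U F

/-- Polynomials in the coefficients and their derivatives. -/
abbrev DiffPoly (𝕜 : Type*) [RCLike 𝕜] (n : ℕ) : Type _ := MvPolynomial (Fin n × ℕ) 𝕜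

/-- Rational functions in the coefficients and their derivatives. -/
abbrev DiffRat (𝕜 : Type*) [RCLike 𝕜] (n : ℕ) : Type _ := FractionRing (DiffPoly 𝕜 n)

/-- Every term of `S` has weight `m`, where the `k`-th derivative of `a_j` has weight `j + k`. -/
def HasWeight {𝕜 : Type*} [RCLike 𝕜] {n : ℕ} (S : DiffPoly 𝕜 n) (m : ℕ) : Prop :=
  MvPolynomial.IsWeightedHomogeneous (fun p : Fin n × ℕ => p.1.val + 1 + p.2) S m

/-- The points at which the reduced denominator of `f` does not vanish. -/
def DiffRat.domain {𝕜 : Type*} [RCLike 𝕜] {n : ℕ} (f : DiffRat 𝕜 n) : Set (Fin n × ℕ → 𝕜) :=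
  {p | MvPolynomial.eval p (IsFractionRing.den (DiffPoly 𝕜 n) f : DiffPoly 𝕜 n) ≠ 0}

/-- The value of `f` at a point of its domain. -/
noncomputable def DiffRat.value {𝕜 : Type*} [RCLike 𝕜] {n : ℕ} (f : DiffRat 𝕜 n)
    (p : Fin n × ℕ → 𝕜) : 𝕜 :=
  MvPolynomial.eval p (IsFractionRing.num (DiffPoly 𝕜 n) f) /
    MvPolynomial.eval p (IsFractionRing.den (DiffPoly 𝕜 n) f : DiffPoly 𝕜 n)

/-- Only derivatives of order at most `r` occur in `f` (written in lowest terms). -/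
def DiffRat.OrderLE {𝕜 : Type*} [RCLike 𝕜] {n : ℕ} (f : DiffRat 𝕜 n) (r : ℕ) : Prop :=
  (∀ p ∈ (IsFractionRing.num (DiffPoly 𝕜 n) f).vars, p.2 ≤ r) ∧
  ∀ p ∈ (IsFractionRing.den (DiffPoly 𝕜 n) f : DiffPoly 𝕜 n).vars, p.2 ≤ r

/-- `I₁, …, I_s` is a fundamental system of absolute invariants of order at most `r`: at every point
of some dense open set of jets, they are defined and functionally independent (their differentials
are linearly independent), and every smooth absolute invariant of order at most `r`, on whatever
open set of jets it is defined, is a smooth function `Φ(I₁, …, I_s)` near that point. -/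
def IsFundamentalOfOrder {𝕜 : Type*} [RCLike 𝕜] {n : ℕ} (r : ℕ) {s : ℕ}
    (I : Fin s → DiffRat 𝕜 n) : Prop :=
  ∃ V : Set (Jet 𝕜 n r), IsOpen V ∧ Dense V ∧ ∀ p ∈ V,
    (∀ i, extendJet p ∈ (I i).domain) ∧
    LinearIndependent 𝕜 (fun i => fderiv 𝕜 (fun q : Jet 𝕜 n r => (I i).value (extendJet q)) p) ∧
    ∀ (U : Set (Jet 𝕜 n r)) (F : Jet 𝕜 n r → 𝕜), IsOpen U → p ∈ U → ContDiffOn 𝕜 ∞ F U →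
      IsAbsoluteInvariantOn (truncJet r ⁻¹' U) (fun q => F (truncJet r q)) →
      ∃ (W : Set (Fin s → 𝕜)) (Φ : (Fin s → 𝕜) → 𝕜), IsOpen W ∧
        (fun i => (I i).value (extendJet p)) ∈ W ∧ ContDiffOn 𝕜 ∞ Φ W ∧
        ∀ᶠ q in 𝓝 p, F q = Φ (fun i => (I i).value (extendJet q))

/-- A set `B` of rational functions is a fundamental set of absolute invariants: its elements are
absolute invariants and, for every `r`, the elements of order at most `r` are finite in number and
form a fundamental system of absolute invariants of order at most `r`. -/
def IsFundamentalSet {𝕜 : Type*} [RCLike 𝕜] {n : ℕ} (B : Set (DiffRat 𝕜 n)) : Prop :=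
  (∀ f ∈ B, IsAbsoluteInvariantOn f.domain f.value) ∧
  ∀ r : ℕ, ∃ (s : ℕ) (I : Fin s → DiffRat 𝕜 n),
    Set.range I = {f | f ∈ B ∧ f.OrderLE r} ∧ IsFundamentalOfOrder r I

/-- The polynomial `S` is a relative invariant of weight `m`: its terms have weight `m`, and
`S_τ = ξ'(z)^m S` for every transformation `τ`. -/
def IsRelativeInvariantOfWeight {𝕜 : Type*} [RCLike 𝕜] {n : ℕ} (S : DiffPoly 𝕜 n) (m : ℕ) : Prop :=
  HasWeight S m ∧
  IsRelativeInvariantOn (fun ξ _ z => deriv ξ z ^ m) Set.univ (fun p => MvPolynomial.eval p S)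

/-! Write (j, k) for the k-th derivative of the coefficient with index j, counted from 0, and m = j
+ k. Let h_i and g_i be the i-th derivatives of η'/η and ξ''/ξ'. After rescaling by powers of ξ',
the transformed coordinate (j, k) is the old one plus C(n,j+1) h_m − C(n,j+2) g_m plus terms of
smaller weight (`restPoly_mem`, `jetAct_eq`). So h_m and g_m can be solved for weight by weight: two
coordinates of total index m with neighbouring j can be given any values, because the determinant
C(n,s+1)² − C(n,s) C(n,s+2) is positive. At m = 0 there is only one coordinate, so g_0 stays free,
as does the dilation ξ'. The coordinates so normalized form the slice (`IsSlice`,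
`exists_jetAct_eq`).

Normalizing the slice to 0 with g_0 = u turns a coordinate i with j ≥ 2 into a polynomial `reduced i
p u`. The group law and the uniqueness of the normalization show that a transformation multiplies it
by ξ' to the weight of i, up to an affine change of u (`reduced_jetAct_scaleJet`). The coordinate
(2, 0) does not depend on u and gives a relative invariant θ of weight 3. One coordinate κ of weight
4 depends on u as κ(0) + k u θ with k ≠ 0 (`reduced_kappaIdx`). Where θ ≠ 0, the equation κ = 0
determines u. Substituting this u into the other reduced coordinates and clearing powers of θ gives
polynomial relative invariants S_i of weight m_i (`relPoly`); the fundamental set consists of the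
quotients S_i³ / θ^(m_i).

Independence: `reduced i` contains the coordinate `pivot i`, two orders higher than i, affinely with
a nonzero constant coefficient, and these dependences are triangular (`reduced_update_pivot`).

Completeness: near a generic jet, equal values of the quotients yield a scale c with θ' = c³θ and
S_i' = c^(m_i) S_i, and then the two jets are equivalent (`eventually_exists_scale`,
`exists_jetAct_eq_of_relPoly`). If f is the map formed by the quotients and σ a local section of f,
an absolute invariant F takes equal values at q and σ(f(q)), so F = (F ∘ σ) ∘ f. If n ≤ 2 or r < 2,
the slice is everything and all invariants are locally constant. -/

/-! ### Transformed coefficients as polynomials in jet coordinates -/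

/-- The jet coordinates in which transformed coefficients are expressed: the rescaled derivatives of
the coefficients, the derivatives of `η'/η` and the derivatives of `ξ''/ξ'`. -/
inductive JetVar (n : ℕ) : Type
  | coef (i : Fin n × ℕ) : JetVar n
  | logEta (i : ℕ) : JetVar n
  | logXi (i : ℕ) : JetVar n

/-- The weight `j + k` of the `k`-th derivative of the `j`-th coefficient. -/
def jetWeight {n : ℕ} (i : Fin n × ℕ) : ℕ := i.1.val + 1 + i.2

namespace JetVar

/-- The weight of a jet coordinate. -/
def weight {n : ℕ} : JetVar n → ℕ
  | coef i => jetWeight i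
  | logEta i => i + 1
  | logXi i => i + 1

/-- The point with prescribed jet coordinates. -/
def point {n : ℕ} {R : Type*} (b : Fin n × ℕ → R) (h g : ℕ → R) : JetVar n → R
  | coef i => b i
  | logEta i => h i
  | logXi i => g i

/-- The coordinates of the transformation of weight less than `s`. -/
def groupBelow (n s : ℕ) : Set (JetVar n) := {v | v.weight < s ∧ ∀ i, v ≠ coef i}

/-- The coordinates of weight less than that of `i`, only those of index at most `i` being allowed
among the coefficients. -/
def lower {n : ℕ} (i : Fin n × ℕ) : Set (JetVar n) :=
  {v | v.weight < jetWeight i ∧ ∀ i', v = coef i' → i'.1 ≤ i.1 ∧ i'.2 ≤ i.2}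

end JetVar

open MvPolynomial JetVar

theorem Derivation.mem_supported_of_mem {σ R : Type*} [CommRing R]
    (D : Derivation R (MvPolynomial σ R) (MvPolynomial σ R)) {s t : Set σ} (hst : s ⊆ t)
    (hD : ∀ v ∈ s, D (X v) ∈ supported R t) {p : MvPolynomial σ R} (hp : p ∈ supported R s) :
    D p ∈ supported R t := by
  induction hp using Algebra.adjoin_induction with
  | mem x hx =>
    obtain ⟨v, hv, rfl⟩ := hx
    exact hD v hv
  | algebraMap r => simp
  | add x y _ _ hx hy => rw [map_add]; exact add_mem hx hy
  | mul x y hx' hy' hx hy =>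
    rw [Derivation.leibniz, smul_eq_mul, smul_eq_mul]
    exact add_mem (mul_mem (supported_mono hst hx') hy) (mul_mem (supported_mono hst hy') hx)

theorem MvPolynomial.X_mem_supported_of_mem {σ R : Type*} [CommRing R] {s : Set σ} {v : σ}
    (hv : v ∈ s) : (X v : MvPolynomial σ R) ∈ supported R s :=
  Algebra.subset_adjoin ⟨v, hv, rfl⟩

/-- Differentiation with respect to the new independent variable. -/
noncomputable def totalDeriv (n : ℕ) :
    Derivation ℤ (MvPolynomial (JetVar n) ℤ) (MvPolynomial (JetVar n) ℤ) :=
  mkDerivation ℤ fun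
    | coef i => X (coef (i.1, i.2 + 1)) + (jetWeight i : MvPolynomial (JetVar n) ℤ) *
        (X (logXi 0) * X (coef i))
    | logEta i => X (logEta (i + 1))
    | logXi i => X (logXi (i + 1))

section
variable {n : ℕ}

@[simp] theorem totalDeriv_coef (i : Fin n × ℕ) : totalDeriv n (X (coef i)) =
    X (coef (i.1, i.2 + 1)) + (jetWeight i : MvPolynomial (JetVar n) ℤ) *
        (X (logXi 0) * X (coef i)) := by
  rw [totalDeriv, mkDerivation_X]

@[simp] theorem totalDeriv_logEta (i : ℕ) :
    totalDeriv n (X (logEta i)) = X (logEta (i + 1)) := by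
  rw [totalDeriv, mkDerivation_X]

@[simp] theorem totalDeriv_logXi (i : ℕ) : totalDeriv n (X (logXi i)) = X (logXi (i + 1)) := by
  rw [totalDeriv, mkDerivation_X]

/-- The coefficient of `w^(m-s)` in `y^(m)`, up to the factor `η / ξ' ^ m`, where `y(ξ) = η w`. -/
noncomputable def chainPoly (n : ℕ) : ℕ → ℕ → MvPolynomial (JetVar n) ℤ
  | _, 0 => 1
  | 0, _ + 1 => 0
  | m + 1, s + 1 => totalDeriv n (chainPoly n m s) +
      (X (logEta 0) - (m : MvPolynomial (JetVar n) ℤ) * X (logXi 0)) * chainPoly n m s +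
      chainPoly n m (s + 1)

/-- The transformed coefficients and their derivatives, as polynomials in the jet coordinates. -/
noncomputable def transPoly (i : Fin n × ℕ) : MvPolynomial (JetVar n) ℤ :=
  (totalDeriv n)^[i.2] (chainPoly n n (i.1.val + 1) +
    ∑ l ∈ Finset.Iic i.1, X (coef (l, 0)) * chainPoly n (n - (l.val + 1)) (i.1.val - l.val))

@[simp] theorem chainPoly_zero_right (m : ℕ) : chainPoly n m 0 = 1 := by cases m <;> rfl

theorem chainPoly_eq_zero {m s : ℕ} (h : m < s) : chainPoly n m s = 0 := by
  induction m generalizing s with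
  | zero => obtain ⟨s, rfl⟩ := Nat.exists_eq_succ_of_ne_zero h.ne'; rfl
  | succ m ih =>
    obtain ⟨s, rfl⟩ := Nat.exists_eq_succ_of_ne_zero (by omega : s ≠ 0)
    rw [Nat.succ_eq_add_one, chainPoly, ih (by omega : m < s), ih (by omega : m < s + 1)]
    simp

theorem groupBelow_mono {s t : ℕ} (h : s ≤ t) : groupBelow n s ⊆ groupBelow n t :=
  fun _ hv => ⟨hv.1.trans_le h, hv.2⟩

theorem logEta_mem_supported {s i : ℕ} (h : i < s) :
    (X (logEta i) : MvPolynomial (JetVar n) ℤ) ∈ supported ℤ (groupBelow n (s + 1)) :=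
  X_mem_supported_of_mem ⟨by simpa [weight] using h, fun _ => by simp⟩

theorem logXi_mem_supported {s i : ℕ} (h : i < s) :
    (X (logXi i) : MvPolynomial (JetVar n) ℤ) ∈ supported ℤ (groupBelow n (s + 1)) :=
  X_mem_supported_of_mem ⟨by simpa [weight] using h, fun _ => by simp⟩

theorem totalDeriv_mem_groupBelow {s : ℕ} {p : MvPolynomial (JetVar n) ℤ}
    (hp : p ∈ supported ℤ (groupBelow n s)) :
    totalDeriv n p ∈ supported ℤ (groupBelow n (s + 1)) := by
  refine Derivation.mem_supported_of_mem _ (groupBelow_mono s.le_succ) ?_ hp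
  rintro (i | i | i) ⟨hv, hv'⟩
  · exact absurd rfl (hv' i)
  · rw [totalDeriv_logEta]; exact logEta_mem_supported hv
  · rw [totalDeriv_logXi]; exact logXi_mem_supported hv

/-- Modulo smaller weight only the linear terms in the two top parameters survive, and the recursion
of `chainPoly` acts on their coefficients by Pascal's rule. For s = 0 they come from the factor
`logEta 0 - m * logXi 0`, since `chainPoly n m 0 = 1`. -/
theorem chainPoly_sub_mem (m s : ℕ) :
    chainPoly n m (s + 1) - ((m.choose (s + 1) : ℕ) : MvPolynomial (JetVar n) ℤ) * X (logEta s) +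
      ((m.choose (s + 2) : ℕ) : MvPolynomial (JetVar n) ℤ) * X (logXi s) ∈
      supported ℤ (groupBelow n (s + 1)) := by
  induction m generalizing s with
  | zero => simp [chainPoly]
  | succ m ih =>
    rw [chainPoly, Nat.choose_succ_succ m s, Nat.choose_succ_succ m (s + 1)]
    cases s with
    | zero =>
      have := ih 0
      convert this using 1
      simp
      ring
    | succ s =>
      have h1 := totalDeriv_mem_groupBelow (ih s)
      have h2 := ih (s + 1)
      have hc : chainPoly n m (s + 1) ∈ supported ℤ (groupBelow n (s + 1 + 1)) := by
        have h3 := supported_mono (R := ℤ) (groupBelow_mono (n := n) (s + 1).le_succ) (ih s)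
        have h4 := mul_mem (natCast_mem (supported ℤ (groupBelow n (s + 1 + 1)))
          (m.choose (s + 1))) (logEta_mem_supported (n := n) (s.lt_succ_self))
        have h5 := mul_mem (natCast_mem (supported ℤ (groupBelow n (s + 1 + 1)))
          (m.choose (s + 2))) (logXi_mem_supported (n := n) (s.lt_succ_self))
        convert sub_mem (add_mem h3 h4) h5 using 1
        ring
      have h6 := mul_mem (sub_mem (logEta_mem_supported (n := n) (s.succ_pos)) (mul_mem
        (natCast_mem (supported ℤ (groupBelow n (s + 1 + 1))) m)
        (logXi_mem_supported (n := n) s.succ_pos))) hc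
      convert add_mem (add_mem h1 h6) h2 using 1
      simp
      ring

theorem chainPoly_mem (m s : ℕ) : chainPoly n m s ∈ supported ℤ (groupBelow n (s + 1)) := by
  cases s with
  | zero => simp
  | succ s =>
    have h3 := supported_mono (R := ℤ) (groupBelow_mono (n := n) (s + 1).le_succ)
      (chainPoly_sub_mem m s)
    have h4 := mul_mem (natCast_mem (supported ℤ (groupBelow n (s + 1 + 1)))
      (m.choose (s + 1))) (logEta_mem_supported (n := n) (s.lt_succ_self))
    have h5 := mul_mem (natCast_mem (supported ℤ (groupBelow n (s + 1 + 1)))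
      (m.choose (s + 2))) (logXi_mem_supported (n := n) (s.lt_succ_self))
    convert sub_mem (add_mem h3 h4) h5 using 1
    ring

theorem groupBelow_subset_lower (i : Fin n × ℕ) : groupBelow n (jetWeight i) ⊆ lower i :=
  fun _ hv => ⟨hv.1, fun i' h => absurd h (hv.2 i')⟩

theorem lower_subset_lower_succ (i : Fin n × ℕ) : lower i ⊆ lower (i.1, i.2 + 1) := by
  rintro v ⟨hv, hv'⟩
  refine ⟨hv.trans (by simp [jetWeight]), fun i' h => ⟨(hv' i' h).1, (hv' i' h).2.trans ?_⟩⟩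
  simp

theorem coef_mem_lower {i i' : Fin n × ℕ} (h : i'.1 ≤ i.1) (h' : i'.2 ≤ i.2) (hne : i' ≠ i) :
    coef i' ∈ lower i := by
  refine ⟨?_, ?_⟩
  · have : (i'.1 : ℕ) ≤ i.1 := h
    simp only [weight, jetWeight]
    rcases Nat.lt_or_ge (i'.1 : ℕ) i.1 with h1 | h1
    · omega
    · rcases Nat.lt_or_ge i'.2 i.2 with h2 | h2
      · omega
      · exact absurd (Prod.ext (le_antisymm h h1) (le_antisymm h' h2)) hne
  · rintro _ h2
    cases h2
    exact ⟨h, h'⟩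

theorem logXi_zero_mem_lower_succ (i : Fin n × ℕ) : logXi 0 ∈ lower (i.1, i.2 + 1) :=
  ⟨by simp [weight, jetWeight]; omega, by simp⟩

theorem totalDeriv_mem_lower {i : Fin n × ℕ} {p : MvPolynomial (JetVar n) ℤ}
    (hp : p ∈ supported ℤ (lower i)) : totalDeriv n p ∈ supported ℤ (lower (i.1, i.2 + 1)) := by
  refine Derivation.mem_supported_of_mem _ (lower_subset_lower_succ i) ?_ hp
  rintro (i' | i' | i') ⟨hv, hv'⟩
  · rw [totalDeriv_coef]
    obtain ⟨h1, h2⟩ := hv' i' rfl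
    refine add_mem (X_mem_supported_of_mem (coef_mem_lower h1 (by simpa using h2) ?_))
      (mul_mem (natCast_mem _ _) (mul_mem
        (X_mem_supported_of_mem (logXi_zero_mem_lower_succ i))
        (X_mem_supported_of_mem (lower_subset_lower_succ i ⟨hv, hv'⟩))))
    rintro h
    obtain ⟨h3, h4⟩ := Prod.mk.inj h
    simp only [weight, jetWeight, h3] at hv
    omega
  · rw [totalDeriv_logEta]
    exact X_mem_supported_of_mem ⟨by simp [weight, jetWeight] at hv ⊢; omega, by simp⟩
  · rw [totalDeriv_logXi]
    exact X_mem_supported_of_mem ⟨by simp [weight, jetWeight] at hv ⊢; omega, by simp⟩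

/-- The part of `transPoly i` that only involves coordinates of smaller weight. -/
noncomputable def restPoly (i : Fin n × ℕ) : MvPolynomial (JetVar n) ℤ :=
  transPoly i - X (coef i) -
    ((n.choose (i.1.val + 1) : ℕ) : MvPolynomial (JetVar n) ℤ) * X (logEta (i.1.val + i.2)) +
    ((n.choose (i.1.val + 2) : ℕ) : MvPolynomial (JetVar n) ℤ) * X (logXi (i.1.val + i.2))

theorem transPoly_succ (j : Fin n) (k : ℕ) :
    transPoly (j, k + 1) = totalDeriv n (transPoly (j, k)) := by
  simp only [transPoly, Function.iterate_succ_apply']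

/-- This is the triangularity on which the solution weight by weight rests. `totalDeriv` raises the
weight by one and preserves it; the rescaling term it produces contains the coordinate of the
previous order, which has smaller weight. -/
theorem restPoly_mem (i : Fin n × ℕ) : restPoly i ∈ supported ℤ (lower i) := by
  obtain ⟨j, k⟩ := i
  induction k with
  | zero =>
    have h1 := supported_mono (R := ℤ) (groupBelow_subset_lower (j, 0)) (chainPoly_sub_mem n j)
    have h2 : ∑ l ∈ Finset.Iio j, X (coef (l, 0)) *
        chainPoly n (n - (l.val + 1)) (j.val - l.val) ∈ supported ℤ (lower (j, 0)) := by
      refine sum_mem fun l hl => mul_mem (X_mem_supported_of_mem ?_) ?_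
      · rw [Finset.mem_Iio] at hl
        exact coef_mem_lower hl.le le_rfl (by simpa using hl.ne)
      · refine supported_mono ((groupBelow_mono ?_).trans (groupBelow_subset_lower _))
          (chainPoly_mem _ _)
        simp [jetWeight]
    convert add_mem h1 h2 using 1
    have : Finset.Iic j = insert j (Finset.Iio j) := by simp
    simp only [restPoly, transPoly, this, Function.iterate_zero, id]
    rw [Finset.sum_insert (by simp)]
    simp
    ring
  | succ k ih =>
    have h1 := totalDeriv_mem_lower ih
    have h2 : (jetWeight (j, k) : MvPolynomial (JetVar n) ℤ) *
        (X (logXi 0) * X (coef (j, k))) ∈ supported ℤ (lower (j, k + 1)) :=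
      mul_mem (natCast_mem _ _) (mul_mem (X_mem_supported_of_mem (logXi_zero_mem_lower_succ (j, k)))
        (X_mem_supported_of_mem (coef_mem_lower le_rfl (Nat.le_succ k) (by simp))))
    convert add_mem h1 h2 using 1
    simp only [restPoly, transPoly_succ]
    simp [add_assoc]
    ring

variable {R : Type*} [CommRing R]

/-- The action of a transformation with `ξ' = 1` on the jets of the coefficients. -/
noncomputable def jetAct (b : Fin n × ℕ → R) (h g : ℕ → R) (i : Fin n × ℕ) : R :=
  aeval (point b h g) (transPoly i)

/-- The part of the action that only involves coordinates of smaller weight. -/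
noncomputable def jetRest (b : Fin n × ℕ → R) (h g : ℕ → R) (i : Fin n × ℕ) : R :=
  aeval (point b h g) (restPoly i)

theorem jetAct_eq (b : Fin n × ℕ → R) (h g : ℕ → R) (i : Fin n × ℕ) :
    jetAct b h g i = b i + n.choose (i.1.val + 1) * h (i.1.val + i.2) -
      n.choose (i.1.val + 2) * g (i.1.val + i.2) + jetRest b h g i := by
  simp [jetAct, jetRest, restPoly, point]

theorem MvPolynomial.aeval_congr_of_mem_supported {σ S : Type*} [CommRing S] {R : Type*}
    [CommRing R] [Algebra S R] {s : Set σ}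
    {p : MvPolynomial σ S} (hp : p ∈ supported S s) {f f' : σ → R} (h : ∀ v ∈ s, f v = f' v) :
    aeval f p = aeval f' p := by
  refine eval₂Hom_congr' rfl (fun v hv _ => h v ?_) rfl
  exact mem_supported.1 hp hv

theorem jetRest_congr {b b' : Fin n × ℕ → R} {h h' g g' : ℕ → R} {i : Fin n × ℕ}
    (hb : ∀ i', i'.1 ≤ i.1 → i'.2 ≤ i.2 → i' ≠ i → b i' = b' i')
    (hh : ∀ m, m < i.1.val + i.2 → h m = h' m) (hg : ∀ m, m < i.1.val + i.2 → g m = g' m) :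
    jetRest b h g i = jetRest b' h' g' i := by
  refine aeval_congr_of_mem_supported (restPoly_mem i) ?_
  rintro (i' | m | m) ⟨hv, hv'⟩
  · refine hb i' (hv' _ rfl).1 (hv' _ rfl).2 ?_
    rintro rfl
    exact lt_irrefl _ hv
  · exact hh m (by simp [weight, jetWeight] at hv; omega)
  · exact hg m (by simp [weight, jetWeight] at hv; omega)

theorem jetAct_congr {b b' : Fin n × ℕ → R} {h h' g g' : ℕ → R} {i : Fin n × ℕ}
    (hb : ∀ i', i'.1 ≤ i.1 → i'.2 ≤ i.2 → b i' = b' i')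
    (hh : ∀ m, m ≤ i.1.val + i.2 → h m = h' m) (hg : ∀ m, m ≤ i.1.val + i.2 → g m = g' m) :
    jetAct b h g i = jetAct b' h' g' i := by
  rw [jetAct_eq, jetAct_eq, hb i le_rfl le_rfl, hh _ le_rfl, hg _ le_rfl,
    jetRest_congr (fun i' h1 h2 _ => hb i' h1 h2) (fun m hm => hh m hm.le) (fun m hm => hg m hm.le)]

theorem map_jetAct {R' : Type*} [CommRing R'] (f : R →+* R') (b : Fin n × ℕ → R) (h g : ℕ → R)
    (i : Fin n × ℕ) :
    f (jetAct b h g i) = jetAct (fun i => f (b i)) (fun m => f (h m)) (fun m => f (g m)) i := by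
  have : (fun v => f (point b h g v)) =
      point (fun i => f (b i)) (fun m => f (h m)) (fun m => f (g m)) := by
    funext v; cases v <;> rfl
  rw [jetAct, jetAct, ← this]
  have := MvPolynomial.map_aeval (point b h g) f (transPoly i)
  rw [this, aeval_def, coe_eval₂Hom]
  congr 1
  exact RingHom.ext_int _ _

/-- The ideal generated by the parameters of the transformation is stable under `totalDeriv` and
contains every `chainPoly n m (s + 1)`. It serves to show that zero parameters act trivially. -/
theorem transPoly_sub_mem (i : Fin n × ℕ) : transPoly i - X (coef i) ∈
    Ideal.span (Set.range (fun m => (X (logEta m) : MvPolynomial (JetVar n) ℤ)) ∪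
      Set.range fun m => X (logXi m)) := by
  set I := Ideal.span (Set.range (fun m => (X (logEta m) : MvPolynomial (JetVar n) ℤ)) ∪
      Set.range fun m => X (logXi m)) with hI
  have hh (m) : (X (logEta m) : MvPolynomial (JetVar n) ℤ) ∈ I :=
    Ideal.subset_span (Or.inl ⟨m, rfl⟩)
  have hg (m) : (X (logXi m) : MvPolynomial (JetVar n) ℤ) ∈ I :=
    Ideal.subset_span (Or.inr ⟨m, rfl⟩)
  have hD : ∀ p ∈ I, totalDeriv n p ∈ I := by
    intro p hp
    induction hp using Submodule.span_induction with
    | mem x hx =>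
      rcases hx with ⟨m, rfl⟩ | ⟨m, rfl⟩
      · simpa using hh _
      · simpa using hg _
    | zero => simp
    | add x y _ _ hx hy => rw [map_add]; exact add_mem hx hy
    | smul a x hx' hx =>
      rw [smul_eq_mul, Derivation.leibniz, smul_eq_mul, smul_eq_mul]
      exact add_mem (I.mul_mem_left _ hx) (I.mul_mem_right _ hx')
  have hc (m s) : chainPoly n m (s + 1) ∈ I := by
    induction m generalizing s with
    | zero => simp [chainPoly]
    | succ m ih =>
      rw [chainPoly]
      refine add_mem (add_mem ?_ (I.mul_mem_right _ (sub_mem (hh 0) (I.mul_mem_left _ (hg 0)))))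
        (ih s)
      cases s with
      | zero => simp
      | succ s => exact hD _ (ih s)
  obtain ⟨j, k⟩ := i
  induction k with
  | zero =>
    have : Finset.Iic j = insert j (Finset.Iio j) := by simp
    simp only [transPoly, this, Function.iterate_zero, id]
    rw [Finset.sum_insert (by simp)]
    simp only [tsub_self, chainPoly_zero_right, mul_one]
    have h1 : ∑ l ∈ Finset.Iio j, X (coef (l, 0)) *
        chainPoly n (n - (l.val + 1)) (j.val - l.val) ∈ I := by
      refine sum_mem fun l hl => I.mul_mem_left _ ?_
      rw [Finset.mem_Iio] at hl
      obtain ⟨s, hs⟩ := Nat.exists_eq_add_of_lt (show l.val < j.val from hl)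
      rw [show j.val - l.val = s + 1 by omega]
      exact hc _ _
    convert add_mem (hc n j.val) h1 using 1
    ring
  | succ k ih =>
    have h1 := hD _ ih
    convert add_mem h1 (I.mul_mem_left (jetWeight (j, k) : MvPolynomial (JetVar n) ℤ)
      (I.mul_mem_right (X (coef (j, k))) (hg 0))) using 1
    rw [transPoly_succ]
    simp
    ring

theorem jetAct_zero_zero (b : Fin n × ℕ → R) : jetAct b (fun _ => 0) (fun _ => 0) = b := by
  funext i
  have h1 := transPoly_sub_mem i
  have h2 : ∀ p ∈ Ideal.span (Set.range (fun m => (X (logEta m) : MvPolynomial (JetVar n) ℤ)) ∪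
      Set.range fun m => X (logXi m)), aeval (point b (fun _ => 0) (fun _ => 0)) p = (0 : R) := by
    intro p hp
    induction hp using Submodule.span_induction with
    | mem x hx => rcases hx with ⟨m, rfl⟩ | ⟨m, rfl⟩ <;> simp [point]
    | zero => simp
    | add x y _ _ hx hy => rw [map_add, hx, hy, add_zero]
    | smul a x hx' hx => rw [smul_eq_mul, map_mul, hx, mul_zero]
  have h3 := h2 _ h1
  rw [map_sub, aeval_X, sub_eq_zero] at h3
  exact h3

end

/-! ### Solving for the parameters on the slice -/

/-- Strict log-concavity: with d = n − s − 1, the left side is (s+1)d / ((s+2)(d+1)) times the right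
side. -/
theorem Nat.choose_mul_choose_lt_sq {n s : ℕ} (h : s + 1 ≤ n) :
    n.choose s * n.choose (s + 2) < n.choose (s + 1) ^ 2 := by
  have h1 := Nat.choose_succ_right_eq n s
  have h2 := Nat.choose_succ_right_eq n (s + 1)
  have hp : 0 < n.choose (s + 1) := Nat.choose_pos h
  obtain ⟨d, rfl⟩ := Nat.exists_eq_add_of_le h
  rw [show s + 1 + d - s = d + 1 by omega] at h1
  rw [show s + 1 + d - (s + 1) = d by omega] at h2
  set A := (s + 1 + d).choose s
  set B := (s + 1 + d).choose (s + 1)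
  set C := (s + 1 + d).choose (s + 1 + 1)
  have h3 : (A * C) * ((d + 1) * (s + 2)) = B ^ 2 * ((s + 1) * d) := by
    calc (A * C) * ((d + 1) * (s + 2)) = (A * (d + 1)) * (C * (s + 1 + 1)) := by ring
      _ = B ^ 2 * ((s + 1) * d) := by rw [← h1, h2]; ring
  have h4 : B ^ 2 * ((s + 1) * d) < B ^ 2 * ((d + 1) * (s + 2)) := by
    have : 0 < B ^ 2 := by positivity
    refine Nat.mul_lt_mul_of_pos_left ?_ this
    nlinarith
  rw [← h3] at h4
  exact lt_of_mul_lt_mul_right h4 (Nat.zero_le _)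

/-- The coordinates of order at most `r` that can be normalized by a transformation. -/
def IsSlice {n : ℕ} (r : ℕ) (i : Fin n × ℕ) : Prop := i.2 ≤ r ∧ (i.1.val ≤ 1 ∨ r ≤ i.2 + 1)

/-- The determinant of the system that determines the parameters of a given weight. -/
def chooseDet (n s : ℕ) : ℕ := n.choose (s + 1) ^ 2 - n.choose s * n.choose (s + 2)

theorem chooseDet_pos {n s : ℕ} (h : s + 1 ≤ n) : 0 < chooseDet n s :=
  Nat.sub_pos_of_lt (Nat.choose_mul_choose_lt_sq h)

theorem cast_chooseDet {R : Type*} [CommRing R] {n s : ℕ} (h : s + 1 ≤ n) :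
    (chooseDet n s : R) = n.choose (s + 1) ^ 2 - n.choose s * n.choose (s + 2) := by
  rw [chooseDet, Nat.cast_sub (Nat.choose_mul_choose_lt_sq h).le]
  push_cast
  ring

section
variable {n : ℕ} {R : Type*} [CommRing R]

/-- Cramer's rule with determinant `chooseDet n s`. The ring is only assumed to invert nonzero
integers, so that the result also applies to polynomial rings, that is, to generic jets. -/
theorem exists_choose_system (hR : ∀ m : ℕ, m ≠ 0 → IsUnit (m : R)) {s : ℕ} (hs : s + 1 ≤ n)
    (x y : R) : ∃ h g : R, n.choose s * h - n.choose (s + 1) * g = x ∧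
      n.choose (s + 1) * h - n.choose (s + 2) * g = y := by
  obtain ⟨e, he⟩ := (hR _ (chooseDet_pos hs).ne').exists_right_inv
  rw [cast_chooseDet hs] at he
  refine ⟨(n.choose (s + 1) * y - n.choose (s + 2) * x) * e,
    (n.choose s * y - n.choose (s + 1) * x) * e, ?_, ?_⟩
  · linear_combination x * he
  · linear_combination y * he

theorem choose_system_unique (hR : ∀ m : ℕ, m ≠ 0 → IsUnit (m : R)) {s : ℕ} (hs : s + 1 ≤ n)
    {h g : R} (h1 : n.choose s * h - n.choose (s + 1) * g = 0)
    (h2 : n.choose (s + 1) * h - n.choose (s + 2) * g = 0) : h = 0 ∧ g = 0 := by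
  have hu := hR _ (chooseDet_pos hs).ne'
  rw [cast_chooseDet hs] at hu
  constructor
  · rw [← hu.mul_right_eq_zero]
    linear_combination (n.choose (s + 1) : R) * h2 - (n.choose (s + 2) : R) * h1
  · rw [← hu.mul_right_eq_zero]
    linear_combination (n.choose s : R) * h2 - (n.choose (s + 1) : R) * h1

/-- Each total index m has at most two slice coordinates, as many as there are parameters: (0, m)
and (1, m − 1) if m ≤ r, those of orders r and r − 1 if m > r. Truncated subtraction covers both
cases. -/
theorem IsSlice.val_eq {r m : ℕ} {i : Fin n × ℕ} (hi : IsSlice r i) (hm : i.1.val + i.2 = m) :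
    i.1.val = m - r ∨ (i.1.val = m - r + 1 ∧ 0 < m) := by
  obtain ⟨h1, h2⟩ := hi
  omega

/-- The slice coordinates can be given arbitrary values by a transformation with prescribed
second derivative. -/
theorem exists_jetAct_eq (hR : ∀ m : ℕ, m ≠ 0 → IsUnit (m : R)) (r : ℕ) (b c : Fin n × ℕ → R)
    (u : R) : ∃ h g : ℕ → R, g 0 = u ∧ ∀ i, IsSlice r i → jetAct b h g i = c i := by
  suffices H : ∀ N : ℕ, ∃ h g : ℕ → R, g 0 = u ∧
      ∀ i, IsSlice r i → i.1.val + i.2 < N → jetAct b h g i = c i by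
    obtain ⟨h, g, hg, H⟩ := H (n + r)
    exact ⟨h, g, hg, fun i hi => H i hi (add_lt_add_of_lt_of_le i.1.2 hi.1)⟩
  intro N
  induction N with
  | zero => exact ⟨fun _ => 0, fun _ => u, rfl, fun i _ h => absurd h (Nat.not_lt_zero _)⟩
  | succ N ih =>
    obtain ⟨h, g, hg, H⟩ := ih
    obtain ⟨x, y, hy, hxy⟩ : ∃ x y : R, (N = 0 → y = u) ∧ ∀ i, IsSlice r i → i.1.val + i.2 = N →
        (n.choose (i.1.val + 1) : R) * x - n.choose (i.1.val + 2) * y =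
          c i - b i - jetRest b h g i := by
      -- At total index 0 the parameter g 0 is prescribed, and the single coordinate (0, 0)
      -- determines h 0.
      rcases Nat.eq_zero_or_pos N with rfl | hN
      · rcases Nat.eq_zero_or_pos n with rfl | hn
        · exact ⟨0, u, fun _ => rfl, fun i => i.1.elim0⟩
        · obtain ⟨e, he⟩ := (hR _ hn.ne').exists_right_inv
          refine ⟨e * (c (⟨0, hn⟩, 0) - b (⟨0, hn⟩, 0) - jetRest b h g (⟨0, hn⟩, 0) +
            n.choose 2 * u), u, fun _ => rfl, ?_⟩
          rintro ⟨⟨j, hj⟩, k⟩ - hi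
          obtain ⟨rfl, rfl⟩ : j = 0 ∧ k = 0 := by simpa using hi
          simp only [zero_add, Nat.choose_one_right]
          linear_combination (c (⟨0, hn⟩, 0) - b (⟨0, hn⟩, 0) - jetRest b h g (⟨0, hn⟩, 0) +
            n.choose 2 * u) * he
      · rcases Nat.lt_or_ge (N - r + 1) n with hs | hs
        -- For N < r the first slice coordinate is (0, N) rather than (N − r, r), hence the case
        -- distinction.
        · obtain ⟨x, y, hx, hy⟩ := exists_choose_system hR (s := N - r + 1) (n := n) hs
            (if hk : r ≤ N then c (⟨N - r, by omega⟩, r) - b (⟨N - r, by omega⟩, r) -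
              jetRest b h g (⟨N - r, by omega⟩, r) else
              c (⟨0, by omega⟩, N) - b (⟨0, by omega⟩, N) - jetRest b h g (⟨0, by omega⟩, N))
            (c (⟨N - r + 1, hs⟩, N - (N - r + 1)) - b (⟨N - r + 1, hs⟩, N - (N - r + 1)) -
              jetRest b h g (⟨N - r + 1, hs⟩, N - (N - r + 1)))
          refine ⟨x, y, fun h => absurd h hN.ne', ?_⟩
          rintro ⟨⟨j, hj⟩, k⟩ hi hik
          rcases hi.val_eq hik with h1 | ⟨h1, -⟩
          · simp only at h1 hik
            subst h1
            split_ifs at hx with hk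
            · obtain rfl : k = r := by omega
              exact hx
            · obtain ⟨h1, h2⟩ : N - r = 0 ∧ k = N := by omega
              simp only [h1, h2] at hx ⊢
              exact hx
          · simp only at h1 hik
            subst h1
            obtain rfl : k = N - (N - r + 1) := by omega
            exact hy
        · rcases Nat.lt_or_ge (N - r) n with hs' | hs'
          -- At the top index only (n − 1, r) is left; its equation reads C(n,n) x − C(n,n+1) y = x,
          -- so y may be 0.
          · have hn : N - r + 1 = n := by omega
            refine ⟨c (⟨N - r, hs'⟩, N - (N - r)) - b (⟨N - r, hs'⟩, N - (N - r)) -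
              jetRest b h g (⟨N - r, hs'⟩, N - (N - r)), 0, fun h => absurd h hN.ne', ?_⟩
            rintro ⟨⟨j, hj⟩, k⟩ hi hik
            rcases hi.val_eq hik with h1 | ⟨h1, -⟩
            · simp only at h1 hik
              subst h1
              obtain rfl : k = N - (N - r) := by omega
              simp [hn]
            · simp only at h1
              omega
          · refine ⟨0, 0, fun h => absurd h hN.ne', ?_⟩
            rintro ⟨⟨j, hj⟩, k⟩ hi hik
            rcases hi.val_eq hik with h1 | ⟨h1, -⟩ <;> simp only at h1 <;> omega
    have hu (f : ℕ → R) (z : R) (m : ℕ) (hm : m < N) : Function.update f N z m = f m :=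
      Function.update_of_ne hm.ne _ _
    refine ⟨Function.update h N x, Function.update g N y, ?_, fun i hi hiN => ?_⟩
    · rcases Nat.eq_zero_or_pos N with rfl | hN
      · simp [hy]
      · rw [hu _ _ _ hN, hg]
    · rcases Nat.lt_succ_iff_lt_or_eq.1 hiN with h1 | h1
      · rw [← H i hi h1]
        exact jetAct_congr (fun _ _ _ => rfl) (fun m hm => hu _ _ _ (hm.trans_lt h1))
          (fun m hm => hu _ _ _ (hm.trans_lt h1))
      · rw [jetAct_eq, jetRest_congr (b' := b) (h' := h) (g' := g) (fun _ _ _ _ => rfl)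
          (fun m hm => hu _ _ _ (hm.trans_eq h1)) (fun m hm => hu _ _ _ (hm.trans_eq h1)), h1,
          Function.update_self, Function.update_self]
        linear_combination hxy i hi h1

/-- The parameters of a transformation are determined by its effect on the slice coordinates. -/
theorem jetAct_param_unique (hR : ∀ m : ℕ, m ≠ 0 → IsUnit (m : R)) {r N : ℕ} (hr : 1 ≤ r)
    (hn : 2 ≤ n) (hN : N < n + r) {b b' : Fin n × ℕ → R} {h h' g g' : ℕ → R} (hg : g 0 = g' 0)
    (hb : ∀ i, i.2 ≤ r → (i.1.val + i.2 + 1 < N ∨ (i.1.val + i.2 + 1 = N ∧ IsSlice r i)) →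
      b i = b' i)
    (hact : ∀ i, IsSlice r i → i.1.val + i.2 < N → jetAct b h g i = jetAct b' h' g' i) :
    ∀ m < N, h m = h' m ∧ g m = g' m := by
  intro m
  induction m using Nat.strong_induction_on with
  | _ m ih =>
  intro hm
  have key : ∀ i : Fin n × ℕ, IsSlice r i → i.1.val + i.2 = m →
      (n.choose (i.1.val + 1) : R) * (h m - h' m) - n.choose (i.1.val + 2) * (g m - g' m) = 0 := by
    intro i hi him
    have h1 := hact i hi (him.trans_lt hm)
    have h2 : b i = b' i := by
      refine hb i hi.1 ?_
      rcases Nat.lt_or_ge (i.1.val + i.2 + 1) N with h | h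
      · exact Or.inl h
      · exact Or.inr ⟨by omega, hi⟩
    rw [jetAct_eq, jetAct_eq, jetRest_congr (b' := b') (h' := h') (g' := g') ?_ ?_ ?_, him, h2]
      at h1
    · linear_combination h1
    · intro i' h3 h4 h5
      refine hb i' (h4.trans hi.1) (Or.inl ?_)
      have h6 : i'.1.val ≤ i.1.val := h3
      have : ¬ (i'.1.val = i.1.val ∧ i'.2 = i.2) := fun h => h5 (Prod.ext (Fin.ext h.1) h.2)
      omega
    · exact fun m' hm' => (ih m' (by omega) (by omega)).1
    · exact fun m' hm' => (ih m' (by omega) (by omega)).2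
  rcases Nat.eq_zero_or_pos m with rfl | hm0
  · have h1 := key (⟨0, by omega⟩, 0) ⟨by simp, Or.inl (by simp)⟩ rfl
    simp only [hg, sub_self, mul_zero, sub_zero, zero_add, Nat.choose_one_right] at h1
    exact ⟨sub_eq_zero.1 (((hR n (by omega)).mul_right_eq_zero).1 h1), hg⟩
  -- Both slice coordinates of total index m exist because m < N < n + r; the orders are min(m, r)
  -- and what remains for the next coefficient.
  · have h1 := key (⟨m - r, by omega⟩, m - (m - r)) ⟨by simp only; omega, by simp only; omega⟩
      (by simp only; omega)
    have h2 := key (⟨m - r + 1, by omega⟩, m - (m - r + 1))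
      ⟨by simp only; omega, by simp only; omega⟩ (by simp only; omega)
    have h3 := choose_system_unique hR (s := m - r + 1) (by omega) h1 h2
    exact ⟨sub_eq_zero.1 h3.1, sub_eq_zero.1 h3.2⟩

end

/-! ### Reduced coordinates: values on the normal form -/

section
variable {n : ℕ} (K : Type*) [Field K] [CharZero K]

theorem isUnit_natCast_mvPolynomial {σ : Type*} (m : ℕ) (hm : m ≠ 0) :
    IsUnit (m : MvPolynomial σ K) := by
  rw [← map_natCast (C : K →+* MvPolynomial σ K) m]
  exact (IsUnit.mk0 _ (Nat.cast_ne_zero.2 hm)).map C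

theorem isUnit_natCast_field (m : ℕ) (hm : m ≠ 0) : IsUnit (m : K) :=
  IsUnit.mk0 _ (Nat.cast_ne_zero.2 hm)

/-- Normalizing the generic jet over a polynomial ring, with g 0 an extra variable, and then
specializing gives polynomial dependence. For i.1 ≥ 2 the order i.2 + 2 is the least one at which i
is no longer a slice coordinate. -/
theorem exists_reducedPoly (i : Fin n × ℕ) : ∃ Q : MvPolynomial (Option (Fin n × ℕ)) K,
    ∀ (p : Fin n × ℕ → K) (u : K), ∃ h g : ℕ → K, g 0 = u ∧
      (∀ i', IsSlice (i.2 + 2) i' → jetAct p h g i' = 0) ∧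
      jetAct p h g i = eval (fun o => o.elim u p) Q := by
  obtain ⟨h, g, hg, H⟩ := exists_jetAct_eq (isUnit_natCast_mvPolynomial K) (i.2 + 2)
    (fun v => X (some v)) (fun _ => 0) (X none : MvPolynomial (Option (Fin n × ℕ)) K)
  refine ⟨jetAct (fun v => X (some v)) h g i, fun p u => ⟨fun m => eval (fun o => o.elim u p) (h m),
    fun m => eval (fun o => o.elim u p) (g m), by simp [hg], fun i' hi' => ?_, ?_⟩⟩
  · have := congrArg (eval (fun o => o.elim u p)) (H i' hi')
    rw [map_jetAct] at this
    simpa using this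
  · rw [map_jetAct]
    simp

/-- The coordinate `i` of the normal form, as a polynomial in the jet and in the value of `ξ''`. -/
noncomputable def reducedPoly (i : Fin n × ℕ) : MvPolynomial (Option (Fin n × ℕ)) K :=
  (exists_reducedPoly K i).choose

variable {K}

/-- The coordinate `i` of the normal form of the jet `p` for transformations with `ξ'' = u`. -/
noncomputable def reduced (i : Fin n × ℕ) (p : Fin n × ℕ → K) (u : K) : K :=
  eval (fun o => o.elim u p) (reducedPoly K i)

theorem exists_jetAct_eq_reduced (i : Fin n × ℕ) (p : Fin n × ℕ → K) (u : K) :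
    ∃ h g : ℕ → K, g 0 = u ∧ (∀ i', IsSlice (i.2 + 2) i' → jetAct p h g i' = 0) ∧
      jetAct p h g i = reduced i p u :=
  (exists_reducedPoly K i).choose_spec p u

theorem val_add_lt_of_le {i i' : Fin n × ℕ} (h3 : i'.1 ≤ i.1) (h4 : i'.2 ≤ i.2) (h5 : i' ≠ i) :
    i'.1.val + i'.2 < i.1.val + i.2 := by
  have h6 : i'.1.val ≤ i.1.val := h3
  have : ¬ (i'.1.val = i.1.val ∧ i'.2 = i.2) := fun h => h5 (Prod.ext (Fin.ext h.1) h.2)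
  omega

/-- The parameters that enter coordinate i are determined by the coordinates on which p and p'
agree, so both jets are normalized by the same ones up to this weight. The results then differ only
in the linear term of i itself. -/
theorem reduced_eq_of_agree {i : Fin n × ℕ} (hi : 2 ≤ i.1.val) {p p' : Fin n × ℕ → K} {u : K}
    (hp : ∀ i', i'.2 ≤ i.2 + 2 → (i'.1.val + i'.2 < i.1.val + i.2 ∨
      (i'.1.val + i'.2 = i.1.val + i.2 ∧ IsSlice (i.2 + 2) i')) → p i' = p' i')
    {h g : ℕ → K} (hg : g 0 = u)
    (hs : ∀ i', IsSlice (i.2 + 2) i' → i'.1.val + i'.2 ≤ i.1.val + i.2 → jetAct p' h g i' = 0) :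
    reduced i p u = jetAct p' h g i + p i - p' i := by
  obtain ⟨h', g', hg', hs', hr⟩ := exists_jetAct_eq_reduced i p u
  have hlt := i.1.2
  have key := jetAct_param_unique (isUnit_natCast_field K) (r := i.2 + 2)
    (N := i.1.val + i.2 + 1) (by omega) (by omega) (by omega) (hg.trans hg'.symm) (b := p')
    (b' := p) (h := h) (h' := h')
    (fun i' h1 h2 => (hp i' h1 (h2.imp (by omega) (fun h => ⟨by omega, h.2⟩))).symm)
    (fun i' h1 h2 => by rw [hs i' h1 (by omega), hs' i' h1])
  rw [← hr, jetAct_eq, jetAct_eq, (key _ (Nat.lt_succ_self _)).1, (key _ (Nat.lt_succ_self _)).2,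
    jetRest_congr (b' := p') (h' := h) (g' := g) ?_ ?_ ?_]
  · ring
  · exact fun i' h1 h2 h3 => hp i' (by omega) (Or.inl (val_add_lt_of_le h1 h2 h3))
  · exact fun m hm => (key m (by omega)).1.symm
  · exact fun m hm => (key m (by omega)).2.symm

theorem reduced_eq {i : Fin n × ℕ} (hi : 2 ≤ i.1.val) {p : Fin n × ℕ → K} {u : K}
    {h g : ℕ → K} (hg : g 0 = u)
    (hs : ∀ i', IsSlice (i.2 + 2) i' → i'.1.val + i'.2 ≤ i.1.val + i.2 → jetAct p h g i' = 0) :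
    reduced i p u = jetAct p h g i := by
  rw [reduced_eq_of_agree hi (fun _ _ _ => rfl) hg hs, add_sub_cancel_right]

theorem reduced_sub_of_agree {i : Fin n × ℕ} (hi : 2 ≤ i.1.val) {p p' : Fin n × ℕ → K} (u : K)
    (hp : ∀ i', i'.2 ≤ i.2 + 2 → (i'.1.val + i'.2 < i.1.val + i.2 ∨
      (i'.1.val + i'.2 = i.1.val + i.2 ∧ IsSlice (i.2 + 2) i')) → p i' = p' i') :
    reduced i p u - p i = reduced i p' u - p' i := by
  obtain ⟨h', g', hg', hs', hr⟩ := exists_jetAct_eq_reduced i p' u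
  rw [reduced_eq_of_agree hi hp hg' (fun i' h1 _ => hs' i' h1), hr]
  ring

theorem reduced_congr {i : Fin n × ℕ} (hi : 2 ≤ i.1.val) {p p' : Fin n × ℕ → K} (u : K)
    (hp : ∀ i', i'.2 ≤ i.2 + 2 → i'.1.val + i'.2 ≤ i.1.val + i.2 → p i' = p' i') :
    reduced i p u = reduced i p' u := by
  have := reduced_sub_of_agree hi u (fun i' h1 h2 => hp i' h1 (h2.elim le_of_lt (fun h => h.1.le)))
  rw [hp i (by omega) le_rfl] at this
  exact sub_left_injective this

/-- The coordinate of highest order on which the reduced coordinate `i` depends. -/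
def pivot (i : Fin n × ℕ) : Fin n × ℕ := (⟨i.1.val - 2, (Nat.sub_le _ _).trans_lt i.1.2⟩, i.2 + 2)

theorem pivot_val_add {i : Fin n × ℕ} (hi : 2 ≤ i.1.val) :
    (pivot i).1.val + (pivot i).2 = i.1.val + i.2 := by
  simp only [pivot]
  omega

/-- The coefficient of the pivot coordinate in a reduced coordinate. -/
noncomputable def pivotCoeff (K : Type*) [Field K] (i : Fin n × ℕ) : K :=
  chooseDet n i.1.val / chooseDet n (i.1.val - 1)

theorem pivotCoeff_ne_zero {i : Fin n × ℕ} (hi : 2 ≤ i.1.val) : pivotCoeff K i ≠ 0 := by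
  have := i.1.2
  refine div_ne_zero ?_ ?_ <;> exact Nat.cast_ne_zero.2 (chooseDet_pos (by omega)).ne'

end

/-! ### Explicit dependence on the pivot and on ξ'' -/

section
variable {n : ℕ} {R : Type*} [CommRing R]

theorem jetAct_update_param {b : Fin n × ℕ → R} {h g : ℕ → R} {m : ℕ} (x y : R)
    {i : Fin n × ℕ} (hi : i.1.val + i.2 = m) :
    jetAct b (Function.update h m x) (Function.update g m y) i = jetAct b h g i +
      n.choose (i.1.val + 1) * (x - h m) - n.choose (i.1.val + 2) * (y - g m) := by
  rw [jetAct_eq, jetAct_eq, jetRest_congr (b' := b) (h' := h) (g' := g) (fun _ _ _ _ => rfl), hi,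
    Function.update_self, Function.update_self]
  · ring
  · exact fun m' hm' => Function.update_of_ne (hm'.trans_eq hi).ne _ _
  · exact fun m' hm' => Function.update_of_ne (hm'.trans_eq hi).ne _ _

theorem jetAct_update_param_of_lt {b : Fin n × ℕ → R} {h g : ℕ → R} {m : ℕ} (x y : R)
    {i : Fin n × ℕ} (hi : i.1.val + i.2 < m) :
    jetAct b (Function.update h m x) (Function.update g m y) i = jetAct b h g i :=
  jetAct_congr (fun _ _ _ => rfl)
    (fun _ hm' => Function.update_of_ne (hm'.trans_lt hi).ne _ _)
    (fun _ hm' => Function.update_of_ne (hm'.trans_lt hi).ne _ _)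

theorem chainPoly_one (m : ℕ) : chainPoly n m 1 = (m : MvPolynomial (JetVar n) ℤ) *
    X (logEta 0) - ((m.choose 2 : ℕ) : MvPolynomial (JetVar n) ℤ) * X (logXi 0) := by
  induction m with
  | zero => simp [chainPoly]
  | succ m ih =>
    rw [chainPoly, zero_add, ih, Nat.choose_succ_succ m 1]
    simp
    ring

variable {b : Fin n × ℕ → R} (h g : ℕ → R) {j : Fin n}

theorem aeval_chainPoly_point (b : Fin n × ℕ → R) (m s : ℕ) :
    aeval (point b h g) (chainPoly n m s) = aeval (point (fun _ => 0) h g) (chainPoly n m s) := by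
  refine aeval_congr_of_mem_supported (chainPoly_mem m s) ?_
  rintro (i | i | i) ⟨-, hv⟩
  · exact absurd rfl (hv i)
  · rfl
  · rfl

theorem aeval_totalDeriv_chainPoly_point (b : Fin n × ℕ → R) (m s : ℕ) :
    aeval (point b h g) (totalDeriv n (chainPoly n m s)) =
      aeval (point (fun _ => 0) h g) (totalDeriv n (chainPoly n m s)) := by
  refine aeval_congr_of_mem_supported (totalDeriv_mem_groupBelow (chainPoly_mem m s)) ?_
  rintro (i | i | i) ⟨-, hv⟩
  · exact absurd rfl (hv i)
  · rfl
  · rfl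

theorem jetAct_zero_right (b : Fin n × ℕ → R) (j : Fin n) :
    jetAct b h g (j, 0) = jetAct (fun _ => 0) h g (j, 0) + ∑ l ∈ Finset.Iic j, b (l, 0) *
      aeval (point b h g) (chainPoly n (n - (l.val + 1)) (j.val - l.val)) := by
  simp [jetAct, transPoly, point, aeval_chainPoly_point h g b]

theorem jetAct_one_right (b : Fin n × ℕ → R) (j : Fin n) :
    jetAct b h g (j, 1) = jetAct (fun _ => 0) h g (j, 1) + ∑ l ∈ Finset.Iic j,
      (b (l, 0) * aeval (point b h g) (totalDeriv n
        (chainPoly n (n - (l.val + 1)) (j.val - l.val))) +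
      aeval (point b h g) (chainPoly n (n - (l.val + 1)) (j.val - l.val)) *
        (b (l, 1) + jetWeight (l, 0) * (g 0 * b (l, 0)))) := by
  simp [jetAct, transPoly, point, aeval_totalDeriv_chainPoly_point h g b]

/-- The action on the first derivative of the first nonzero coefficient. -/
theorem jetAct_one_of_vanish (hb : ∀ i : Fin n × ℕ, i.1 < j → i.2 ≤ 1 → b i = 0) :
    jetAct b h g (j, 1) = jetAct (fun _ => 0) h g (j, 1) + b (j, 1) +
      (j.val + 1) * g 0 * b (j, 0) := by
  rw [jetAct_one_right, Finset.sum_eq_single_of_mem j (Finset.mem_Iic.2 le_rfl)]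
  · simp [jetWeight]
    ring
  · intro l hl hne
    have hlt := lt_of_le_of_ne (Finset.mem_Iic.1 hl) hne
    rw [hb (l, 0) hlt zero_le_one, hb (l, 1) hlt le_rfl]
    simp

/-- The action on the coefficient that follows the first nonzero one. -/
theorem jetAct_zero_of_vanish {j' : Fin n} (hj : j'.val = j.val + 1)
    (hb : ∀ i : Fin n × ℕ, i.1 < j → i.2 = 0 → b i = 0) :
    jetAct b h g (j', 0) = jetAct (fun _ => 0) h g (j', 0) + b (j', 0) +
      b (j, 0) * ((n - (j.val + 1) : ℕ) * h 0 - (n - (j.val + 1)).choose 2 * g 0) := by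
  have hjj' : j < j' := Fin.lt_def.2 (by omega)
  rw [jetAct_zero_right, ← Finset.sum_subset (s₁ := {j, j'})]
  · rw [Finset.sum_pair hjj'.ne, hj]
    simp [chainPoly_one, point]
    ring
  · intro l
    simp only [Finset.mem_insert, Finset.mem_singleton, Finset.mem_Iic]
    rintro (rfl | rfl)
    · exact hjj'.le
    · exact le_rfl
  · intro l hl hne
    simp only [Finset.mem_insert, Finset.mem_singleton, Finset.mem_Iic, not_or] at hl hne
    have h1 : l.val ≤ j'.val := hl
    have h2 : l.val ≠ j.val := fun h => hne.1 (Fin.ext h)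
    have h3 : l.val ≠ j'.val := fun h => hne.2 (Fin.ext h)
    rw [hb (l, 0) (Fin.lt_def.2 (by simp only; omega)) rfl, zero_mul]

end

section
variable {n : ℕ} {K : Type*} [Field K] [CharZero K]

/-- The pivot has the same total index m as i and is a slice coordinate of order i.2 + 2. Moving it
by t spoils one equation of the system for h m and g m; the Cramer correction changes coordinate i
by t times a quotient of two determinants. -/
theorem reduced_update_pivot {i : Fin n × ℕ} (hi : 2 ≤ i.1.val) (p : Fin n × ℕ → K) (u x : K) :
    reduced i (Function.update p (pivot i) x) u =
      reduced i p u + pivotCoeff K i * (x - p (pivot i)) := by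
  classical
  obtain ⟨h, g, hg, hs, hr⟩ := exists_jetAct_eq_reduced i p u
  set m := i.1.val + i.2 with hm
  set t := x - p (pivot i) with ht
  have hlt := i.1.2
  have hD : (chooseDet n (i.1.val - 1) : K) ≠ 0 :=
    Nat.cast_ne_zero.2 (chooseDet_pos (by omega)).ne'
  have hD' := cast_chooseDet (R := K) (n := n) (s := i.1.val - 1) (by omega)
  have hD'' := cast_chooseDet (R := K) (n := n) (s := i.1.val) (by omega)
  set D : K := ((chooseDet n (i.1.val - 1) : ℕ) : K) with hDdef
  obtain ⟨a, ha⟩ : ∃ a, i.1.val = a + 2 := ⟨i.1.val - 2, by omega⟩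
  have e1 : i.1.val - 1 = a + 1 := by omega
  rw [e1] at hD'
  rw [ha] at hD''
  have hupd (i' : Fin n × ℕ) (hne : i' ≠ pivot i) : Function.update p (pivot i) x i' = p i' :=
    Function.update_of_ne hne _ _
  have hrest (i' : Fin n × ℕ) (hi' : i'.1.val + i'.2 ≤ m) :
      jetRest (Function.update p (pivot i) x) h g i' = jetRest p h g i' := by
    refine jetRest_congr (fun i'' h1 h2 h3 => hupd _ ?_) (fun _ _ => rfl) (fun _ _ => rfl)
    rintro rfl
    have := val_add_lt_of_le h1 h2 h3
    rw [pivot_val_add hi] at this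
    omega
  have hact (i' : Fin n × ℕ) (hi' : i'.1.val + i'.2 ≤ m) (hne : i' ≠ pivot i) :
      jetAct (Function.update p (pivot i) x) h g i' = jetAct p h g i' := by
    rw [jetAct_eq, jetAct_eq, hrest i' hi', hupd _ hne]
  have hact' : jetAct (Function.update p (pivot i) x) h g (pivot i) =
      jetAct p h g (pivot i) + t := by
    rw [jetAct_eq, jetAct_eq, hrest _ (pivot_val_add hi).le, Function.update_self, ht]
    ring
  -- With a = i.1 − 2, the corrections dh and dg solve C(n,a+1) dh − C(n,a+2) dg = −t and C(n,a+2)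
  -- dh − C(n,a+3) dg = 0.
  rw [reduced_eq hi (h := Function.update h m (h m + t * n.choose (a + 3) / D))
    (g := Function.update g m (g m + t * n.choose (a + 2) / D))]
  · rw [jetAct_update_param _ _ rfl, hact i le_rfl, hr, pivotCoeff, ← hDdef, ← hm, ha, hD'']
    · field_simp
      ring
    · intro h
      have := congrArg (fun q => q.2) h
      simp [pivot] at this
  · rw [Function.update_of_ne (by omega), hg]
  · intro i' h1 h2
    rcases Nat.lt_or_ge (i'.1.val + i'.2) m with h3 | h3
    · rw [jetAct_update_param_of_lt _ _ h3, hact i' h2, hs i' h1]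
      rintro rfl
      rw [pivot_val_add hi] at h3
      omega
    · have h4 : i'.1.val + i'.2 = m := le_antisymm h2 h3
      rw [jetAct_update_param _ _ h4]
      rcases h1.val_eq h4 with h5 | ⟨h5, -⟩
      · have h6 : i'.1.val = a := by omega
        have h7 : i' = pivot i := by
          refine Prod.ext (Fin.ext ?_) ?_ <;> simp only [pivot] <;> omega
        rw [h7, hact', hs _ (h7 ▸ h1), ← h7, h6]
        field_simp
        rw [hD']
        ring
      · have h6 : i'.1.val = a + 1 := by omega
        rw [hact i' h2, hs i' h1, h6]
        · field_simp
          ring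
        · rintro rfl
          simp only [pivot] at h6
          omega

/-- This provides κ for n = 3. The slice coordinates of total index at most 3 involve only
coefficients of index 0 and 1, which vanish, so the normalization of the zero jet also works for p.
The middle term is the logarithmic derivative of the factor ξ'^3 in front of (2, 0). -/
theorem reduced_eq_of_slice_three {j : Fin n} (hj : j.val = 2) {p : Fin n × ℕ → K}
    (hp : ∀ i, IsSlice 3 i → p i = 0) (u : K) :
    reduced (j, 1) p u = p (j, 1) + 3 * u * p (j, 0) + reduced (j, 1) (fun _ => 0) u := by
  obtain ⟨h, g, hg, hs, hr⟩ := exists_jetAct_eq_reduced (j, 1) (fun _ => 0) u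
  rw [reduced_eq (p := p) (by simp [hj]) hg, ← hr, jetAct_one_of_vanish, hg, hj]
  · push_cast
    ring
  · intro i h1 h2
    have h3 : i.1.val < j.val := h1
    exact hp i ⟨by omega, by omega⟩
  · intro i h1 h2
    rw [← hs i h1]
    refine jetAct_congr (fun i' h3 h4 => hp i' ?_) (fun _ _ => rfl) (fun _ _ => rfl)
    have h5 : i'.1.val ≤ i.1.val := h3
    obtain ⟨h6, h7⟩ := h1
    simp only [hj] at h2 h6 h7
    exact ⟨by omega, by omega⟩

/-- This provides κ for n > 3. The coordinate (2, 0) feeds u into (3, 0) directly, with factor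
3(n−3)/2. It also displaces the slice coordinate (2, 1) by 3u times (2, 0), and undoing this at
index 3 contributes −6(n−3)/5; the sum is 3(n−3)/10. -/
theorem reduced_eq_of_slice_two {j j' : Fin n} (hj : j.val = 2) (hj' : j'.val = 3)
    {p : Fin n × ℕ → K} (hp : ∀ i, IsSlice 2 i → p i = 0) (u : K) :
    reduced (j', 0) p u = p (j', 0) + (3 * (n - 3) / 10 : K) * u * p (j, 0) +
      reduced (j', 0) (fun _ => 0) u := by
  obtain ⟨h, g, hg, hs, hr⟩ := exists_jetAct_eq_reduced (j', 0) (fun _ => 0) u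
  have hn : 3 < n := hj' ▸ j'.2
  -- From here on N = n − 4.
  obtain ⟨N, rfl⟩ := Nat.exists_eq_add_of_lt hn
  have hc1 : ((3 + N + 1).choose 1 : K) = N + 4 := by simp; ring
  have hc (s : ℕ) : ((3 + N + 1).choose (s + 1) : K) * (s + 1) =
      (3 + N + 1).choose s * (N + 4 - s) := by
    rcases Nat.lt_or_ge (3 + N + 1) s with h | h
    · rw [Nat.choose_eq_zero_of_lt h, Nat.choose_eq_zero_of_lt (by omega)]
      simp
    · have := congrArg (Nat.cast : ℕ → K) (Nat.choose_succ_right_eq (3 + N + 1) s)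
      rw [Nat.cast_mul, Nat.cast_mul, Nat.cast_sub h] at this
      push_cast at this
      rw [this]
      ring
  have hc2 : ((3 + N + 1).choose 2 : K) = (N + 4) * (N + 3) / 2 := by
    have := hc 1
    rw [hc1] at this
    push_cast at this
    linear_combination this / 2
  have hc3 : ((3 + N + 1).choose 3 : K) = (N + 4) * (N + 3) * (N + 2) / 6 := by
    have := hc 2
    rw [hc2] at this
    push_cast at this
    linear_combination this / 3
  have hc4 : ((3 + N + 1).choose 4 : K) = (N + 4) * (N + 3) * (N + 2) * (N + 1) / 24 := by
    have := hc 3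
    rw [hc3] at this
    push_cast at this
    linear_combination this / 4
  have hc5 : ((3 + N + 1).choose 5 : K) = (N + 4) * (N + 3) * (N + 2) * (N + 1) * N / 120 := by
    have := hc 4
    rw [hc4] at this
    push_cast at this
    linear_combination this / 5
  have hN (k : ℕ) : (N + (k + 1 : ℕ) : K) ≠ 0 := by
    exact_mod_cast (by omega : N + (k + 1) ≠ 0)
  have hN1 : (N + 1 : K) ≠ 0 := by simpa using hN 0
  have hN2 : (N + 2 : K) ≠ 0 := by simpa using hN 1
  have hN3 : (N + 3 : K) ≠ 0 := by simpa using hN 2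
  have hN4 : (N + 4 : K) ≠ 0 := by simpa using hN 3
  have hN5 : (N + 5 : K) ≠ 0 := by simpa using hN 4
  have hm2 : ((N + 1).choose 2 : K) = (N + 1) * N / 2 := by
    rw [Nat.cast_choose_two]
    push_cast
    ring
  -- the value of `h 0`
  have hh0 : h 0 = (N + 3) / 2 * u := by
    have h1 := hs (⟨0, by omega⟩, 0) ⟨by simp, by simp⟩
    rw [jetAct_eq, jetRest_congr (b' := fun _ => 0) (h' := fun _ => 0) (g' := fun _ => 0)] at h1
    · have h2 := congrFun (jetAct_zero_zero (fun _ : Fin (3 + N + 1) × ℕ => (0 : K)))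
        (⟨0, by omega⟩, 0)
      rw [jetAct_eq] at h2
      simp only [zero_add, add_zero, mul_zero, sub_zero] at h1 h2
      rw [h2, hc1, hc2, hg] at h1
      apply mul_left_cancel₀ hN4
      linear_combination h1
    · exact fun _ _ _ _ => rfl
    · simp
    · simp
  set x : K := p (j, 0) * u with hx
  -- The correction y of g 3 and (N+2)/3 · y of h 3 leaves (1, 2) unchanged and moves (2, 1) by −3x.
  set y : K := -36 * x * 6 / ((N + 4) * (N + 3) * (N + 2) * (N + 5)) with hy
  have hvan (i : Fin (3 + N + 1) × ℕ) (h1 : i.1 < j) (h2 : i.2 ≤ 2) : p i = 0 := by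
    have h3 : i.1.val < j.val := h1
    exact hp i ⟨h2, by omega⟩
  have hlow (i : Fin (3 + N + 1) × ℕ) (h1 : i.1.val < 2) (h2 : i.2 ≤ 2) :
      jetAct p h g i = jetAct (fun _ => 0) h g i := by
    refine jetAct_congr (fun i' h3 h4 => hvan i' ?_ (h4.trans h2)) (fun _ _ => rfl) (fun _ _ => rfl)
    have h5 : i'.1.val ≤ i.1.val := h3
    exact Fin.lt_def.2 (by omega)
  rw [reduced_eq (p := p) (by simp [hj']) (h := Function.update h 3 (h 3 + (N + 2) / 3 * y))
    (g := Function.update g 3 (g 3 + y)), jetAct_update_param _ _ (by simp [hj']),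
    jetAct_zero_of_vanish (j := j) _ _ (by omega), hr, hj, hj', hh0, hg]
  · simp only [add_sub_cancel_left]
    rw [show 3 + N + 1 - (2 + 1) = N + 1 by omega, hm2, hc4, hc5, hy, hx]
    push_cast
    field_simp
    ring
  · exact fun i h1 h2 => hvan i h1 (by omega)
  · rw [Function.update_of_ne (by omega), hg]
  · intro i h1 h2
    have h6 := h1.1
    simp only [hj', add_zero, zero_add] at h2 h6
    rcases h2.lt_or_eq with h3 | h3
    · rw [jetAct_update_param_of_lt _ _ h3, hlow, hs i h1]
      · have h7 := h1.2
        simp only at h7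
        omega
      · omega
    · rw [jetAct_update_param _ _ h3]
      simp only [add_sub_cancel_left]
      rcases h1.val_eq h3 with h5 | ⟨h5, -⟩
      · rw [hlow i (by omega) (by omega), hs i h1, show i.1.val = 1 by simpa using h5, hc2, hc3]
        ring
      · have h7 : i = (j, 1) := Prod.ext (Fin.ext (by simp only [hj]; omega)) (by simp only; omega)
        subst h7
        rw [jetAct_one_of_vanish _ _ (fun i h1 h2 => hvan i h1 (h2.trans one_le_two)), hs _ h1, hp _ h1, hg]
        simp only [hj]
        rw [hc3, hc4, hy, hx]
        push_cast
        field_simp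
        ring

end

/-! ### Jets along actual changes of variables -/

section
variable {n : ℕ} {R : Type*} [CommRing R]

/-- The action of a dilation of the independent variable on jets. -/
def scaleJet (c : R) (p : Fin n × ℕ → R) (i : Fin n × ℕ) : R := c ^ jetWeight i * p i

end

section
variable {𝕜 : Type*} [RCLike 𝕜] {n : ℕ}

/-- The derivatives of the logarithmic derivative. -/
noncomputable def logJet (f : 𝕜 → 𝕜) (z : 𝕜) (i : ℕ) : 𝕜 :=
  iteratedDeriv i (fun s => deriv f s / f s) z

theorem ContDiffOn.iteratedDeriv_of_isOpen {J : Set 𝕜} (hJ : IsOpen J) {f : 𝕜 → 𝕜}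
    (hf : ContDiffOn 𝕜 ∞ f J) (k : ℕ) : ContDiffOn 𝕜 ∞ (iteratedDeriv k f) J := by
  induction k with
  | zero => simpa using hf
  | succ k ih =>
    rw [iteratedDeriv_succ]
    exact ((contDiffOn_infty_iff_deriv_of_isOpen hJ).1 ih).2

theorem ContDiffOn.hasDerivAt_iteratedDeriv {J : Set 𝕜} (hJ : IsOpen J) {f : 𝕜 → 𝕜}
    (hf : ContDiffOn 𝕜 ∞ f J) (k : ℕ) {z : 𝕜} (hz : z ∈ J) :
    HasDerivAt (iteratedDeriv k f) (iteratedDeriv (k + 1) f z) z := by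
  rw [iteratedDeriv_succ]
  exact (((hf.iteratedDeriv_of_isOpen hJ k).contDiffAt (hJ.mem_nhds hz)).differentiableAt
    (by simp)).hasDerivAt

theorem ContDiffOn.logDeriv_of_isOpen {J : Set 𝕜} (hJ : IsOpen J) {f : 𝕜 → 𝕜}
    (hf : ContDiffOn 𝕜 ∞ f J) (h0 : ∀ z ∈ J, f z ≠ 0) :
    ContDiffOn 𝕜 ∞ (fun s => deriv f s / f s) J :=
  ((contDiffOn_infty_iff_deriv_of_isOpen hJ).1 hf).2.div hf h0

/-- The jet coordinates along a transformation. -/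
noncomputable def transPoint (a : Fin n → 𝕜 → 𝕜) (ξ η : 𝕜 → 𝕜) (z : 𝕜) : JetVar n → 𝕜 :=
  point (scaleJet (deriv ξ z) (coeffJet a (ξ z))) (logJet η z) (logJet (deriv ξ) z)

/-- The data of a change of variables and of the coefficients to which it is applied. -/
structure IsChange (J D : Set 𝕜) (ξ η : 𝕜 → 𝕜) (a : Fin n → 𝕜 → 𝕜) : Prop where
  isOpen_J : IsOpen J
  isOpen_D : IsOpen D
  smooth_xi : ContDiffOn 𝕜 ∞ ξ J
  deriv_xi_ne : ∀ z ∈ J, deriv ξ z ≠ 0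
  mapsTo_xi : Set.MapsTo ξ J D
  smooth_eta : ContDiffOn 𝕜 ∞ η J
  eta_ne : ∀ z ∈ J, η z ≠ 0
  smooth_a : ∀ j, ContDiffOn 𝕜 ∞ (a j) D

theorem IsTransform.isChange {J D : Set 𝕜} {ξ η : 𝕜 → 𝕜} {a A : Fin n → 𝕜 → 𝕜}
    (H : IsTransform J D ξ η a A) : IsChange J D ξ η a :=
  ⟨H.isOpen_J, H.isOpen_D, H.smooth_xi, H.deriv_xi_ne, H.mapsTo_xi, H.smooth_eta, H.eta_ne,
    H.smooth_a⟩

namespace IsChange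

variable {J D : Set 𝕜} {ξ η : 𝕜 → 𝕜} {a : Fin n → 𝕜 → 𝕜} (H : IsChange J D ξ η a)
include H

theorem smooth_deriv_xi : ContDiffOn 𝕜 ∞ (deriv ξ) J :=
  ((contDiffOn_infty_iff_deriv_of_isOpen H.isOpen_J).1 H.smooth_xi).2

theorem hasDerivAt_xi {z : 𝕜} (hz : z ∈ J) : HasDerivAt ξ (deriv ξ z) z :=
  ((H.smooth_xi.contDiffAt (H.isOpen_J.mem_nhds hz)).differentiableAt (by simp)).hasDerivAt

theorem hasDerivAt_deriv_xi {z : 𝕜} (hz : z ∈ J) :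
    HasDerivAt (deriv ξ) (deriv (deriv ξ) z) z :=
  ((H.smooth_deriv_xi.contDiffAt (H.isOpen_J.mem_nhds hz)).differentiableAt (by simp)).hasDerivAt

theorem hasDerivAt_eta {z : 𝕜} (hz : z ∈ J) : HasDerivAt η (deriv η z) z :=
  ((H.smooth_eta.contDiffAt (H.isOpen_J.mem_nhds hz)).differentiableAt (by simp)).hasDerivAt

/-- This identifies `totalDeriv` with d/dz: differentiating the factor ξ' to the weight of i
produces the term weight · ξ''/ξ'. -/
theorem hasDerivAt_transPoint {z : 𝕜} (hz : z ∈ J) (v : JetVar n) :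
    HasDerivAt (fun z => transPoint a ξ η z v)
      (aeval (transPoint a ξ η z) (totalDeriv n (X v))) z := by
  rcases v with i | i | i
  · have h1 := (H.hasDerivAt_deriv_xi hz).pow (jetWeight i)
    have h2 := ((H.smooth_a i.1).hasDerivAt_iteratedDeriv H.isOpen_D i.2
      (H.mapsTo_xi hz)).comp z (H.hasDerivAt_xi hz)
    refine (h1.fun_mul h2).congr_deriv ?_
    have hne := H.deriv_xi_ne z hz
    simp only [totalDeriv_coef, map_add, map_mul, aeval_X, map_natCast, transPoint, point, scaleJet,
      coeffJet, logJet, iteratedDeriv_zero, Function.comp, jetWeight, Pi.pow_apply]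
    rw [show i.1.val + 1 + (i.2 + 1) = i.1.val + i.2 + 2 by ring,
      show i.1.val + 1 + i.2 = i.1.val + i.2 + 1 by ring, Nat.add_sub_cancel]
    field_simp
    ring
  · rw [totalDeriv_logEta, aeval_X]
    exact (H.smooth_eta.logDeriv_of_isOpen H.isOpen_J H.eta_ne).hasDerivAt_iteratedDeriv
      H.isOpen_J i hz
  · rw [totalDeriv_logXi, aeval_X]
    exact (H.smooth_deriv_xi.logDeriv_of_isOpen H.isOpen_J H.deriv_xi_ne).hasDerivAt_iteratedDeriv
      H.isOpen_J i hz

theorem hasDerivAt_aeval {z : 𝕜} (hz : z ∈ J) (Q : MvPolynomial (JetVar n) ℤ) :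
    HasDerivAt (fun z => aeval (transPoint a ξ η z) Q)
      (aeval (transPoint a ξ η z) (totalDeriv n Q)) z := by
  induction Q using MvPolynomial.induction_on with
  | C c => simpa [Derivation.map_algebraMap, ← algebraMap_eq] using hasDerivAt_const z (c : 𝕜)
  | add p q hp hq =>
    simp only [map_add]
    exact hp.fun_add hq
  | mul_X p v hp =>
    simp only [map_mul, aeval_X]
    refine (hp.fun_mul (H.hasDerivAt_transPoint hz v)).congr_deriv ?_
    rw [Derivation.leibniz]
    simp only [smul_eq_mul, map_add, map_mul, aeval_X]
    ring

theorem contDiffOn_aeval (Q : MvPolynomial (JetVar n) ℤ) :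
    ContDiffOn 𝕜 ∞ (fun z => aeval (transPoint a ξ η z) Q) J := by
  rw [contDiffOn_infty]
  intro k
  induction k generalizing Q with
  | zero =>
    exact contDiffOn_zero.2 fun z hz => (H.hasDerivAt_aeval hz Q).continuousAt.continuousWithinAt
  | succ k ih =>
    rw [Nat.cast_succ, contDiffOn_succ_iff_deriv_of_isOpen H.isOpen_J]
    refine ⟨fun z hz => (H.hasDerivAt_aeval hz Q).differentiableAt.differentiableWithinAt,
      fun h => by simp at h, (ih (totalDeriv n Q)).congr fun z hz => (H.hasDerivAt_aeval hz Q).deriv⟩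

theorem iteratedDeriv_aeval {z : 𝕜} (hz : z ∈ J) (Q : MvPolynomial (JetVar n) ℤ) (k : ℕ) :
    iteratedDeriv k (fun z => aeval (transPoint a ξ η z) Q) z =
      aeval (transPoint a ξ η z) ((totalDeriv n)^[k] Q) := by
  induction k generalizing z with
  | zero => simp
  | succ k ih =>
    rw [iteratedDeriv_succ, Function.iterate_succ_apply', ← (H.hasDerivAt_aeval hz _).deriv]
    refine Filter.EventuallyEq.deriv_eq ?_
    filter_upwards [H.isOpen_J.mem_nhds hz] with s hs using ih hs

/-- The chain rule for `y(ξ(z)) = η(z) w(z)`. -/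
theorem iteratedDeriv_comp {y w : 𝕜 → 𝕜} (hy : ContDiffOn 𝕜 ∞ y D) (hw : ContDiffOn 𝕜 ∞ w J)
    (hyw : ∀ z ∈ J, y (ξ z) = η z * w z) (m : ℕ) : ∀ z ∈ J, iteratedDeriv m y (ξ z) =
      η z / deriv ξ z ^ m * ∑ s ∈ Finset.range (m + 1),
        aeval (transPoint a ξ η z) (chainPoly n m s) * iteratedDeriv (m - s) w z := by
  induction m with
  | zero => intro z hz; simpa using hyw z hz
  | succ m ih =>
    intro z hz
    have h1 := (hy.hasDerivAt_iteratedDeriv H.isOpen_D m (H.mapsTo_xi hz)).comp z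
      (H.hasDerivAt_xi hz)
    have hne := H.deriv_xi_ne z hz
    have hne' := H.eta_ne z hz
    have h2 := ((H.hasDerivAt_eta hz).fun_div ((H.hasDerivAt_deriv_xi hz).fun_pow m)
      (pow_ne_zero m hne)).fun_mul (HasDerivAt.fun_sum (u := Finset.range (m + 1)) fun s _ =>
        (H.hasDerivAt_aeval hz (chainPoly n m s)).fun_mul
          (hw.hasDerivAt_iteratedDeriv H.isOpen_J (m - s) hz))
    have h3 := h1.unique (h2.congr_of_eventuallyEq (by
      filter_upwards [H.isOpen_J.mem_nhds hz] with s hs using ih s hs))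
    set P : ℕ → 𝕜 := fun s => aeval (transPoint a ξ η z) (chainPoly n m s) with hP
    set P' : ℕ → 𝕜 := fun s => aeval (transPoint a ξ η z) (totalDeriv n (chainPoly n m s)) with hP'
    set W : ℕ → 𝕜 := fun s => iteratedDeriv s w z with hW
    -- The recursion of `chainPoly` summed against the derivatives of w. The index shift costs
    -- nothing, as `chainPoly n m (m + 1) = 0`.
    have h4 : ∑ s ∈ Finset.range (m + 1 + 1),
        aeval (transPoint a ξ η z) (chainPoly n (m + 1) s) * W (m + 1 - s) =
        ∑ s ∈ Finset.range (m + 1), (P' s * W (m - s) + P s * W (m - s + 1)) +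
        (deriv η z / η z - m * (deriv (deriv ξ) z / deriv ξ z)) *
          ∑ s ∈ Finset.range (m + 1), P s * W (m - s) := by
      have h5 : ∑ s ∈ Finset.range (m + 1), P (s + 1) * W (m - s) + P 0 * W (m + 1) =
          ∑ s ∈ Finset.range (m + 1), P s * W (m - s + 1) := by
        have := Finset.sum_range_succ' (fun s => P s * W (m + 1 - s)) (m + 1)
        simp only [Nat.add_sub_add_right, tsub_zero] at this
        rw [← this, Finset.sum_range_succ]
        have h6 : P (m + 1) = 0 := by simp [hP, chainPoly_eq_zero (Nat.lt_succ_self m)]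
        rw [h6, zero_mul, add_zero]
        refine Finset.sum_congr rfl fun s hs => ?_
        rw [show m + 1 - s = m - s + 1 by have := Finset.mem_range.1 hs; omega]
      rw [Finset.sum_range_succ', Finset.sum_add_distrib, ← h5, Finset.mul_sum]
      have h7 (s : ℕ) : aeval (transPoint a ξ η z) (chainPoly n (m + 1) (s + 1)) =
          P' s + (deriv η z / η z - m * (deriv (deriv ξ) z / deriv ξ z)) * P s + P (s + 1) := by
        simp [chainPoly, hP, hP', transPoint, point, logJet]
      simp only [h7, Nat.add_sub_add_right, chainPoly_zero_right, map_one, tsub_zero]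
      have h8 : P 0 = 1 := by simp [hP]
      rw [h8]
      simp only [add_mul, Finset.sum_add_distrib, mul_assoc]
      ring
    rw [h4]
    apply mul_right_cancel₀ hne
    rw [h3]
    have h9 : (m : 𝕜) * deriv ξ z ^ (m - 1) = m * deriv ξ z ^ m / deriv ξ z := by
      rcases m with _ | m
      · simp
      · rw [Nat.add_sub_cancel, pow_succ]
        field_simp
    rw [h9, pow_succ]
    field_simp
    ring

theorem linearODE_eq {y w : 𝕜 → 𝕜} (hy : ContDiffOn 𝕜 ∞ y D) (hw : ContDiffOn 𝕜 ∞ w J)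
    (hyw : ∀ z ∈ J, y (ξ z) = η z * w z) {z : 𝕜} (hz : z ∈ J) :
    linearODE (fun j z => aeval (transPoint a ξ η z) (transPoly (j, 0))) w z =
      deriv ξ z ^ n / η z * linearODE a y (ξ z) := by
  have hne := H.deriv_xi_ne z hz
  have hne' := H.eta_ne z hz
  simp only [linearODE, transPoly, Function.iterate_zero, id, map_add, map_sum, map_mul, aeval_X,
    H.iteratedDeriv_comp hy hw hyw _ z hz]
  set P : ℕ → ℕ → 𝕜 := fun m s => aeval (transPoint a ξ η z) (chainPoly n m s) with hP
  set W : ℕ → 𝕜 := fun s => iteratedDeriv s w z with hW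
  have h0 : P n 0 = 1 := by simp [hP]
  have h1 (l : Fin n) : ∑ s ∈ Finset.range (n - (l.val + 1) + 1),
      P (n - (l.val + 1)) s * W (n - (l.val + 1) - s) = ∑ j : Fin n, if l ≤ j then
        P (n - (l.val + 1)) (j.val - l.val) * W (n - (j.val + 1)) else 0 := by
    simp only [Fin.le_def]
    rw [Fin.sum_univ_eq_sum_range (fun j => if l.val ≤ j then
      P (n - (l.val + 1)) (j - l.val) * W (n - (j + 1)) else 0) n, ← Finset.sum_filter]
    have hl := l.2
    have h2 : (Finset.range n).filter (fun j => l.val ≤ j) = Finset.Ico l.val n := by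
      ext j
      simp
      omega
    rw [h2, Finset.sum_Ico_eq_sum_range, show n - (l.val + 1) + 1 = n - l.val by omega]
    refine Finset.sum_congr rfl fun s _ => ?_
    rw [Nat.add_sub_cancel_left, show n - (l.val + 1) - s = n - (l.val + s + 1) by omega]
  have hPd (m s : ℕ) : aeval (transPoint a ξ η z) (chainPoly n m s) = P m s := rfl
  have hWd (s : ℕ) : iteratedDeriv s w z = W s := rfl
  simp only [hPd, hWd, h1]
  have h2 : ∑ s ∈ Finset.range (n + 1), P n s * W (n - s) =
      W n + ∑ j : Fin n, P n (j.val + 1) * W (n - (j.val + 1)) := by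
    rw [Finset.sum_range_succ', h0, Fin.sum_univ_eq_sum_range (fun j => P n (j + 1) *
      W (n - (j + 1)))]
    simp [add_comm]
  rw [h2]
  have h3 (l : Fin n) : a l (ξ z) * (η z / deriv ξ z ^ (n - (l.val + 1)) * ∑ j : Fin n,
      (if l ≤ j then P (n - (l.val + 1)) (j.val - l.val) * W (n - (j.val + 1)) else 0)) =
      η z / deriv ξ z ^ n * ∑ j : Fin n, if l ≤ j then transPoint a ξ η z (coef (l, 0)) *
        P (n - (l.val + 1)) (j.val - l.val) * W (n - (j.val + 1)) else 0 := by
    have h4 : deriv ξ z ^ n = deriv ξ z ^ (n - (l.val + 1)) * deriv ξ z ^ (l.val + 1) := by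
      rw [← pow_add]
      congr 1
      have := l.2
      omega
    have h5 : transPoint a ξ η z (coef (l, 0)) = deriv ξ z ^ (l.val + 1) * a l (ξ z) := by
      simp [transPoint, point, scaleJet, coeffJet, jetWeight]
    simp only [h4, h5, mul_assoc, Finset.mul_sum]
    refine Finset.sum_congr rfl fun j _ => ?_
    split_ifs
    · field_simp
    · simp
  simp only [h3, ← Finset.mul_sum]
  rw [← mul_add, Finset.sum_comm]
  have h6 : ∀ x : 𝕜, deriv ξ z ^ n / η z * (η z / deriv ξ z ^ n * x) = x := by
    intro x
    field_simp
  rw [h6, add_assoc, ← Finset.sum_add_distrib]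
  congr 1
  refine Finset.sum_congr rfl fun j _ => ?_
  rw [add_mul, Finset.sum_mul, ← Finset.sum_filter]
  congr 2
  ext l
  simp

/-- Every change of variables transforms the coefficients. -/
theorem isTransform : IsTransform J D ξ η a
    (fun j z => aeval (transPoint a ξ η z) (transPoly (j, 0))) where
  isOpen_J := H.isOpen_J
  isOpen_D := H.isOpen_D
  smooth_xi := H.smooth_xi
  deriv_xi_ne := H.deriv_xi_ne
  mapsTo_xi := H.mapsTo_xi
  smooth_eta := H.smooth_eta
  eta_ne := H.eta_ne
  smooth_a := H.smooth_a
  smooth_A := fun _ => H.contDiffOn_aeval _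
  subst_eq := fun _ _ hy hw hyw _ hz => H.linearODE_eq hy hw hyw hz

end IsChange

theorem iteratedDeriv_sub_pow (c x : 𝕜) (i k : ℕ) :
    iteratedDeriv k (fun s => (s - c) ^ i) x = i.descFactorial k * (x - c) ^ (i - k) := by
  have := iteratedDeriv_comp_sub_const k (fun s : 𝕜 => s ^ i) c
  rw [this]
  simp

namespace IsTransform
variable {J D : Set 𝕜} {ξ η : 𝕜 → 𝕜} {a A : Fin n → 𝕜 → 𝕜} (H : IsTransform J D ξ η a A)
include H

/-- Testing on y = (x − ξ(z))^i with i = n − (j + 1) isolates the coefficient j: the corresponding w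
vanishes at z to order exactly i, so later coefficients drop out, and earlier ones agree by
induction. -/
theorem coeff_eq {z : 𝕜} (hz : z ∈ J) (j : Fin n) :
    A j z = aeval (transPoint a ξ η z) (transPoly (j, 0)) := by
  have hc := H.isChange
  have hne := H.deriv_xi_ne z hz
  have hne' := H.eta_ne z hz
  obtain ⟨j, hj⟩ := j
  induction j using Nat.strong_induction_on with
  | _ j ih =>
  set i := n - (j + 1) with hi
  set y : 𝕜 → 𝕜 := fun s => (s - ξ z) ^ i with hy
  set w : 𝕜 → 𝕜 := fun s => (ξ s - ξ z) ^ i / η s with hw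
  have hy' : ContDiffOn 𝕜 ∞ y D := by fun_prop
  have hw' : ContDiffOn 𝕜 ∞ w J := ((H.smooth_xi.sub contDiffOn_const).pow i).div H.smooth_eta
    H.eta_ne
  have hyw : ∀ s ∈ J, y (ξ s) = η s * w s := by
    intro s hs
    have := H.eta_ne s hs
    simp only [hy, hw]
    field_simp
  have h1 := H.subst_eq y w hy' hw' hyw z hz
  rw [← hc.linearODE_eq hy' hw' hyw hz] at h1
  have hchain := fun m => hc.iteratedDeriv_comp hy' hw' hyw m z hz
  have hlow : ∀ m < i, iteratedDeriv m w z = 0 := by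
    intro m
    induction m using Nat.strong_induction_on with
    | _ m ihm =>
    intro hm
    have h2 := hchain m
    rw [hy, iteratedDeriv_sub_pow, sub_self, zero_pow (by omega), mul_zero,
      Finset.sum_range_succ', Finset.sum_eq_zero] at h2
    · simpa [hne, hne'] using h2
    · intro s hs
      rw [ihm _ (by have := Finset.mem_range.1 hs; omega)
        (by have := Finset.mem_range.1 hs; omega), mul_zero]
  have htop : iteratedDeriv i w z ≠ 0 := by
    intro h0
    have h2 := hchain i
    rw [hy, iteratedDeriv_sub_pow, sub_self, Finset.sum_eq_zero] at h2
    · simp at h2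
    · intro s hs
      rcases Nat.eq_zero_or_pos s with rfl | hs'
      · rw [Nat.sub_zero, h0, mul_zero]
      · rw [hlow _ (by have := Finset.mem_range.1 hs; omega), mul_zero]
  simp only [linearODE, add_right_inj] at h1
  rw [← sub_eq_zero, ← Finset.sum_sub_distrib, Finset.sum_eq_single ⟨j, hj⟩] at h1
  · rw [← sub_mul, mul_eq_zero, sub_eq_zero] at h1
    exact h1.resolve_right htop
  · rintro ⟨l, hl⟩ - hne
    rcases lt_or_gt_of_ne (show l ≠ j from fun h => hne (Fin.ext h)) with h2 | h2
    · rw [ih l h2 hl, sub_self]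
    · rw [hlow _ (by simp only; omega), mul_zero, mul_zero, sub_zero]
  · simp

/-- The jets of the transformed coefficients. -/
theorem coeffJet_eq {z : 𝕜} (hz : z ∈ J) : coeffJet A z =
    jetAct (scaleJet (deriv ξ z) (coeffJet a (ξ z))) (logJet η z) (logJet (deriv ξ) z) := by
  funext i
  have h1 := H.isChange.iteratedDeriv_aeval hz (transPoly (i.1, 0)) i.2
  have h2 : (totalDeriv n)^[i.2] (transPoly (i.1, 0)) = transPoly i := by
    simp [transPoly]
  rw [h2] at h1
  change _ = aeval (transPoint a ξ η z) (transPoly i)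
  rw [← h1]
  refine Filter.EventuallyEq.iteratedDeriv_eq _ ?_
  filter_upwards [H.isOpen_J.mem_nhds hz] with s hs using H.coeff_eq hs i.1

end IsTransform

end

/-! ### Composition, and transformations with prescribed jets -/

section
variable {𝕜 : Type*} [RCLike 𝕜] {n : ℕ}

theorem IsTransform.comp {J J' D : Set 𝕜} {ξ₁ η₁ ξ₂ η₂ : 𝕜 → 𝕜} {a b c : Fin n → 𝕜 → 𝕜}
    (H₁ : IsTransform J D ξ₁ η₁ a b) (H₂ : IsTransform J' J ξ₂ η₂ b c) :
    IsTransform J' D (fun s => ξ₁ (ξ₂ s)) (fun s => η₁ (ξ₂ s) * η₂ s) a c := by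
  have hd (s : 𝕜) (hs : s ∈ J') :
      deriv (fun s => ξ₁ (ξ₂ s)) s = deriv ξ₁ (ξ₂ s) * deriv ξ₂ s :=
    ((H₁.isChange.hasDerivAt_xi (H₂.mapsTo_xi hs)).comp s (H₂.isChange.hasDerivAt_xi hs)).deriv
  refine ⟨H₂.isOpen_J, H₁.isOpen_D, H₁.smooth_xi.comp H₂.smooth_xi H₂.mapsTo_xi, fun s hs => ?_,
    fun s hs => H₁.mapsTo_xi (H₂.mapsTo_xi hs),
    (H₁.smooth_eta.comp H₂.smooth_xi H₂.mapsTo_xi).mul H₂.smooth_eta, fun s hs =>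
    mul_ne_zero (H₁.eta_ne _ (H₂.mapsTo_xi hs)) (H₂.eta_ne s hs), H₁.smooth_a, H₂.smooth_A, ?_⟩
  · rw [hd s hs]
    exact mul_ne_zero (H₁.deriv_xi_ne _ (H₂.mapsTo_xi hs)) (H₂.deriv_xi_ne s hs)
  · intro y w hy hw hyw s hs
    have hv : ContDiffOn 𝕜 ∞ (fun z => y (ξ₁ z) / η₁ z) J :=
      (hy.comp H₁.smooth_xi H₁.mapsTo_xi).div H₁.smooth_eta H₁.eta_ne
    have h1 := H₁.subst_eq y _ hy hv (fun z hz => by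
      have := H₁.eta_ne z hz
      field_simp) (ξ₂ s) (H₂.mapsTo_xi hs)
    have h2 := H₂.subst_eq _ w hv hw (fun z hz => by
      have := H₁.eta_ne _ (H₂.mapsTo_xi hz)
      rw [hyw z hz]
      field_simp) s hs
    rw [h2, h1, hd s hs, mul_pow]
    have := H₁.eta_ne _ (H₂.mapsTo_xi hs)
    have := H₂.eta_ne _ hs
    field_simp

/-- Of the composition law of the parameters, only this component for ξ''/ξ' is needed explicitly.
-/
theorem IsTransform.logJet_comp {J J' D : Set 𝕜} {ξ₁ η₁ ξ₂ η₂ : 𝕜 → 𝕜} {a b c : Fin n → 𝕜 → 𝕜}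
    (H₁ : IsTransform J D ξ₁ η₁ a b) (H₂ : IsTransform J' J ξ₂ η₂ b c) {s : 𝕜} (hs : s ∈ J') :
    logJet (deriv fun s => ξ₁ (ξ₂ s)) s 0 =
      deriv ξ₂ s * logJet (deriv ξ₁) (ξ₂ s) 0 + logJet (deriv ξ₂) s 0 := by
  have hd (s : 𝕜) (hs : s ∈ J') :
      deriv (fun s => ξ₁ (ξ₂ s)) s = deriv ξ₁ (ξ₂ s) * deriv ξ₂ s :=
    ((H₁.isChange.hasDerivAt_xi (H₂.mapsTo_xi hs)).comp s (H₂.isChange.hasDerivAt_xi hs)).deriv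
  have hdd : deriv (deriv fun s => ξ₁ (ξ₂ s)) s =
      deriv (deriv ξ₁) (ξ₂ s) * deriv ξ₂ s * deriv ξ₂ s +
        deriv ξ₁ (ξ₂ s) * deriv (deriv ξ₂) s := by
    have h1 := ((H₁.isChange.hasDerivAt_deriv_xi (H₂.mapsTo_xi hs)).comp s
      (H₂.isChange.hasDerivAt_xi hs)).mul (H₂.isChange.hasDerivAt_deriv_xi hs)
    refine Eq.trans ?_ h1.deriv
    refine Filter.EventuallyEq.deriv_eq ?_
    filter_upwards [H₂.isOpen_J.mem_nhds hs] with t ht using hd t ht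
  simp only [logJet, iteratedDeriv_zero, hdd, hd s hs]
  have := H₁.deriv_xi_ne _ (H₂.mapsTo_xi hs)
  have := H₂.deriv_xi_ne _ hs
  field_simp

/-- The polynomial with prescribed derivatives at `0`. -/
noncomputable def taylorFun (c : ℕ → 𝕜) (N : ℕ) (x : 𝕜) : 𝕜 :=
  ∑ i ∈ Finset.range (N + 1), c i / i.factorial * x ^ i

theorem contDiff_taylorFun (c : ℕ → 𝕜) (N : ℕ) {m : WithTop ℕ∞} :
    ContDiff 𝕜 m (taylorFun c N) := by
  unfold taylorFun
  fun_prop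

theorem iteratedDeriv_taylorFun (c : ℕ → 𝕜) (N k : ℕ) :
    iteratedDeriv k (taylorFun c N) 0 = if k ≤ N then c k else 0 := by
  have h1 : iteratedDeriv k (taylorFun c N) 0 = ∑ i ∈ Finset.range (N + 1),
      iteratedDeriv k (fun x : 𝕜 => c i / i.factorial * x ^ i) 0 :=
    iteratedDeriv_fun_sum fun i _ => by fun_prop
  rw [h1]
  have h2 (i : ℕ) : iteratedDeriv k (fun x : 𝕜 => c i / i.factorial * x ^ i) 0 =
      if i = k then c i else 0 := by
    rw [iteratedDeriv_const_mul_field]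
    have := iteratedDeriv_sub_pow (0 : 𝕜) 0 i k
    simp only [sub_zero] at this
    rw [this]
    have hf : (i.factorial : 𝕜) ≠ 0 := Nat.cast_ne_zero.2 i.factorial_ne_zero
    rcases lt_trichotomy i k with h | rfl | h
    · rw [Nat.descFactorial_of_lt h, if_neg h.ne]
      simp
    · simp [Nat.descFactorial_self]
      field_simp
    · rw [zero_pow (by omega), if_neg h.ne']
      simp
  simp only [h2]
  simp

/-- The derivatives of a function with prescribed value and logarithmic derivative. -/
noncomputable def expJet (c : 𝕜) (l : ℕ → 𝕜) : ℕ → 𝕜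
  | 0 => c
  | k + 1 => ∑ i : Fin (k + 1), (k.choose i : 𝕜) * l i * expJet c l (k - i)

/-- The Leibniz rule for f' = (f'/f) · f is the recursion of `expJet`; comparing the two and
cancelling f(0) = c gives the claim by induction. -/
theorem logJet_eq_of_expJet {f : 𝕜 → 𝕜} {c : 𝕜} (hc : c ≠ 0) {l : ℕ → 𝕜} {N : ℕ}
    (hf : ContDiff 𝕜 ∞ f) (hk : ∀ k ≤ N + 1, iteratedDeriv k f 0 = expJet c l k) :
    ∀ k ≤ N, logJet f 0 k = l k := by
  have h0 : f 0 = c := by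
    have := hk 0 (Nat.zero_le _)
    rwa [iteratedDeriv_zero, expJet] at this
  have hne : ∀ᶠ s in 𝓝 (0 : 𝕜), f s ≠ 0 :=
    hf.continuous.continuousAt.eventually_ne (by rwa [h0])
  have hL : ContDiffAt 𝕜 ∞ (fun s => deriv f s / f s) 0 :=
    ((contDiff_infty_iff_deriv.1 hf).2.contDiffAt).div hf.contDiffAt (by rwa [h0])
  intro k
  induction k using Nat.strong_induction_on with
  | _ k ih =>
  intro hkN
  have h1 : iteratedDeriv (k + 1) f 0 =
      iteratedDeriv k ((fun s => deriv f s / f s) * f) 0 := by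
    rw [iteratedDeriv_succ']
    refine Filter.EventuallyEq.iteratedDeriv_eq _ ?_
    filter_upwards [hne] with s hs
    simp only [Pi.mul_apply]
    field_simp
  rw [iteratedDeriv_mul (hL.of_le (by exact_mod_cast le_top))
    (hf.contDiffAt.of_le (by exact_mod_cast le_top)), hk _ (by omega), expJet,
    Fin.sum_univ_eq_sum_range (fun i => (k.choose i : 𝕜) * l i * expJet c l (k - i)),
    Finset.sum_range_succ, Finset.sum_range_succ] at h1
  have h2 : ∑ i ∈ Finset.range k, (k.choose i : 𝕜) * l i * expJet c l (k - i) =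
      ∑ i ∈ Finset.range k, (k.choose i : 𝕜) * iteratedDeriv i (fun s => deriv f s / f s) 0 *
        iteratedDeriv (k - i) f 0 := by
    refine Finset.sum_congr rfl fun i hi => ?_
    have hik := Finset.mem_range.1 hi
    rw [← ih i hik (by omega), hk _ (by omega), logJet]
  rw [h2, add_right_inj, tsub_self, iteratedDeriv_zero, h0, expJet] at h1
  simp only [Nat.choose_self, Nat.cast_one, one_mul] at h1
  exact (mul_right_cancel₀ hc h1).symm

/-- Transformations with prescribed jets exist. -/
theorem exists_isTransform {D : Set 𝕜} (hD : IsOpen D) {x : 𝕜} (hx : x ∈ D)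
    {a : Fin n → 𝕜 → 𝕜} (ha : ∀ j, ContDiffOn 𝕜 ∞ (a j) D) {c : 𝕜} (hc : c ≠ 0) (h g : ℕ → 𝕜)
    (N : ℕ) : ∃ (J : Set 𝕜) (ξ η : 𝕜 → 𝕜) (A : Fin n → 𝕜 → 𝕜), IsTransform J D ξ η a A ∧
      0 ∈ J ∧ ξ 0 = x ∧ deriv ξ 0 = c ∧ ∀ k ≤ N, logJet η 0 k = h k ∧
        logJet (deriv ξ) 0 k = g k := by
  -- The jet of ξ is its value x followed by the jet of ξ', hence the shift by one and the degree N
  -- + 2.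
  set d : ℕ → 𝕜 := fun k => Nat.casesOn k x (expJet c g) with hd
  set ξ := taylorFun d (N + 2) with hξ
  set η := taylorFun (expJet 1 h) (N + 1) with hη
  have hξs : ContDiff 𝕜 ∞ ξ := contDiff_taylorFun _ _
  have hηs : ContDiff 𝕜 ∞ η := contDiff_taylorFun _ _
  have hξ's : ContDiff 𝕜 ∞ (deriv ξ) := (contDiff_infty_iff_deriv.1 hξs).2
  have hξj (k : ℕ) (hk : k ≤ N + 2) : iteratedDeriv k ξ 0 = d k := by
    rw [hξ, iteratedDeriv_taylorFun, if_pos hk]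
  have hξ'j (k : ℕ) (hk : k ≤ N + 1) : iteratedDeriv k (deriv ξ) 0 = expJet c g k := by
    rw [← iteratedDeriv_succ', hξj _ (by omega)]
  have hηj (k : ℕ) (hk : k ≤ N + 1) : iteratedDeriv k η 0 = expJet 1 h k := by
    rw [hη, iteratedDeriv_taylorFun, if_pos hk]
  have h1 : ξ 0 = x := by simpa [hd] using hξj 0 (Nat.zero_le _)
  have h2 : deriv ξ 0 = c := by simpa [expJet] using hξ'j 0 (Nat.zero_le _)
  have h3 : η 0 = 1 := by simpa [expJet] using hηj 0 (Nat.zero_le _)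
  have H : IsChange ({z | deriv ξ z ≠ 0} ∩ {z | η z ≠ 0} ∩ ξ ⁻¹' D) D ξ η a :=
    { isOpen_J := ((isOpen_ne_fun hξ's.continuous continuous_const).inter
        (isOpen_ne_fun hηs.continuous continuous_const)).inter (hD.preimage hξs.continuous)
      isOpen_D := hD
      smooth_xi := hξs.contDiffOn
      deriv_xi_ne := fun z hz => hz.1.1
      mapsTo_xi := fun z hz => hz.2
      smooth_eta := hηs.contDiffOn
      eta_ne := fun z hz => hz.1.2
      smooth_a := ha }
  refine ⟨_, ξ, η, _, H.isTransform, ⟨⟨?_, ?_⟩, ?_⟩, h1, h2, fun k hk =>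
    ⟨logJet_eq_of_expJet one_ne_zero hηs hηj k hk, logJet_eq_of_expJet hc hξ's hξ'j k hk⟩⟩
  · simpa [h2] using hc
  · simp [h3]
  · simpa [h1] using hx

theorem exists_coeffJet_eq (p : Fin n × ℕ → 𝕜) (N : ℕ) : ∃ a : Fin n → 𝕜 → 𝕜,
    (∀ j, ContDiff 𝕜 ∞ (a j)) ∧ ∀ i, i.2 ≤ N → coeffJet a 0 i = p i :=
  ⟨fun j => taylorFun (fun k => p (j, k)) N, fun _ => contDiff_taylorFun _ _, fun i hi => by
    rw [coeffJet, iteratedDeriv_taylorFun, if_pos hi]⟩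

/-- Two successive transformations amount to a single one. -/
theorem exists_jetAct_comp (p : Fin n × ℕ → 𝕜) {c c' : 𝕜} (hc : c ≠ 0) (hc' : c' ≠ 0)
    (h g h' g' : ℕ → 𝕜) (N : ℕ) : ∃ h'' g'' : ℕ → 𝕜, g'' 0 = c' * g 0 + g' 0 ∧
      ∀ i, i.1.val + i.2 ≤ N → jetAct (scaleJet c' (jetAct (scaleJet c p) h g)) h' g' i =
        jetAct (scaleJet (c * c') p) h'' g'' i := by
  -- The group law is read off from functions: p is realized by polynomial coefficients, transformed
  -- twice, and compared with the composite transformation at 0.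
  obtain ⟨a, ha, hap⟩ := exists_coeffJet_eq p N
  obtain ⟨J, ξ₁, η₁, b, H₁, hJ, h1, h2, h3⟩ := exists_isTransform isOpen_univ (Set.mem_univ 0)
    (fun j => (ha j).contDiffOn) hc h g N
  obtain ⟨J', ξ₂, η₂, d, H₂, hJ', h4, h5, h6⟩ := exists_isTransform H₁.isOpen_J hJ H₁.smooth_A
    hc' h' g' N
  have H := H₁.comp H₂
  have hd : deriv (fun s => ξ₁ (ξ₂ s)) 0 = c * c' := by
    rw [← h2, ← h5]
    have := ((H₁.isChange.hasDerivAt_xi (H₂.mapsTo_xi hJ')).comp 0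
      (H₂.isChange.hasDerivAt_xi hJ')).deriv
    rw [h4] at this
    exact this
  have e1 := H₁.coeffJet_eq hJ
  have e2 := H₂.coeffJet_eq hJ'
  have e3 := H.coeffJet_eq hJ'
  rw [h4, e1, h1, h2, h5] at e2
  rw [hd] at e3
  simp only [h4, h1] at e3
  refine ⟨logJet (fun s => η₁ (ξ₂ s) * η₂ s) 0, logJet (deriv fun s => ξ₁ (ξ₂ s)) 0, ?_, ?_⟩
  · rw [H₁.logJet_comp H₂ hJ', h4, h5, (h3 0 (Nat.zero_le _)).2, (h6 0 (Nat.zero_le _)).2]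
  · intro i hi
    have hle {i i' : Fin n × ℕ} (hi : i.1.val + i.2 ≤ N) (h7 : i'.1 ≤ i.1) (h8 : i'.2 ≤ i.2) :
        i'.1.val + i'.2 ≤ N := (add_le_add (show i'.1.val ≤ i.1.val from h7) h8).trans hi
    have hs (x : 𝕜) (i i' : Fin n × ℕ) (hi : i.1.val + i.2 ≤ N) (h7 : i'.1 ≤ i.1)
        (h8 : i'.2 ≤ i.2) : scaleJet x (coeffJet a 0) i' = scaleJet x p i' := by
      have := hle hi h7 h8
      rw [scaleJet, hap i' (by omega), scaleJet]
    rw [jetAct_congr (fun i' h7 h8 => (hs _ i i' hi h7 h8).symm) (fun _ _ => rfl)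
      (fun _ _ => rfl), ← e3, e2]
    refine jetAct_congr (fun i' h7 h8 => ?_) (fun m hm => ?_) (fun m hm => ?_)
    · have hi' := hle hi h7 h8
      rw [scaleJet, scaleJet]
      congr 1
      refine jetAct_congr (fun i'' h9 h10 => (hs _ i' i'' hi' h9 h10).symm) (fun m hm => ?_)
        (fun m hm => ?_)
      · exact (h3 m (hm.trans hi')).1.symm
      · exact (h3 m (hm.trans hi')).2.symm
    · exact (h6 m (hm.trans hi)).1.symm
    · exact (h6 m (hm.trans hi)).2.symm

end

/-! ### Transformation law of the reduced coordinates -/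

section
variable {n : ℕ} {R : Type*} [CommRing R]

@[simp] theorem scaleJet_one (p : Fin n × ℕ → R) : scaleJet 1 p = p := by
  funext i
  simp [scaleJet]

@[simp] theorem scaleJet_zero_right (c : R) :
    scaleJet c (fun _ : Fin n × ℕ => (0 : R)) = fun _ => 0 := by
  funext i
  simp [scaleJet]

end

section
variable {𝕜 : Type*} [RCLike 𝕜] {n : ℕ}

/-- Normalizing a transformed jet normalizes the original jet by the composite, whose parameter for
ξ'' is g 0 + u; the normal form is unique. -/
theorem reduced_jetAct {i : Fin n × ℕ} (hi : 2 ≤ i.1.val) (p : Fin n × ℕ → 𝕜) {c : 𝕜}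
    (hc : c ≠ 0) (h g : ℕ → 𝕜) (u : 𝕜) :
    reduced i (jetAct (scaleJet c p) h g) u = reduced i (scaleJet c p) (g 0 + u) := by
  obtain ⟨h', g', hg', hs', hr⟩ := exists_jetAct_eq_reduced i (jetAct (scaleJet c p) h g) u
  obtain ⟨h'', g'', hg'', H⟩ := exists_jetAct_comp p hc one_ne_zero h g h' g' (i.1.val + i.2)
  simp only [scaleJet_one, mul_one, one_mul] at hg'' H
  rw [reduced_eq (p := scaleJet c p) hi (hg''.trans (by rw [hg'])) fun i' h1 h2 => by
    rw [← H i' h2, hs' i' h1], ← H i le_rfl, hr]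

/-- A dilation after the normalization keeps the slice at zero and multiplies coordinate i by c to
its weight. -/
theorem reduced_scaleJet {i : Fin n × ℕ} (hi : 2 ≤ i.1.val) (p : Fin n × ℕ → 𝕜) {c : 𝕜}
    (hc : c ≠ 0) (u : 𝕜) :
    reduced i (scaleJet c p) (c * u) = c ^ jetWeight i * reduced i p u := by
  obtain ⟨h, g, hg, hs, hr⟩ := exists_jetAct_eq_reduced i p u
  obtain ⟨h'', g'', hg'', H⟩ := exists_jetAct_comp p one_ne_zero hc h g (fun _ => 0) (fun _ => 0)
    (i.1.val + i.2)
  simp only [scaleJet_one, one_mul, jetAct_zero_zero, add_zero] at hg'' H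
  rw [reduced_eq hi (hg''.trans (by rw [hg])) fun i' h1 h2 => by
    rw [← H i' h2, scaleJet, hs i' h1, mul_zero], ← H i le_rfl, scaleJet, hr]

theorem reduced_jetAct_scaleJet {i : Fin n × ℕ} (hi : 2 ≤ i.1.val) (p : Fin n × ℕ → 𝕜) {c : 𝕜}
    (hc : c ≠ 0) (h g : ℕ → 𝕜) (u : 𝕜) :
    reduced i (jetAct (scaleJet c p) h g) (c * u - g 0) = c ^ jetWeight i * reduced i p u := by
  rw [reduced_jetAct hi p hc, add_sub_cancel, reduced_scaleJet hi p hc]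

theorem reduced_jetAct_of_one {i : Fin n × ℕ} (hi : 2 ≤ i.1.val) (p : Fin n × ℕ → 𝕜)
    (h g : ℕ → 𝕜) (u : 𝕜) : reduced i (jetAct p h g) u = reduced i p (g 0 + u) := by
  have := reduced_jetAct hi p one_ne_zero h g u
  simpa using this

/-- Under dilation by 2 the function of u is homogeneous of degree `jetWeight i` ≥ 3, whereas
additivity makes the factor 2; hence it vanishes. -/
theorem reduced_zero_jet_of_add {i : Fin n × ℕ} (hi : 2 ≤ i.1.val)
    (h : ∀ u : 𝕜, reduced i (fun _ => 0) (u + u) =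
      reduced i (fun _ => 0) u + reduced i (fun _ => 0) u) (u : 𝕜) :
    reduced i (fun _ => 0) u = 0 := by
  have h1 := reduced_scaleJet hi (fun _ => 0) (two_ne_zero (α := 𝕜)) u
  rw [scaleJet_zero_right, two_mul, h u, ← two_mul] at h1
  have h2 : (2 : 𝕜) ^ jetWeight i - 2 ≠ 0 := by
    intro h3
    have h4 : (2 : ℕ) ^ jetWeight i = 2 := by exact_mod_cast sub_eq_zero.1 h3
    have h5 := Nat.pow_right_injective le_rfl (h4.trans (pow_one 2).symm)
    simp only [jetWeight] at h5
    omega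
  refine (mul_eq_zero.1 ?_).resolve_left h2
  linear_combination -h1

variable {j : Fin n} (hj : j.val = 2)
include hj

theorem reduced_two_zero_eq {p : Fin n × ℕ → 𝕜} (hp : ∀ i : Fin n × ℕ, i.1.val ≤ 1 → i.2 ≤ 2 →
    i.1.val + i.2 ≤ 2 → p i = 0) (u : 𝕜) :
    reduced (j, 0) p u = p (j, 0) + reduced (j, 0) (fun _ => 0) u := by
  have := reduced_sub_of_agree (i := (j, 0)) hj.ge (p := p) (p' := fun _ => 0) u (fun i h1 h2 => by
    simp only [hj, IsSlice] at h1 h2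
    exact hp i (by omega) (by omega) (by omega))
  linear_combination this

/-- Normalize the zero jet with parameter u, then again with u. After the first step the relevant
slice coordinates are zero, so the second adds the same amount, and the function of u is additive.
-/
theorem reduced_two_zero_zero (u : 𝕜) : reduced (j, 0) (fun _ => 0) u = 0 := by
  refine reduced_zero_jet_of_add hj.ge (fun u => ?_) u
  obtain ⟨h, g, hg, hs, hr⟩ := exists_jetAct_eq_reduced (j, 0) (fun _ => (0 : 𝕜)) u
  have h1 := reduced_jetAct_of_one (i := (j, 0)) hj.ge (fun _ => (0 : 𝕜)) h g u
  rw [hg] at h1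
  rw [← h1, reduced_two_zero_eq hj, hr]
  exact fun i h2 h3 _ => hs i ⟨h3, Or.inl h2⟩

theorem reduced_two_zero_eq_of_slice {p : Fin n × ℕ → 𝕜} (hp : ∀ i : Fin n × ℕ, i.1.val ≤ 1 →
    i.2 ≤ 2 → i.1.val + i.2 ≤ 2 → p i = 0) (u : 𝕜) : reduced (j, 0) p u = p (j, 0) := by
  rw [reduced_two_zero_eq hj hp, reduced_two_zero_zero hj, add_zero]

/-- The first reduced coordinate does not depend on `ξ''`. -/
theorem reduced_two_zero_const (p : Fin n × ℕ → 𝕜) (u : 𝕜) :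
    reduced (j, 0) p u = reduced (j, 0) p 0 := by
  obtain ⟨h, g, hg, hs, hr⟩ := exists_jetAct_eq_reduced (j, 0) p 0
  have h1 := reduced_jetAct_of_one (i := (j, 0)) hj.ge p h g u
  rw [hg, zero_add] at h1
  rw [← h1, reduced_two_zero_eq_of_slice hj, hr]
  exact fun i h2 h3 _ => hs i ⟨h3, Or.inl h2⟩

/-- Passes from normalized jets to all jets: bring p to the slice with parameter v, then shift by u.
On the zero jet the resulting formula is additive, because θ vanishes there, so the constant term
drops out. -/
theorem reduced_shift {i : Fin n × ℕ} (hi : 2 ≤ i.1.val) {k : 𝕜}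
    (H : ∀ (p : Fin n × ℕ → 𝕜), (∀ i', IsSlice (i.2 + 2) i' → p i' = 0) → ∀ u,
      reduced i p u = p i + k * u * p (j, 0) + reduced i (fun _ => 0) u)
    (p : Fin n × ℕ → 𝕜) (u : 𝕜) :
    reduced i p u = reduced i p 0 + k * u * reduced (j, 0) p 0 := by
  have key (p : Fin n × ℕ → 𝕜) (u v : 𝕜) : reduced i p (v + u) = reduced i p v +
      k * u * reduced (j, 0) p 0 + reduced i (fun _ => 0) u := by
    obtain ⟨h, g, hg, hs, hr⟩ := exists_jetAct_eq_reduced i p v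
    have h1 := reduced_jetAct_of_one hi p h g u
    have h2 := reduced_jetAct_of_one (i := (j, 0)) hj.ge p h g 0
    rw [reduced_two_zero_const hj p, reduced_two_zero_eq_of_slice hj] at h2
    · rw [hg] at h1
      rw [← h1, H _ hs, hr, h2]
    · exact fun i' h3 h4 h5 => hs i' ⟨by omega, Or.inl h3⟩
  have h0 (u : 𝕜) : reduced i (fun _ => 0) u = 0 := by
    refine reduced_zero_jet_of_add hi (fun u => ?_) u
    rw [key, reduced_two_zero_zero hj]
    ring
  have := key p u 0
  rwa [zero_add, h0, add_zero] at this

end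

/-! ### Polynomial relative invariants -/

section
variable {𝕜 : Type*} [RCLike 𝕜] {n : ℕ}

/-- The index of the first reduced coordinate, the relative invariant of weight `3`. -/
def thetaIdx (hn : 2 < n) : Fin n × ℕ := (⟨2, hn⟩, 0)

/-- The index of the reduced coordinate that is used to normalize `ξ''`. -/
def kappaIdx (hn : 2 < n) : Fin n × ℕ := if h : 3 < n then (⟨3, h⟩, 0) else (⟨2, hn⟩, 1)

/-- The rate at which the coordinate `kappaIdx` depends on `ξ''`. -/
noncomputable def kappaCoeff (𝕜 : Type*) [RCLike 𝕜] (n : ℕ) : 𝕜 :=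
  if 3 < n then 3 * (n - 3) / 10 else 3

theorem kappaCoeff_ne_zero : kappaCoeff 𝕜 n ≠ 0 := by
  unfold kappaCoeff
  split_ifs with h
  · have : (n - 3 : 𝕜) ≠ 0 := by
      rw [sub_ne_zero]
      exact_mod_cast h.ne'
    exact div_ne_zero (mul_ne_zero three_ne_zero this) (by norm_num)
  · exact three_ne_zero

theorem two_le_kappaIdx (hn : 2 < n) : 2 ≤ (kappaIdx hn).1.val := by
  unfold kappaIdx
  split_ifs <;> simp

theorem jetWeight_kappaIdx (hn : 2 < n) : jetWeight (kappaIdx hn) = 4 := by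
  unfold kappaIdx
  split_ifs <;> simp [jetWeight]

/-- Since the coefficient of u is a nonzero multiple of θ, the remaining freedom in ξ'' is used up,
where θ ≠ 0, by making this coordinate vanish. -/
theorem reduced_kappaIdx (hn : 2 < n) (p : Fin n × ℕ → 𝕜) (u : 𝕜) :
    reduced (kappaIdx hn) p u = reduced (kappaIdx hn) p 0 +
      kappaCoeff 𝕜 n * u * reduced (thetaIdx hn) p 0 := by
  refine reduced_shift rfl (two_le_kappaIdx hn) (fun p hp u => ?_) p u
  unfold kappaIdx kappaCoeff at *
  split_ifs at hp ⊢ with h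
  · exact reduced_eq_of_slice_two rfl rfl hp u
  · exact reduced_eq_of_slice_three rfl hp u

theorem reduced_thetaIdx_jetAct (hn : 2 < n) (p : Fin n × ℕ → 𝕜) {c : 𝕜} (hc : c ≠ 0)
    (h g : ℕ → 𝕜) : reduced (thetaIdx hn) (jetAct (scaleJet c p) h g) 0 =
      c ^ 3 * reduced (thetaIdx hn) p 0 := by
  have := reduced_jetAct_scaleJet (i := thetaIdx hn) le_rfl p hc h g 0
  rwa [thetaIdx, reduced_two_zero_const rfl] at this

theorem reduced_kappaIdx_jetAct (hn : 2 < n) (p : Fin n × ℕ → 𝕜) {c : 𝕜} (hc : c ≠ 0)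
    (h g : ℕ → 𝕜) : reduced (kappaIdx hn) (jetAct (scaleJet c p) h g) 0 =
      c ^ 4 * reduced (kappaIdx hn) p 0 +
        c ^ 3 * kappaCoeff 𝕜 n * g 0 * reduced (thetaIdx hn) p 0 := by
  have := reduced_jetAct_scaleJet (two_le_kappaIdx hn) p hc h g (g 0 / c)
  rw [mul_div_cancel₀ _ hc, sub_self, reduced_kappaIdx hn p, jetWeight_kappaIdx] at this
  rw [this]
  field_simp

/-- The value of `ξ''` that makes the reduced coordinate `kappaIdx` vanish. -/
noncomputable def kappaShift (hn : 2 < n) (p : Fin n × ℕ → 𝕜) : 𝕜 :=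
  -reduced (kappaIdx hn) p 0 / kappaCoeff 𝕜 n / reduced (thetaIdx hn) p 0

/-- This is exactly the change of u in `reduced_jetAct_scaleJet`, so substituting `kappaShift` for u
makes a reduced coordinate a true relative invariant. -/
theorem kappaShift_jetAct (hn : 2 < n) (p : Fin n × ℕ → 𝕜) {c : 𝕜} (hc : c ≠ 0) (h g : ℕ → 𝕜)
    (hp : reduced (thetaIdx hn) p 0 ≠ 0) :
    kappaShift hn (jetAct (scaleJet c p) h g) = c * kappaShift hn p - g 0 := by
  have := kappaCoeff_ne_zero (𝕜 := 𝕜) (n := n)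
  rw [kappaShift, kappaShift, reduced_kappaIdx_jetAct hn p hc, reduced_thetaIdx_jetAct hn p hc]
  field_simp
  ring

theorem MvPolynomial.exists_clear_denom {σ K : Type*} [Field K] (Q : MvPolynomial (Option σ) K)
    (A T : MvPolynomial σ K) : ∃ (M : ℕ) (S : MvPolynomial σ K), ∀ p, eval p T ≠ 0 →
      eval p S = eval p T ^ M * eval (fun o => o.elim (eval p A / eval p T) p) Q := by
  induction Q using MvPolynomial.induction_on with
  | C a => exact ⟨0, C a, fun p _ => by simp⟩
  | add Q₁ Q₂ h₁ h₂ =>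
    obtain ⟨M₁, S₁, h₁⟩ := h₁
    obtain ⟨M₂, S₂, h₂⟩ := h₂
    refine ⟨M₁ + M₂, S₁ * T ^ M₂ + S₂ * T ^ M₁, fun p hp => ?_⟩
    simp only [map_add, map_mul, map_pow, h₁ p hp, h₂ p hp]
    ring
  | mul_X Q v h =>
    obtain ⟨M, S, h⟩ := h
    rcases v with _ | v
    · refine ⟨M + 1, S * A, fun p hp => ?_⟩
      simp only [map_mul, h p hp, eval_X, Option.elim_none]
      field_simp
      ring
    · refine ⟨M, S * X v, fun p hp => ?_⟩
      simp only [map_mul, h p hp, eval_X, Option.elim_some]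
      ring

/-- A reduced coordinate for `ξ'' = 0`, as a polynomial in the jet. -/
noncomputable def reducedPolyZero (𝕜 : Type*) [RCLike 𝕜] {n : ℕ} (i : Fin n × ℕ) : DiffPoly 𝕜 n :=
  aeval (fun o => o.elim 0 X) (reducedPoly 𝕜 i)

theorem MvPolynomial.eval_aeval {σ τ K : Type*} [CommRing K] (f : σ → MvPolynomial τ K)
    (p : τ → K) (Q : MvPolynomial σ K) :
    eval p (aeval f Q) = eval (fun o => eval p (f o)) Q := by
  induction Q using MvPolynomial.induction_on with
  | C a => simp [← algebraMap_eq]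
  | add Q₁ Q₂ h₁ h₂ => rw [map_add, map_add, map_add, h₁, h₂]
  | mul_X Q v h => rw [map_mul, map_mul, map_mul, h, aeval_X, eval_X]

theorem eval_reducedPolyZero (i : Fin n × ℕ) (p : Fin n × ℕ → 𝕜) :
    eval p (reducedPolyZero 𝕜 i) = reduced i p 0 := by
  rw [reducedPolyZero, MvPolynomial.eval_aeval, reduced]
  congr 2
  funext o
  cases o <;> simp

theorem exists_relPoly (hn : 2 < n) (i : Fin n × ℕ) : ∃ (M : ℕ) (S : DiffPoly 𝕜 n),
    (∀ p, reduced (thetaIdx hn) p 0 ≠ 0 →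
      eval p S = reduced (thetaIdx hn) p 0 ^ M * reduced i p (kappaShift hn p)) ∧
    ∀ p, reduced (thetaIdx hn) p 0 = 0 → eval p S = 0 := by
  obtain ⟨M, S, H⟩ := MvPolynomial.exists_clear_denom (reducedPoly 𝕜 i)
    (C (-(kappaCoeff 𝕜 n)⁻¹) * reducedPolyZero 𝕜 (kappaIdx hn)) (reducedPolyZero 𝕜 (thetaIdx hn))
  -- The extra factor θ forces the polynomial to vanish where θ = 0 and `kappaShift` has no meaning;
  -- relative invariance then holds at every jet.
  refine ⟨M + 1, S * reducedPolyZero 𝕜 (thetaIdx hn), fun p hp => ?_, fun p hp => ?_⟩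
  · have h1 := H p (by rwa [eval_reducedPolyZero])
    simp only [map_mul, eval_C, eval_reducedPolyZero] at h1 ⊢
    rw [h1, reduced.eq_def i, kappaShift, pow_succ]
    have : -(kappaCoeff 𝕜 n)⁻¹ * reduced (kappaIdx hn) p 0 / reduced (thetaIdx hn) p 0 =
      -reduced (kappaIdx hn) p 0 / kappaCoeff 𝕜 n / reduced (thetaIdx hn) p 0 := by ring
    rw [this]
    ring
  · rw [map_mul, eval_reducedPolyZero, hp, mul_zero]

/-- The exponent of the first relative invariant in `relPoly`. -/
noncomputable def relExp (𝕜 : Type*) [RCLike 𝕜] (hn : 2 < n) (i : Fin n × ℕ) : ℕ :=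
  (exists_relPoly (𝕜 := 𝕜) hn i).choose

/-- The relative invariant obtained from the reduced coordinate `i`. -/
noncomputable def relPoly (𝕜 : Type*) [RCLike 𝕜] (hn : 2 < n) (i : Fin n × ℕ) : DiffPoly 𝕜 n :=
  (exists_relPoly (𝕜 := 𝕜) hn i).choose_spec.choose

/-- The weight of `relPoly`. -/
noncomputable def relWeight (𝕜 : Type*) [RCLike 𝕜] (hn : 2 < n) (i : Fin n × ℕ) : ℕ :=
  3 * relExp 𝕜 hn i + jetWeight i

theorem eval_relPoly (hn : 2 < n) (i : Fin n × ℕ) {p : Fin n × ℕ → 𝕜}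
    (hp : reduced (thetaIdx hn) p 0 ≠ 0) : eval p (relPoly 𝕜 hn i) =
      reduced (thetaIdx hn) p 0 ^ relExp 𝕜 hn i * reduced i p (kappaShift hn p) :=
  (exists_relPoly (𝕜 := 𝕜) hn i).choose_spec.choose_spec.1 p hp

theorem eval_relPoly_of_eq_zero (hn : 2 < n) (i : Fin n × ℕ) {p : Fin n × ℕ → 𝕜}
    (hp : reduced (thetaIdx hn) p 0 = 0) : eval p (relPoly 𝕜 hn i) = 0 :=
  (exists_relPoly (𝕜 := 𝕜) hn i).choose_spec.choose_spec.2 p hp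

/-- Relative invariance with respect to the action on jets. -/
def IsJetInvariant (S : DiffPoly 𝕜 n) (m : ℕ) : Prop :=
  ∀ (p : Fin n × ℕ → 𝕜) (c : 𝕜), c ≠ 0 → ∀ h g : ℕ → 𝕜,
    eval (jetAct (scaleJet c p) h g) S = c ^ m * eval p S

theorem IsJetInvariant.pow {S : DiffPoly 𝕜 n} {m : ℕ} (H : IsJetInvariant S m) (k : ℕ) :
    IsJetInvariant (S ^ k) (m * k) := fun p c hc h g => by
  rw [map_pow, map_pow, H p c hc, mul_pow, pow_mul]

theorem isJetInvariant_theta (hn : 2 < n) :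
    IsJetInvariant (reducedPolyZero 𝕜 (thetaIdx hn)) 3 := fun p c hc h g => by
  rw [eval_reducedPolyZero, eval_reducedPolyZero, reduced_thetaIdx_jetAct hn p hc]

theorem isJetInvariant_relPoly (hn : 2 < n) {i : Fin n × ℕ} (hi : 2 ≤ i.1.val) :
    IsJetInvariant (relPoly 𝕜 hn i) (relWeight 𝕜 hn i) := fun p c hc h g => by
  have h1 := reduced_thetaIdx_jetAct hn p hc h g
  by_cases hp : reduced (thetaIdx hn) p 0 = 0
  · rw [eval_relPoly_of_eq_zero hn i hp, eval_relPoly_of_eq_zero, mul_zero]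
    rw [h1, hp, mul_zero]
  · rw [eval_relPoly hn i hp, eval_relPoly, kappaShift_jetAct hn p hc h g hp,
      reduced_jetAct_scaleJet hi p hc, h1, relWeight, pow_add, pow_mul]
    · ring
    · rw [h1]
      exact mul_ne_zero (pow_ne_zero 3 hc) hp

theorem coeff_aeval_C_mul_X {σ K : Type*} [CommRing K] (a : σ → K) (d : σ →₀ ℕ)
    (Q : MvPolynomial σ K) : coeff d (aeval (fun v => C (a v) * X v) Q) =
      (d.prod fun v k => a v ^ k) * coeff d Q := by
  classical
  induction Q using MvPolynomial.induction_on' with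
  | monomial e r =>
    have : aeval (fun v => C (a v) * X v) (monomial e r) =
        monomial e ((e.prod fun v k => a v ^ k) * r) := by
      rw [aeval_monomial, algebraMap_eq, mul_comm _ r, ← C_mul_monomial, monomial_eq (s := e)]
      congr 1
      simp only [mul_pow, Finsupp.prod, Finset.prod_mul_distrib, map_prod, map_pow]
    rw [this, coeff_monomial, coeff_monomial]
    split_ifs with h
    · rw [h]
    · rw [mul_zero]
  | add P Q hP hQ => rw [map_add, coeff_add, coeff_add, hP, hQ, mul_add]

/-- Dilation by 2 multiplies each monomial by 2 to its weight and S by 2^m; compare coefficients and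
use that distinct powers of 2 differ. -/
theorem IsJetInvariant.hasWeight {S : DiffPoly 𝕜 n} {m : ℕ} (H : IsJetInvariant S m) :
    HasWeight S m := by
  have h1 : aeval (fun i : Fin n × ℕ => C ((2 : 𝕜) ^ jetWeight i) * X i) S = C ((2 : 𝕜) ^ m) * S := by
    refine MvPolynomial.funext fun p => ?_
    have := H p 2 two_ne_zero (fun _ => 0) (fun _ => 0)
    rw [jetAct_zero_zero] at this
    rw [MvPolynomial.eval_aeval]
    simp only [map_mul, eval_C, eval_X]
    exact this
  intro d hd
  have h2 := coeff_aeval_C_mul_X (fun i : Fin n × ℕ => (2 : 𝕜) ^ jetWeight i) d S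
  rw [h1, coeff_C_mul] at h2
  have h3 := mul_right_cancel₀ hd h2
  simp only [Finsupp.prod, ← pow_mul, Finset.prod_pow_eq_pow_sum] at h3
  have h4 : (2 : ℕ) ^ m = 2 ^ ∑ x ∈ d.support, jetWeight x * d x := by exact_mod_cast h3
  have h5 := Nat.pow_right_injective le_rfl h4
  rw [Finsupp.weight_apply, h5, Finsupp.sum]
  refine Finset.sum_congr rfl fun i _ => ?_
  rw [smul_eq_mul, mul_comm, jetWeight]

theorem isCharacter_deriv_pow (m : ℕ) :
    IsCharacter (fun (ξ _ : 𝕜 → 𝕜) z => deriv ξ z ^ m) := by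
  intro ξ₁ η₁ ξ₂ η₂ t h₂ _ _ _ h₁ _ _ _
  have := ((h₁.differentiableAt (by simp)).hasDerivAt.comp t
    (h₂.differentiableAt (by simp)).hasDerivAt).deriv
  simp only [← mul_pow, ← this]
  rfl

theorem IsJetInvariant.isRelativeInvariantOfWeight {S : DiffPoly 𝕜 n} {m : ℕ}
    (H : IsJetInvariant S m) : IsRelativeInvariantOfWeight S m :=
  ⟨H.hasWeight, isCharacter_deriv_pow m, fun _ _ _ _ _ _ ht z hz _ _ => by
    rw [ht.coeffJet_eq hz]
    exact H _ _ (ht.deriv_xi_ne z hz) _ _⟩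

end

/-! ### The absolute invariants, their order and domain -/

section
variable {𝕜 : Type*} [RCLike 𝕜] {n : ℕ}

/-- The indices of the reduced coordinates that give rise to absolute invariants. -/
def IsInvariantIdx (hn : 2 < n) (i : Fin n × ℕ) : Prop :=
  2 ≤ i.1.val ∧ i ≠ thetaIdx hn ∧ i ≠ kappaIdx hn

/-- `reduced i'` sees only orders up to i'.2 + 2 and total indices up to that of i', while the pivot
of i has order i.2 + 2 and the total index of i. This is the triangular structure behind
independence. -/
theorem reduced_update_pivot_of_not_le {i i' : Fin n × ℕ} (hi : 2 ≤ i.1.val) (hi' : 2 ≤ i'.1.val)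
    (h : ¬ (i.2 ≤ i'.2 ∧ i.1.val + i.2 ≤ i'.1.val + i'.2)) (p : Fin n × ℕ → 𝕜) (x u : 𝕜) :
    reduced i' (Function.update p (pivot i) x) u = reduced i' p u := by
  refine reduced_congr hi' u fun v h1 h2 => Function.update_of_ne ?_ _ _
  rintro rfl
  rw [pivot_val_add hi] at h2
  exact h ⟨Nat.le_of_add_le_add_right h1, h2⟩

theorem IsInvariantIdx.not_le_theta {hn : 2 < n} {i : Fin n × ℕ} (hi : IsInvariantIdx hn i) :
    ¬ (i.2 ≤ (thetaIdx hn).2 ∧ i.1.val + i.2 ≤ (thetaIdx hn).1.val + (thetaIdx hn).2) := by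
  obtain ⟨h1, h2, -⟩ := hi
  rintro ⟨h3, h4⟩
  simp only [thetaIdx] at h3 h4
  exact h2 (Prod.ext (Fin.ext (by simp only [thetaIdx]; omega)) (by simp only [thetaIdx]; omega))

/-- θ and κ precede all other indices in the triangular order, so the pivots of the others leave θ
and `kappaShift` fixed. -/
theorem IsInvariantIdx.not_le_kappa {hn : 2 < n} {i : Fin n × ℕ} (hi : IsInvariantIdx hn i) :
    ¬ (i.2 ≤ (kappaIdx hn).2 ∧ i.1.val + i.2 ≤ (kappaIdx hn).1.val + (kappaIdx hn).2) := by
  have h0 := hi.not_le_theta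
  obtain ⟨h1, h2, h3⟩ := hi
  have hlt := i.1.2
  rintro ⟨h4, h5⟩
  unfold kappaIdx at h3 h4 h5
  simp only [thetaIdx] at h0
  split_ifs at h3 h4 h5 with h
  · exact h3 (Prod.ext (Fin.ext (by simp only at h4 h5 ⊢; omega)) (by simp only at h4 h5 ⊢; omega))
  · exact h3 (Prod.ext (Fin.ext (by simp only at h4 h5 ⊢; omega)) (by simp only at h4 h5 ⊢; omega))

theorem IsInvariantIdx.kappa_le {hn : 2 < n} {i : Fin n × ℕ} (hi : IsInvariantIdx hn i) :
    (kappaIdx hn).2 ≤ i.2 := by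
  have h0 := hi.not_le_kappa
  obtain ⟨h1, -, -⟩ := hi
  have hlt := i.1.2
  unfold kappaIdx at h0 ⊢
  split_ifs at h0 ⊢ with h
  · simp
  · simp only at h0 ⊢
    omega

theorem reduced_thetaIdx_update {hn : 2 < n} {i : Fin n × ℕ} (hi : IsInvariantIdx hn i)
    (p : Fin n × ℕ → 𝕜) (x : 𝕜) :
    reduced (thetaIdx hn) (Function.update p (pivot i) x) 0 = reduced (thetaIdx hn) p 0 :=
  reduced_update_pivot_of_not_le hi.1 le_rfl hi.not_le_theta p x 0

theorem kappaShift_update {hn : 2 < n} {i : Fin n × ℕ} (hi : IsInvariantIdx hn i)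
    (p : Fin n × ℕ → 𝕜) (x : 𝕜) :
    kappaShift hn (Function.update p (pivot i) x) = kappaShift hn p := by
  rw [kappaShift, kappaShift, reduced_thetaIdx_update hi,
    reduced_update_pivot_of_not_le hi.1 (two_le_kappaIdx hn) hi.not_le_kappa]

theorem eval_relPoly_update {hn : 2 < n} {i : Fin n × ℕ} (hi : IsInvariantIdx hn i)
    {p : Fin n × ℕ → 𝕜} (hp : reduced (thetaIdx hn) p 0 ≠ 0) (x : 𝕜) :
    eval (Function.update p (pivot i) x) (relPoly 𝕜 hn i) = eval p (relPoly 𝕜 hn i) +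
      reduced (thetaIdx hn) p 0 ^ relExp 𝕜 hn i * pivotCoeff 𝕜 i * (x - p (pivot i)) := by
  rw [eval_relPoly hn i hp, eval_relPoly hn i (by rwa [reduced_thetaIdx_update hi]),
    kappaShift_update hi, reduced_thetaIdx_update hi, reduced_update_pivot hi.1]
  ring

theorem eval_relPoly_update_of_not_le {hn : 2 < n} {i i' : Fin n × ℕ} (hi : IsInvariantIdx hn i)
    (hi' : 2 ≤ i'.1.val) (h : ¬ (i.2 ≤ i'.2 ∧ i.1.val + i.2 ≤ i'.1.val + i'.2))
    (p : Fin n × ℕ → 𝕜) (x : 𝕜) :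
    eval (Function.update p (pivot i) x) (relPoly 𝕜 hn i') = eval p (relPoly 𝕜 hn i') := by
  by_cases hp : reduced (thetaIdx hn) p 0 = 0
  · rw [eval_relPoly_of_eq_zero hn i' hp, eval_relPoly_of_eq_zero hn]
    rwa [reduced_thetaIdx_update hi]
  · rw [eval_relPoly hn i' hp, eval_relPoly hn i' (by rwa [reduced_thetaIdx_update hi]),
      kappaShift_update hi, reduced_thetaIdx_update hi, reduced_update_pivot_of_not_le hi.1 hi' h]

theorem reduced_congr_order {i : Fin n × ℕ} (hi : 2 ≤ i.1.val) {r : ℕ} (hr : i.2 + 2 ≤ r)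
    {p p' : Fin n × ℕ → 𝕜} (hp : ∀ v, v.2 ≤ r → p v = p' v) (u : 𝕜) :
    reduced i p u = reduced i p' u :=
  reduced_congr hi u fun v hv _ => hp v (hv.trans hr)

theorem eval_relPoly_congr {hn : 2 < n} {i : Fin n × ℕ} (hi : IsInvariantIdx hn i) {r : ℕ}
    (hr : i.2 + 2 ≤ r) {p p' : Fin n × ℕ → 𝕜} (hp : ∀ v, v.2 ≤ r → p v = p' v) :
    eval p (relPoly 𝕜 hn i) = eval p' (relPoly 𝕜 hn i) := by
  have h1 : reduced (thetaIdx hn) p 0 = reduced (thetaIdx hn) p' 0 :=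
    reduced_congr_order le_rfl (by simp only [thetaIdx]; omega) hp 0
  have h2 : reduced (kappaIdx hn) p 0 = reduced (kappaIdx hn) p' 0 :=
    reduced_congr_order (two_le_kappaIdx hn) (by have := hi.kappa_le; omega) hp 0
  by_cases h0 : reduced (thetaIdx hn) p 0 = 0
  · rw [eval_relPoly_of_eq_zero hn i h0, eval_relPoly_of_eq_zero hn i (h1 ▸ h0)]
  · rw [eval_relPoly hn i h0, eval_relPoly hn i (h1 ▸ h0), kappaShift, kappaShift, h1, h2,
      reduced_congr_order hi.1 hr hp]

/-- Setting the variables outside s to zero does not change S as a function, hence, over an infinite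
field, not as a polynomial. -/
theorem MvPolynomial.vars_subset_of_eval_congr {σ K : Type*} [Field K] [Infinite K] {s : Set σ}
    {S : MvPolynomial σ K} (H : ∀ p p' : σ → K, (∀ v ∈ s, p v = p' v) → eval p S = eval p' S) :
    ↑S.vars ⊆ s := by
  classical
  rw [← mem_supported (R := K)]
  have h1 : S = aeval (fun v => if v ∈ s then X v else 0) S := by
    refine MvPolynomial.funext fun p => ?_
    rw [MvPolynomial.eval_aeval]
    refine H _ _ fun v hv => ?_
    simp [hv]
  rw [h1]
  have h2 (Q : MvPolynomial σ K) : aeval (fun v => if v ∈ s then X v else 0) Q ∈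
      supported K s := by
    induction Q using MvPolynomial.induction_on with
    | C a => simpa [← algebraMap_eq] using algebraMap_mem (supported K s) a
    | add P Q hP hQ => rw [map_add]; exact add_mem hP hQ
    | mul_X P v hP =>
      rw [map_mul, aeval_X]
      refine mul_mem hP ?_
      split_ifs with hv
      · exact X_mem_supported_of_mem hv
      · exact zero_mem _
  exact h2 S

theorem MvPolynomial.vars_subset_of_dvd {σ K : Type*} [Field K] {P Q : MvPolynomial σ K}
    (h : P ∣ Q) (hQ : Q ≠ 0) : P.vars ⊆ Q.vars := by
  obtain ⟨T, rfl⟩ := h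
  intro v hv
  rw [mem_vars_iff_degreeOf_ne_zero] at hv ⊢
  rw [degreeOf_mul_eq (left_ne_zero_of_mul hQ) (right_ne_zero_of_mul hQ)]
  omega

namespace DiffRat

variable {f : DiffRat 𝕜 n} {S₁ S₂ : DiffPoly 𝕜 n}

theorem num_mul_eq (hS₂ : S₂ ≠ 0) (hf : f = algebraMap (DiffPoly 𝕜 n) (DiffRat 𝕜 n) S₁ /
    algebraMap (DiffPoly 𝕜 n) (DiffRat 𝕜 n) S₂) :
    IsFractionRing.num (DiffPoly 𝕜 n) f * S₂ =
      (IsFractionRing.den (DiffPoly 𝕜 n) f : DiffPoly 𝕜 n) * S₁ := by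
  have h1 := IsFractionRing.mk'_num_den (DiffPoly 𝕜 n) f
  rw [IsFractionRing.mk'_eq_div, hf] at h1
  have h2 : algebraMap (DiffPoly 𝕜 n) (DiffRat 𝕜 n) S₂ ≠ 0 :=
    (map_ne_zero_iff _ (IsFractionRing.injective _ _)).2 hS₂
  rw [div_eq_div_iff (IsFractionRing.to_map_ne_zero_of_mem_nonZeroDivisors (Subtype.prop _)) h2,
    ← hf, ← map_mul, ← map_mul] at h1
  rw [IsFractionRing.injective _ _ h1, mul_comm]

theorem den_dvd (hS₂ : S₂ ≠ 0) (hf : f = algebraMap (DiffPoly 𝕜 n) (DiffRat 𝕜 n) S₁ /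
    algebraMap (DiffPoly 𝕜 n) (DiffRat 𝕜 n) S₂) :
    (IsFractionRing.den (DiffPoly 𝕜 n) f : DiffPoly 𝕜 n) ∣ S₂ :=
  (IsFractionRing.num_den_reduced (DiffPoly 𝕜 n) f).symm.dvd_of_dvd_mul_left
    (Dvd.intro _ (num_mul_eq hS₂ hf).symm)

theorem num_dvd (hS₂ : S₂ ≠ 0) (hf : f = algebraMap (DiffPoly 𝕜 n) (DiffRat 𝕜 n) S₁ /
    algebraMap (DiffPoly 𝕜 n) (DiffRat 𝕜 n) S₂) : IsFractionRing.num (DiffPoly 𝕜 n) f ∣ S₁ :=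
  (IsFractionRing.num_den_reduced (DiffPoly 𝕜 n) f).dvd_of_dvd_mul_left
    (Dvd.intro _ (num_mul_eq hS₂ hf))

theorem mem_domain (hf : f = algebraMap (DiffPoly 𝕜 n) (DiffRat 𝕜 n) S₁ /
    algebraMap (DiffPoly 𝕜 n) (DiffRat 𝕜 n) S₂) {p : Fin n × ℕ → 𝕜} (hp : eval p S₂ ≠ 0) :
    p ∈ f.domain := by
  have hS₂ : S₂ ≠ 0 := by
    rintro rfl
    simp at hp
  obtain ⟨T, hT⟩ := den_dvd hS₂ hf
  rw [hT, map_mul] at hp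
  exact left_ne_zero_of_mul hp

theorem value_eq (hf : f = algebraMap (DiffPoly 𝕜 n) (DiffRat 𝕜 n) S₁ /
    algebraMap (DiffPoly 𝕜 n) (DiffRat 𝕜 n) S₂) {p : Fin n × ℕ → 𝕜} (hp : eval p S₂ ≠ 0) :
    f.value p = eval p S₁ / eval p S₂ := by
  have hS₂ : S₂ ≠ 0 := by
    rintro rfl
    simp at hp
  have h1 := congrArg (eval p) (num_mul_eq hS₂ hf)
  rw [map_mul, map_mul] at h1
  rw [value, div_eq_div_iff (mem_domain hf hp) hp, h1, mul_comm]

theorem orderLE_of_eval_congr (hS₁ : S₁ ≠ 0) (hS₂ : S₂ ≠ 0)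
    (hf : f = algebraMap (DiffPoly 𝕜 n) (DiffRat 𝕜 n) S₁ /
      algebraMap (DiffPoly 𝕜 n) (DiffRat 𝕜 n) S₂) {r : ℕ}
    (H₁ : ∀ p p' : Fin n × ℕ → 𝕜, (∀ v, v.2 ≤ r → p v = p' v) → eval p S₁ = eval p' S₁)
    (H₂ : ∀ p p' : Fin n × ℕ → 𝕜, (∀ v, v.2 ≤ r → p v = p' v) → eval p S₂ = eval p' S₂) :
    f.OrderLE r :=
  ⟨fun _ hv => MvPolynomial.vars_subset_of_eval_congr (s := {v : Fin n × ℕ | v.2 ≤ r}) H₁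
      (MvPolynomial.vars_subset_of_dvd (num_dvd hS₂ hf) hS₁ hv),
    fun _ hv => MvPolynomial.vars_subset_of_eval_congr (s := {v : Fin n × ℕ | v.2 ≤ r}) H₂
      (MvPolynomial.vars_subset_of_dvd (den_dvd hS₂ hf) hS₂ hv)⟩

theorem OrderLE.value_congr {r : ℕ} (H : f.OrderLE r) {p p' : Fin n × ℕ → 𝕜}
    (hp : ∀ v, v.2 ≤ r → p v = p' v) : f.value p = f.value p' := by
  have h1 : eval p (IsFractionRing.num (DiffPoly 𝕜 n) f) =
      eval p' (IsFractionRing.num (DiffPoly 𝕜 n) f) :=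
    eval₂Hom_congr' rfl (fun v hv _ => hp v (H.1 v hv)) rfl
  have h2 : eval p (IsFractionRing.den (DiffPoly 𝕜 n) f : DiffPoly 𝕜 n) =
      eval p' (IsFractionRing.den (DiffPoly 𝕜 n) f : DiffPoly 𝕜 n) :=
    eval₂Hom_congr' rfl (fun v hv _ => hp v (H.2 v hv)) rfl
  rw [value, value, h1, h2]

end DiffRat

/-- The absolute invariant obtained from the reduced coordinate `i`. -/
noncomputable def absInvariant (𝕜 : Type*) [RCLike 𝕜] (hn : 2 < n) (i : Fin n × ℕ) : DiffRat 𝕜 n :=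
  algebraMap (DiffPoly 𝕜 n) (DiffRat 𝕜 n) (relPoly 𝕜 hn i ^ 3) /
    algebraMap (DiffPoly 𝕜 n) (DiffRat 𝕜 n)
      (reducedPolyZero 𝕜 (thetaIdx hn) ^ relWeight 𝕜 hn i)

theorem exists_reduced_thetaIdx_ne_zero (hn : 2 < n) {r : ℕ} (hr : 2 ≤ r) :
    ∃ p : Fin n × ℕ → 𝕜, (∀ v, r < v.2 → p v = 0) ∧ reduced (thetaIdx hn) p 0 ≠ 0 := by
  refine ⟨Function.update (fun _ => 0) (pivot (thetaIdx hn)) 1, fun v hv => ?_, ?_⟩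
  · refine Function.update_of_ne ?_ _ _
    rintro rfl
    simp only [pivot, thetaIdx] at hv
    omega
  · rw [reduced_update_pivot le_rfl, thetaIdx, reduced_two_zero_zero rfl]
    simpa using pivotCoeff_ne_zero (K := 𝕜) (i := ((⟨2, hn⟩, 0) : Fin n × ℕ)) le_rfl

theorem reducedPolyZero_thetaIdx_ne_zero (hn : 2 < n) : reducedPolyZero 𝕜 (thetaIdx hn) ≠ 0 := by
  obtain ⟨p, -, hp⟩ := exists_reduced_thetaIdx_ne_zero (𝕜 := 𝕜) hn le_rfl
  intro h
  rw [← eval_reducedPolyZero, h, map_zero] at hp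
  exact hp rfl

theorem exists_eval_relPoly_ne_zero {hn : 2 < n} {i : Fin n × ℕ} (hi : IsInvariantIdx hn i) {r : ℕ}
    (hr : i.2 + 2 ≤ r) : ∃ p : Fin n × ℕ → 𝕜, (∀ v, r < v.2 → p v = 0) ∧
      eval p (relPoly 𝕜 hn i) ≠ 0 := by
  obtain ⟨p, hp, hp'⟩ := exists_reduced_thetaIdx_ne_zero (𝕜 := 𝕜) hn (r := r) (by omega)
  by_cases h0 : eval p (relPoly 𝕜 hn i) = 0
  · refine ⟨Function.update p (pivot i) (p (pivot i) + 1), fun v hv => ?_, ?_⟩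
    · rw [Function.update_of_ne, hp v hv]
      rintro rfl
      simp only [pivot] at hv
      omega
    · rw [eval_relPoly_update hi hp', h0, zero_add, add_sub_cancel_left, mul_one]
      exact mul_ne_zero (pow_ne_zero _ hp') (pivotCoeff_ne_zero hi.1)
  · exact ⟨p, hp, h0⟩

theorem relPoly_ne_zero {hn : 2 < n} {i : Fin n × ℕ} (hi : IsInvariantIdx hn i) :
    relPoly 𝕜 hn i ≠ 0 := by
  obtain ⟨p, -, hp⟩ := exists_eval_relPoly_ne_zero (𝕜 := 𝕜) hi le_rfl
  rintro h
  rw [h, map_zero] at hp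
  exact hp rfl

theorem absInvariant_value {hn : 2 < n} {i : Fin n × ℕ} {p : Fin n × ℕ → 𝕜}
    (hp : reduced (thetaIdx hn) p 0 ≠ 0) :
    (absInvariant 𝕜 hn i).value p = eval p (relPoly 𝕜 hn i) ^ 3 /
      reduced (thetaIdx hn) p 0 ^ relWeight 𝕜 hn i := by
  rw [DiffRat.value_eq (f := absInvariant 𝕜 hn i) rfl, map_pow, map_pow, eval_reducedPolyZero]
  rw [map_pow, eval_reducedPolyZero]
  exact pow_ne_zero _ hp

theorem absInvariant_mem_domain {hn : 2 < n} {i : Fin n × ℕ} {p : Fin n × ℕ → 𝕜}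
    (hp : reduced (thetaIdx hn) p 0 ≠ 0) : p ∈ (absInvariant 𝕜 hn i).domain := by
  refine DiffRat.mem_domain (f := absInvariant 𝕜 hn i) rfl ?_
  rw [map_pow, eval_reducedPolyZero]
  exact pow_ne_zero _ hp

/-- The order is exactly that of the pivot, in which `relPoly` is affine and nonconstant where θ ≠
0. -/
theorem absInvariant_orderLE_iff {hn : 2 < n} {i : Fin n × ℕ} (hi : IsInvariantIdx hn i) {r : ℕ} :
    (absInvariant 𝕜 hn i).OrderLE r ↔ i.2 + 2 ≤ r := by
  constructor
  · intro H
    by_contra hr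
    obtain ⟨p, -, hp⟩ := exists_reduced_thetaIdx_ne_zero (𝕜 := 𝕜) hn le_rfl
    set k := reduced (thetaIdx hn) p 0 ^ relExp 𝕜 hn i * pivotCoeff 𝕜 i with hk
    have hk0 : k ≠ 0 := mul_ne_zero (pow_ne_zero _ hp) (pivotCoeff_ne_zero hi.1)
    have hval (x : 𝕜) : (absInvariant 𝕜 hn i).value p = (eval p (relPoly 𝕜 hn i) +
        k * (x - p (pivot i))) ^ 3 / reduced (thetaIdx hn) p 0 ^ relWeight 𝕜 hn i := by
      rw [hk, ← eval_relPoly_update hi hp, ← reduced_thetaIdx_update hi p x, ← absInvariant_value]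
      · refine H.value_congr fun v hv => (Function.update_of_ne ?_ _ _).symm
        rintro rfl
        simp only [pivot] at hv
        omega
      · rwa [reduced_thetaIdx_update hi]
    -- Two values of the pivot, at which `relPoly` equals 0 and 1.
    have h1 := hval (p (pivot i) - eval p (relPoly 𝕜 hn i) / k)
    have h2 := hval (p (pivot i) + (1 - eval p (relPoly 𝕜 hn i)) / k)
    have e1 : eval p (relPoly 𝕜 hn i) + k * (p (pivot i) - eval p (relPoly 𝕜 hn i) / k -
      p (pivot i)) = 0 := by field_simp; ring
    have e2 : eval p (relPoly 𝕜 hn i) + k * (p (pivot i) + (1 - eval p (relPoly 𝕜 hn i)) / k -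
      p (pivot i)) = 1 := by field_simp; ring
    rw [h1, e1, e2] at h2
    have := pow_ne_zero (relWeight 𝕜 hn i) hp
    field_simp at h2
    simp at h2
  · intro hr
    refine DiffRat.orderLE_of_eval_congr (f := absInvariant 𝕜 hn i)
      (pow_ne_zero _ (relPoly_ne_zero hi)) (pow_ne_zero _ (reducedPolyZero_thetaIdx_ne_zero hn)) rfl
      (fun p p' hp => ?_) (fun p p' hp => ?_)
    · rw [map_pow, map_pow, eval_relPoly_congr hi hr hp]
    · rw [map_pow, map_pow, eval_reducedPolyZero, eval_reducedPolyZero,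
        reduced_congr_order le_rfl (by simp only [thetaIdx]; omega) hp]

theorem continuous_jetAct {T : Type*} [TopologicalSpace T] {b : T → Fin n × ℕ → 𝕜}
    (hb : Continuous b) (h g : ℕ → 𝕜) : Continuous fun t => jetAct (b t) h g := by
  refine continuous_pi fun i => ?_
  have h1 (t : T) : jetAct (b t) h g i =
      eval (point (b t) h g) (map (algebraMap ℤ 𝕜) (transPoly i)) := by
    rw [jetAct, aeval_def, eval₂_eq_eval_map]
  simp only [h1]
  refine (MvPolynomial.continuous_eval _).comp (continuous_pi fun v => ?_)
  rcases v with v | v | v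
  · exact (continuous_apply v).comp hb
  · exact continuous_const
  · exact continuous_const

theorem absInvariant_jetAct {hn : 2 < n} {i : Fin n × ℕ} (hi : IsInvariantIdx hn i)
    {p : Fin n × ℕ → 𝕜} {c : 𝕜} (hc : c ≠ 0) (h g : ℕ → 𝕜)
    (hp : p ∈ (absInvariant 𝕜 hn i).domain)
    (hq : jetAct (scaleJet c p) h g ∈ (absInvariant 𝕜 hn i).domain) :
    (absInvariant 𝕜 hn i).value (jetAct (scaleJet c p) h g) = (absInvariant 𝕜 hn i).value p := by
  set f := absInvariant 𝕜 hn i with hf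
  have hgen (p : Fin n × ℕ → 𝕜) (hp : reduced (thetaIdx hn) p 0 ≠ 0) :
      f.value (jetAct (scaleJet c p) h g) = f.value p := by
    have hθ := reduced_thetaIdx_jetAct hn p hc h g
    have hc3 := pow_ne_zero 3 hc
    rw [hf, absInvariant_value hp, absInvariant_value (by rw [hθ]; exact mul_ne_zero hc3 hp), hθ,
      isJetInvariant_relPoly hn hi.1 p c hc]
    rw [mul_pow, mul_pow, ← pow_mul, ← pow_mul, mul_comm 3]
    exact mul_div_mul_left _ _ (pow_ne_zero _ hc)
  by_cases h0 : reduced (thetaIdx hn) p 0 = 0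
  -- The domain refers to lowest terms and might contain jets with θ = 0. Moving the pivot of θ
  -- makes θ ≠ 0, and the cross-multiplied identity extends by continuity.
  · set P : 𝕜 → Fin n × ℕ → 𝕜 := fun x => Function.update p (pivot (thetaIdx hn)) x with hP
    have hPc : Continuous P := continuous_const.update _ continuous_id
    have hQc : Continuous fun x => jetAct (scaleJet c (P x)) h g := by
      refine continuous_jetAct (continuous_pi fun v => ?_) h g
      exact continuous_const.mul ((continuous_apply v).comp hPc)
    have key : (fun x => eval (jetAct (scaleJet c (P x)) h g) (IsFractionRing.num (DiffPoly 𝕜 n) f) *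
          eval (P x) (IsFractionRing.den (DiffPoly 𝕜 n) f : DiffPoly 𝕜 n)) =
        fun x => eval (P x) (IsFractionRing.num (DiffPoly 𝕜 n) f) *
          eval (jetAct (scaleJet c (P x)) h g)
            (IsFractionRing.den (DiffPoly 𝕜 n) f : DiffPoly 𝕜 n) := by
      refine Continuous.ext_on (dense_compl_singleton (p (pivot (thetaIdx hn))))
        (((MvPolynomial.continuous_eval _).comp hQc).mul ((MvPolynomial.continuous_eval _).comp hPc))
        (((MvPolynomial.continuous_eval _).comp hPc).mul ((MvPolynomial.continuous_eval _).comp hQc))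
        fun x hx => ?_
      have hθ : reduced (thetaIdx hn) (P x) 0 ≠ 0 := by
        rw [hP, reduced_update_pivot le_rfl, h0, zero_add]
        exact mul_ne_zero (pivotCoeff_ne_zero le_rfl) (sub_ne_zero.2 hx)
      have h1 := hgen _ hθ
      rw [DiffRat.value, DiffRat.value, div_eq_div_iff] at h1
      · exact h1
      · refine absInvariant_mem_domain (hn := hn) (i := i) ?_
        rw [reduced_thetaIdx_jetAct hn _ hc]
        exact mul_ne_zero (pow_ne_zero 3 hc) hθ
      · exact absInvariant_mem_domain (hn := hn) (i := i) hθ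
    have h1 := congrFun key (p (pivot (thetaIdx hn)))
    simp only [hP, Function.update_eq_self] at h1
    rw [DiffRat.value, DiffRat.value, div_eq_div_iff hq hp, h1]
  · exact hgen p h0

theorem isAbsoluteInvariantOn_absInvariant {hn : 2 < n} {i : Fin n × ℕ}
    (hi : IsInvariantIdx hn i) :
    IsAbsoluteInvariantOn (absInvariant 𝕜 hn i).domain (absInvariant 𝕜 hn i).value := by
  refine ⟨fun _ _ _ _ _ _ _ _ _ _ _ _ _ => (one_mul 1).symm, ?_⟩
  intro J D ξ η a A H z hz ha hA
  rw [H.coeffJet_eq hz] at hA ⊢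
  rw [one_mul]
  exact absInvariant_jetAct hi (H.deriv_xi_ne z hz) _ _ ha hA

end

/-! ### Local analysis and equivalence of jets -/

section
variable {𝕜 : Type*} [RCLike 𝕜]

/-- A triangular family of functionals is jointly surjective. -/
theorem ContinuousLinearMap.pi_surjective_of_triangular {E ι : Type*} [NormedAddCommGroup E]
    [NormedSpace 𝕜 E] [Finite ι] (L : ι → E →L[𝕜] 𝕜) (e : ι → E) (ρ : ι → ℕ)
    (h0 : ∀ i i', i ≠ i' → ¬ ρ i < ρ i' → L i' (e i) = 0) (h1 : ∀ i, L i (e i) ≠ 0) :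
    Function.Surjective (ContinuousLinearMap.pi L) := by
  have := Fintype.ofFinite ι
  let T : (ι → 𝕜) →ₗ[𝕜] (ι → 𝕜) :=
    (ContinuousLinearMap.pi L : E →ₗ[𝕜] ι → 𝕜) ∘ₗ (Fintype.linearCombination 𝕜 e)
  have hT (x : ι → 𝕜) (i' : ι) : T x i' = ∑ i, x i * L i' (e i) := by
    simp [T, Fintype.linearCombination_apply]
  have hinj : Function.Injective T := by
    rw [← LinearMap.ker_eq_bot, LinearMap.ker_eq_bot']
    intro x hx
    suffices H : ∀ N, ∀ i, ρ i = N → x i = 0 from funext fun i => H _ i rfl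
    intro N
    induction N using Nat.strong_induction_on with
    | _ N ih =>
    intro i hi
    have h2 : T x i = 0 := congrFun hx i
    rw [hT, Finset.sum_eq_single_of_mem i (Finset.mem_univ i)] at h2
    · exact (mul_eq_zero.1 h2).resolve_right (h1 i)
    · intro i' _ hne
      by_cases h3 : ρ i' < ρ i
      · rw [ih _ (hi ▸ h3) i' rfl, zero_mul]
      · rw [h0 i' i hne h3, mul_zero]
  intro y
  obtain ⟨x, hx⟩ := LinearMap.injective_iff_surjective.1 hinj y
  exact ⟨_, hx⟩

theorem ContinuousLinearMap.linearIndependent_of_pi_surjective {E ι : Type*}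
    [NormedAddCommGroup E] [NormedSpace 𝕜 E] [Finite ι] (L : ι → E →L[𝕜] 𝕜)
    (h : Function.Surjective (ContinuousLinearMap.pi L)) : LinearIndependent 𝕜 L := by
  classical
  have := Fintype.ofFinite ι
  rw [Fintype.linearIndependent_iff]
  intro c hc i
  obtain ⟨v, hv⟩ := h (Pi.single i 1)
  have h1 (i' : ι) : L i' v = (Pi.single i 1 : ι → 𝕜) i' := congrFun hv i'
  have h2 := congrArg (fun M : E →L[𝕜] 𝕜 => M v) hc
  simpa [sum_apply, h1, Pi.single_apply] using h2

/-- A submersion has a local section. -/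
theorem exists_local_section {E F : Type*} [NormedAddCommGroup E] [NormedSpace 𝕜 E]
    [NormedAddCommGroup F] [NormedSpace 𝕜 F] [FiniteDimensional 𝕜 F] {f : E → F} {L : E →L[𝕜] F}
    {p : E} (hf : ContDiffAt 𝕜 ω f p) (hL : HasFDerivAt f L p) (hs : Function.Surjective L) :
    ∃ σ : F → E, ContDiffAt 𝕜 ω σ (f p) ∧ σ (f p) = p ∧ ∀ᶠ t in 𝓝 (f p), f (σ t) = t := by
  have : CompleteSpace F := FiniteDimensional.complete 𝕜 F
  obtain ⟨R, hR⟩ := (L : E →ₗ[𝕜] F).exists_rightInverse_of_surjective (LinearMap.range_eq_top.2 hs)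
  set R' : F →L[𝕜] E := LinearMap.toContinuousLinearMap R with hR'
  have hLR (x : F) : L (R' x) = x := congrArg (fun T : F →ₗ[𝕜] F => T x) hR
  -- Restricted to an affine complement of the kernel, f has derivative the identity; its local
  -- inverse gives the section.
  set φ : F → F := fun x => f (p + R' x) with hφ
  have h0 : p + R' 0 = p := by simp
  have hφc : ContDiffAt 𝕜 ω φ 0 := by
    refine ContDiffAt.comp 0 (g := f) (f := fun x => p + R' x) (by rwa [h0]) ?_
    exact contDiffAt_const.add R'.contDiff.contDiffAt
  have hφd : HasFDerivAt φ ((ContinuousLinearEquiv.refl 𝕜 F : F ≃L[𝕜] F) : F →L[𝕜] F) 0 := by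
    have h1 : HasFDerivAt (fun x => p + R' x) R' 0 := R'.hasFDerivAt.const_add p
    have h2 : HasFDerivAt f L (p + R' 0) := by rwa [h0]
    have h3 : HasFDerivAt φ (L ∘L R') 0 := h2.comp (0 : F) h1
    exact h3.congr_fderiv (by ext x; simp [hLR])
  have hne : (ω : WithTop ℕ∞) ≠ 0 := by simp
  set ψ := hφc.localInverse hφd hne with hψ
  have hψc : ContDiffAt 𝕜 ω ψ (φ 0) := hφc.to_localInverse hφd hne
  have hφ0 : φ 0 = f p := by simp [hφ]
  have hψ0 : ψ (φ 0) = 0 := (hφc.hasStrictFDerivAt' hφd hne).localInverse_apply_image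
  have hψr : ∀ᶠ t in 𝓝 (φ 0), φ (ψ t) = t :=
    (hφc.hasStrictFDerivAt' hφd hne).eventually_right_inverse
  rw [hφ0] at hψc hψ0 hψr
  exact ⟨fun t => p + R' (ψ t), contDiffAt_const.add (R'.contDiff.contDiffAt.comp _ hψc),
    by simp [hψ0], hψr⟩

/-- Any other cube root of unity 1 + d satisfies d² + 3d + 3 = 0, which is impossible for small d.
-/
theorem eq_one_of_cube_eq_one {x : 𝕜} (h : x ^ 3 = 1) (hx : ‖x - 1‖ < 1 / 2) : x = 1 := by
  by_contra hne
  set d := x - 1 with hd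
  have hd0 : d ≠ 0 := sub_ne_zero.2 hne
  have h1 : d * (d ^ 2 + 3 * d + 3) = 0 := by
    rw [hd]
    linear_combination h
  have h2 := (mul_eq_zero.1 h1).resolve_left hd0
  have h3 : (3 : 𝕜) = -(d ^ 2 + 3 * d) := by linear_combination h2
  have h4 : (3 : ℝ) ≤ ‖d‖ ^ 2 + 3 * ‖d‖ := by
    calc (3 : ℝ) = ‖(3 : 𝕜)‖ := by simp
      _ = ‖d ^ 2 + 3 * d‖ := (congrArg norm h3).trans (norm_neg _)
      _ ≤ ‖d ^ 2‖ + ‖3 * d‖ := norm_add_le _ _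
      _ = _ := by simp
  nlinarith [norm_nonneg d]

theorem exists_cube_root_nhds {M : Set 𝕜} (hM : M ∈ 𝓝 (1 : 𝕜)) :
    ∀ᶠ x in 𝓝 (1 : 𝕜), ∃ c ∈ M, c ^ 3 = x := by
  have h1 : HasStrictDerivAt (fun x : 𝕜 => x ^ 3) ((3 : ℕ) * 1 ^ (3 - 1)) 1 :=
    hasStrictDerivAt_pow 3 1
  have h2 := h1.map_nhds_eq (by simp)
  rw [one_pow] at h2
  rw [← h2]
  exact Filter.mem_map.2 (Filter.mem_of_superset hM fun c hc => ⟨c, hc, rfl⟩)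

variable {n r : ℕ}

theorem extendJet_apply {q : Jet 𝕜 n r} {v : Fin n × ℕ} (hv : v.2 ≤ r) :
    extendJet q v = q (v.1, ⟨v.2, Nat.lt_succ_of_le hv⟩) := by
  rw [extendJet, dif_pos]

theorem extendJet_of_lt {q : Jet 𝕜 n r} {v : Fin n × ℕ} (hv : r < v.2) : extendJet q v = 0 := by
  rw [extendJet, dif_neg (by omega)]

theorem truncJet_eq_of_agree {P : Fin n × ℕ → 𝕜} {q : Jet 𝕜 n r}
    (h : ∀ v, v.2 ≤ r → P v = extendJet q v) : truncJet r P = q := by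
  funext w
  rw [truncJet, h _ (Nat.le_of_lt_succ w.2.2), extendJet_apply (Nat.le_of_lt_succ w.2.2)]

theorem extendJet_truncJet {P : Fin n × ℕ → 𝕜} (h : ∀ v, r < v.2 → P v = 0) :
    extendJet (truncJet r P) = P := by
  funext v
  rcases Nat.lt_or_ge r v.2 with hv | hv
  · rw [extendJet_of_lt hv, h v hv]
  · rw [extendJet_apply hv, truncJet]

theorem extendJet_add_smul (q e : Jet 𝕜 n r) (t : 𝕜) (v : Fin n × ℕ) :
    extendJet (q + t • e) v = extendJet q v + t * extendJet e v := by
  unfold extendJet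
  split_ifs <;> simp

theorem contDiff_eval_extendJet (Q : DiffPoly 𝕜 n) :
    ContDiff 𝕜 ω fun q : Jet 𝕜 n r => eval (extendJet q) Q := by
  induction Q using MvPolynomial.induction_on with
  | C a => simpa using contDiff_const
  | add P Q hP hQ => simpa using hP.add hQ
  | mul_X P v hP =>
    simp only [map_mul, eval_X]
    refine hP.mul ?_
    unfold extendJet
    split_ifs
    · exact contDiff_apply _ _ _
    · exact contDiff_const

theorem isOpen_eval_extendJet_ne (Q : DiffPoly 𝕜 n) :
    IsOpen {q : Jet 𝕜 n r | eval (extendJet q) Q ≠ 0} :=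
  isOpen_ne_fun (contDiff_eval_extendJet Q).continuous continuous_const

/-- On the line from q to the truncation of p₀, Q restricts to a nonzero polynomial in one variable,
whose finitely many zeros can be avoided arbitrarily close to q. -/
theorem dense_eval_extendJet_ne {Q : DiffPoly 𝕜 n} {p₀ : Fin n × ℕ → 𝕜}
    (hp₀ : ∀ v, r < v.2 → p₀ v = 0) (hQ : eval p₀ Q ≠ 0) :
    Dense {q : Jet 𝕜 n r | eval (extendJet q) Q ≠ 0} := by
  intro q
  set e : Jet 𝕜 n r := truncJet r p₀ - q with he
  set P : Polynomial 𝕜 := aeval (fun v => Polynomial.C (extendJet q v) +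
    Polynomial.X * Polynomial.C (extendJet e v)) Q with hP
  have hPe (t : 𝕜) : P.eval t = eval (extendJet (q + t • e)) Q := by
    rw [hP]
    have (T : DiffPoly 𝕜 n) : (aeval (fun v => Polynomial.C (extendJet q v) +
        Polynomial.X * Polynomial.C (extendJet e v)) T).eval t =
        eval (extendJet (q + t • e)) T := by
      induction T using MvPolynomial.induction_on with
      | C a => simp [← Polynomial.algebraMap_eq]
      | add A B hA hB => rw [map_add, Polynomial.eval_add, map_add, hA, hB]
      | mul_X A v hA =>
        rw [map_mul, Polynomial.eval_mul, map_mul, hA, aeval_X, eval_X, extendJet_add_smul]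
        simp [mul_comm t]
    exact this Q
  have hP0 : P ≠ 0 := by
    intro h
    have := hPe 1
    rw [h, Polynomial.eval_zero, one_smul, he, add_sub_cancel, extendJet_truncJet hp₀] at this
    exact hQ this.symm
  have hd : Dense {t : 𝕜 | P.IsRoot t}ᶜ := (Polynomial.finite_setOfPred_isRoot hP0).countable.dense_compl 𝕜
  have hc : Continuous fun t : 𝕜 => q + t • e := by fun_prop
  have := map_mem_closure hc (hd 0) (t := {q : Jet 𝕜 n r | eval (extendJet q) Q ≠ 0})
    fun t ht => by
      rw [Set.mem_ofPred_eq, ← hPe]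
      exact ht
  simpa using this

/-- A smooth absolute invariant takes the same value on equivalent jets. -/
theorem eq_of_isAbsoluteInvariantOn {U : Set (Jet 𝕜 n r)} {F : Jet 𝕜 n r → 𝕜}
    (hF : IsAbsoluteInvariantOn (truncJet r ⁻¹' U) (fun q => F (truncJet r q))) {q q' : Jet 𝕜 n r}
    (hq : q ∈ U) (hq' : q' ∈ U) {c : 𝕜} (hc : c ≠ 0) {h g : ℕ → 𝕜}
    (H : ∀ v, v.2 ≤ r → jetAct (scaleJet c (extendJet q)) h g v = extendJet q' v) :
    F q = F q' := by
  obtain ⟨a, ha, haq⟩ := exists_coeffJet_eq (extendJet q) r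
  -- A coordinate of order at most r has total index below n + r, so it only sees the parameters
  -- prescribed here.
  obtain ⟨J, ξ, η, A, ht, hJ, h1, h2, h3⟩ := exists_isTransform isOpen_univ (Set.mem_univ 0)
    (fun j => (ha j).contDiffOn) hc h g (n + r)
  have e1 : truncJet r (coeffJet a (ξ 0)) = q := by
    rw [h1]
    exact truncJet_eq_of_agree haq
  have e2 : truncJet r (coeffJet A 0) = q' := by
    refine truncJet_eq_of_agree fun v hv => ?_
    have hvn := v.1.2
    rw [ht.coeffJet_eq hJ, ← H v hv, h1, h2]
    refine jetAct_congr (fun i h4 h5 => ?_) (fun m hm => (h3 m (by omega)).1)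
      (fun m hm => (h3 m (by omega)).2)
    rw [scaleJet, scaleJet, haq i (h5.trans hv)]
  have : F (truncJet r (coeffJet A 0)) = 1 * F (truncJet r (coeffJet a (ξ 0))) :=
    hF.2 J Set.univ ξ η a A ht 0 hJ (by rwa [Set.mem_preimage, e1]) (by rwa [Set.mem_preimage, e2])
  rw [e1, e2, one_mul] at this
  exact this.symm

/-- Every coordinate of order at most r is then a slice coordinate, so any two jets are equivalent
and invariants are locally constant. -/
theorem isFundamentalOfOrder_of_isEmpty {ι : Fin 0 → DiffRat 𝕜 n} (h : n ≤ 2 ∨ r < 2) :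
    IsFundamentalOfOrder r ι := by
  refine ⟨Set.univ, isOpen_univ, dense_univ, fun p _ => ⟨fun i => i.elim0,
    linearIndependent_empty_type, fun U F hU hp _ hF => ⟨Set.univ, fun _ => F p, isOpen_univ,
    Set.mem_univ _, contDiffOn_const, ?_⟩⟩⟩
  filter_upwards [hU.mem_nhds hp] with q hq
  obtain ⟨h', g', -, H⟩ := exists_jetAct_eq (isUnit_natCast_field 𝕜) r
    (scaleJet 1 (extendJet q)) (extendJet p) 0
  refine eq_of_isAbsoluteInvariantOn hF hq hp one_ne_zero fun v hv => H v ⟨hv, ?_⟩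
  have := v.1.2
  omega

theorem reduced_kappaIdx_kappaShift (hn : 2 < n) {p : Fin n × ℕ → 𝕜}
    (hp : reduced (thetaIdx hn) p 0 ≠ 0) : reduced (kappaIdx hn) p (kappaShift hn p) = 0 := by
  have := kappaCoeff_ne_zero (𝕜 := 𝕜) (n := n)
  rw [reduced_kappaIdx hn, kappaShift]
  field_simp
  ring

/-- `reduced v` minus its own coordinate depends only on smaller total indices and on slice
coordinates of equal total index, which belong to earlier coefficients. Induction on the total index
and then on the coefficient recovers the jet. -/
theorem eq_of_slice_of_reduced {p p' : Fin n × ℕ → 𝕜} {u : 𝕜}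
    (hs : ∀ v, IsSlice r v → p v = p' v)
    (hr : ∀ v : Fin n × ℕ, 2 ≤ v.1.val → v.2 + 2 ≤ r → reduced v p u = reduced v p' u) :
    ∀ v, v.2 ≤ r → p v = p' v := by
  suffices H : ∀ N j, ∀ v : Fin n × ℕ, v.1.val + v.2 = N → v.1.val = j → v.2 ≤ r → p v = p' v from
    fun v hv => H _ _ v rfl rfl hv
  intro N
  induction N using Nat.strong_induction_on with
  | _ N ihN =>
  intro j
  induction j using Nat.strong_induction_on with
  | _ j ihj =>
  intro v hN hj hv
  by_cases hvs : IsSlice r v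
  · exact hs v hvs
  · have h1 : 2 ≤ v.1.val ∧ v.2 + 2 ≤ r := by
      unfold IsSlice at hvs
      omega
    have h2 := reduced_sub_of_agree h1.1 (p := p) (p' := p') u fun v' h3 h4 => by
      rcases h4 with h4 | ⟨h4, h5⟩
      · exact ihN _ (hN ▸ h4) _ v' rfl rfl (h3.trans h1.2)
      · refine ihj _ ?_ v' (h4.trans hN) rfl (h3.trans h1.2)
        rcases h5.val_eq h4 with h6 | ⟨h6, -⟩ <;> omega
    rw [hr v h1.1 h1.2] at h2
    exact sub_right_injective h2

/-- Jets with the same values of the relative invariants are equivalent. -/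
theorem exists_jetAct_eq_of_relPoly (hn : 2 < n) {p p' : Fin n × ℕ → 𝕜}
    {c : 𝕜} (hc : c ≠ 0) (hp : reduced (thetaIdx hn) p 0 ≠ 0)
    (hθ : reduced (thetaIdx hn) p' 0 = c ^ 3 * reduced (thetaIdx hn) p 0)
    (hS : ∀ i, IsInvariantIdx hn i → i.2 + 2 ≤ r →
      eval p' (relPoly 𝕜 hn i) = c ^ relWeight 𝕜 hn i * eval p (relPoly 𝕜 hn i)) :
    ∃ h g : ℕ → 𝕜, ∀ v, v.2 ≤ r → jetAct (scaleJet c p) h g v = p' v := by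
  -- The free parameter g 0 is chosen so that the transformed jet has the same `kappaShift` as p'.
  obtain ⟨h, g, hg, H⟩ := exists_jetAct_eq (isUnit_natCast_field 𝕜) r (scaleJet c p) p'
    (c * kappaShift hn p - kappaShift hn p')
  refine ⟨h, g, ?_⟩
  have hp' : reduced (thetaIdx hn) p' 0 ≠ 0 := by
    rw [hθ]
    exact mul_ne_zero (pow_ne_zero 3 hc) hp
  set q := jetAct (scaleJet c p) h g with hq
  have h1 : reduced (thetaIdx hn) q 0 = reduced (thetaIdx hn) p' 0 := by
    rw [hθ, hq, reduced_thetaIdx_jetAct hn p hc]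
  have h2 : kappaShift hn q = kappaShift hn p' := by
    rw [hq, kappaShift_jetAct hn p hc h g hp, hg, sub_sub_cancel]
  refine eq_of_slice_of_reduced (u := kappaShift hn p') H fun v h3 h4 => ?_
  by_cases hvθ : v = thetaIdx hn
  · rw [hvθ, thetaIdx, reduced_two_zero_const rfl, reduced_two_zero_const rfl p']
    exact h1
  by_cases hvκ : v = kappaIdx hn
  · rw [hvκ, reduced_kappaIdx_kappaShift hn hp', ← h2, reduced_kappaIdx_kappaShift hn (h1 ▸ hp')]
  have hv : IsInvariantIdx hn v := ⟨h3, hvθ, hvκ⟩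
  have h5 := isJetInvariant_relPoly hn h3 p c hc h g
  rw [← hq, ← hS v hv h4, eval_relPoly hn v hp', eval_relPoly hn v (h1 ▸ hp'), h1, h2] at h5
  exact mul_left_cancel₀ (pow_ne_zero _ hp') h5

end

/-! ### Generic jets and the fundamental set -/

section
variable {𝕜 : Type*} [RCLike 𝕜] {n r : ℕ}

/-- The jets at which the basic relative invariants do not vanish. -/
def regularJets (𝕜 : Type*) [RCLike 𝕜] (hn : 2 < n) (r : ℕ) : Set (Jet 𝕜 n r) :=
  {q | reduced (thetaIdx hn) (extendJet q) 0 ≠ 0 ∧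
    ∀ i, IsInvariantIdx hn i → i.2 + 2 ≤ r → eval (extendJet q) (relPoly 𝕜 hn i) ≠ 0}

theorem finite_isInvariantIdx (hn : 2 < n) (r : ℕ) :
    Finite {i : Fin n × ℕ // IsInvariantIdx hn i ∧ i.2 + 2 ≤ r} := by
  refine Finite.of_injective (fun i => ((i.1.1, ⟨i.1.2, by have := i.2.2; omega⟩) : Fin n × Fin r))
    fun i i' h => ?_
  simp only [Prod.mk.injEq, Fin.mk.injEq] at h
  exact Subtype.ext (Prod.ext h.1 h.2)

theorem regularJets_eq (hn : 2 < n) (r : ℕ) : regularJets 𝕜 hn r =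
    {q | eval (extendJet q) (reducedPolyZero 𝕜 (thetaIdx hn)) ≠ 0} ∩
      ⋂ i : {i : Fin n × ℕ // IsInvariantIdx hn i ∧ i.2 + 2 ≤ r},
        {q | eval (extendJet q) (relPoly 𝕜 hn i.1) ≠ 0} := by
  ext q
  simp [regularJets, eval_reducedPolyZero]

theorem isOpen_regularJets (hn : 2 < n) : IsOpen (regularJets 𝕜 hn r) := by
  have := finite_isInvariantIdx hn r
  rw [regularJets_eq]
  exact (isOpen_eval_extendJet_ne _).inter (isOpen_iInter_of_finite fun _ =>
    isOpen_eval_extendJet_ne _)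

theorem dense_regularJets (hn : 2 < n) (hr : 2 ≤ r) : Dense (regularJets 𝕜 hn r) := by
  have := finite_isInvariantIdx hn r
  rw [regularJets_eq]
  refine Dense.inter_of_isOpen_left ?_ ?_ (isOpen_eval_extendJet_ne _)
  · obtain ⟨p, hp, hp'⟩ := exists_reduced_thetaIdx_ne_zero (𝕜 := 𝕜) hn hr
    exact dense_eval_extendJet_ne hp (by rwa [eval_reducedPolyZero])
  · refine dense_iInter_of_isOpen (fun _ => isOpen_eval_extendJet_ne _) fun i => ?_
    obtain ⟨p, hp, hp'⟩ := exists_eval_relPoly_ne_zero (𝕜 := 𝕜) i.2.1 i.2.2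
    exact dense_eval_extendJet_ne hp hp'

theorem contDiff_reduced_thetaIdx (hn : 2 < n) :
    ContDiff 𝕜 ω fun q : Jet 𝕜 n r => reduced (thetaIdx hn) (extendJet q) 0 := by
  simpa only [eval_reducedPolyZero] using
    contDiff_eval_extendJet (r := r) (reducedPolyZero 𝕜 (thetaIdx hn))

theorem contDiffAt_absInvariant {hn : 2 < n} (i : Fin n × ℕ) {q : Jet 𝕜 n r}
    (hq : reduced (thetaIdx hn) (extendJet q) 0 ≠ 0) :
    ContDiffAt 𝕜 ω (fun q : Jet 𝕜 n r => (absInvariant 𝕜 hn i).value (extendJet q)) q := by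
  have h1 := (contDiff_reduced_thetaIdx (𝕜 := 𝕜) (r := r) hn).contDiffAt (x := q)
  refine ContDiffAt.congr_of_eventuallyEq (((contDiff_eval_extendJet
    (relPoly 𝕜 hn i)).contDiffAt.pow 3).div (h1.pow (relWeight 𝕜 hn i)) (pow_ne_zero _ hq)) ?_
  filter_upwards [h1.continuousAt.eventually_ne hq] with q' hq'
  exact absInvariant_value hq'

theorem extendJet_add_smul_single {q : Jet 𝕜 n r} {v : Fin n × ℕ} (hv : v.2 ≤ r) (t : 𝕜) :
    extendJet (q + t • truncJet r (Pi.single v 1)) =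
      Function.update (extendJet q) v (extendJet q v + t) := by
  funext w
  rw [extendJet_add_smul, extendJet_truncJet]
  · by_cases h : w = v
    · subst h
      simp
    · simp [h]
  · intro w hw
    refine Pi.single_eq_of_ne ?_ _
    rintro rfl
    omega

theorem fderiv_absInvariant_of_not_le {hn : 2 < n} {i i' : Fin n × ℕ} (hi : IsInvariantIdx hn i)
    (hr : i.2 + 2 ≤ r) (hi' : 2 ≤ i'.1.val) (h : ¬ (i.2 ≤ i'.2 ∧ i.1.val + i.2 ≤ i'.1.val + i'.2))
    {q : Jet 𝕜 n r} (hq : reduced (thetaIdx hn) (extendJet q) 0 ≠ 0) :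
    fderiv 𝕜 (fun q : Jet 𝕜 n r => (absInvariant 𝕜 hn i').value (extendJet q)) q
      (truncJet r (Pi.single (pivot i) 1)) = 0 := by
  have h1 := ((contDiffAt_absInvariant i' hq).differentiableAt (by simp)).hasFDerivAt.hasLineDerivAt
    (truncJet r (Pi.single (pivot i) 1))
  refine HasDerivAt.unique (x := (0 : 𝕜)) h1 ?_
  convert hasDerivAt_const (0 : 𝕜) ((absInvariant 𝕜 hn i').value (extendJet q)) using 1
  funext t
  beta_reduce
  rw [extendJet_add_smul_single (by exact hr), absInvariant_value, absInvariant_value hq,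
    reduced_thetaIdx_update hi, eval_relPoly_update_of_not_le hi hi' h]
  rwa [reduced_thetaIdx_update hi]

/-- Along the pivot, S³/θ^m has derivative 3S²k/θ^m with k ≠ 0. The cube is why `regularJets`
excludes the zeros of S. -/
theorem fderiv_absInvariant_pivot_ne_zero {hn : 2 < n} {i : Fin n × ℕ} (hi : IsInvariantIdx hn i)
    (hr : i.2 + 2 ≤ r) {q : Jet 𝕜 n r} (hq : reduced (thetaIdx hn) (extendJet q) 0 ≠ 0)
    (hS : eval (extendJet q) (relPoly 𝕜 hn i) ≠ 0) :
    fderiv 𝕜 (fun q : Jet 𝕜 n r => (absInvariant 𝕜 hn i).value (extendJet q)) q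
      (truncJet r (Pi.single (pivot i) 1)) ≠ 0 := by
  have h1 := ((contDiffAt_absInvariant i hq).differentiableAt (by simp)).hasFDerivAt.hasLineDerivAt
    (truncJet r (Pi.single (pivot i) 1))
  set k := reduced (thetaIdx hn) (extendJet q) 0 ^ relExp 𝕜 hn i * pivotCoeff 𝕜 i with hk
  have hk0 : k ≠ 0 := mul_ne_zero (pow_ne_zero _ hq) (pivotCoeff_ne_zero hi.1)
  have h2 : HasDerivAt (fun t : 𝕜 => (eval (extendJet q) (relPoly 𝕜 hn i) + k * t) ^ 3 /
      reduced (thetaIdx hn) (extendJet q) 0 ^ relWeight 𝕜 hn i) _ 0 :=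
    ((((hasDerivAt_id (0 : 𝕜)).const_mul k).const_add _).pow 3).div_const _
  have h3 : HasDerivAt (fun t : 𝕜 => (absInvariant 𝕜 hn i).value
      (extendJet (q + t • truncJet r (Pi.single (pivot i) 1)))) _ 0 := h1
  have h4 : (fun t : 𝕜 => (absInvariant 𝕜 hn i).value
      (extendJet (q + t • truncJet r (Pi.single (pivot i) 1)))) =
      fun t : 𝕜 => (eval (extendJet q) (relPoly 𝕜 hn i) + k * t) ^ 3 /
      reduced (thetaIdx hn) (extendJet q) 0 ^ relWeight 𝕜 hn i := by
    funext t
    rw [extendJet_add_smul_single (by exact hr), absInvariant_value, reduced_thetaIdx_update hi,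
      eval_relPoly_update hi hq, add_sub_cancel_left]
    rwa [reduced_thetaIdx_update hi]
  rw [h4] at h3
  rw [h3.unique h2]
  refine div_ne_zero ?_ (pow_ne_zero _ hq)
  simp [hS, hk0]

/-- Near a point where they do not vanish, functions `θ` of weight `3` and `S i` of weight `m i` are
determined up to scaling by the quotients `S i ^ 3 / θ ^ m i`. -/
theorem eventually_exists_scale {Y ι : Type*} [TopologicalSpace Y] [Finite ι] {θ : Y → 𝕜}
    {S : ι → Y → 𝕜} (m : ι → ℕ) (hθ : Continuous θ) (hS : ∀ i, Continuous (S i)) {p : Y}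
    (hθp : θ p ≠ 0) (hSp : ∀ i, S i p ≠ 0) :
    ∀ᶠ y : Y × Y in 𝓝 (p, p), (∀ i, S i y.1 ^ 3 / θ y.1 ^ m i = S i y.2 ^ 3 / θ y.2 ^ m i) →
      ∃ c : 𝕜, c ≠ 0 ∧ θ y.2 = c ^ 3 * θ y.1 ∧ ∀ i, S i y.2 = c ^ m i * S i y.1 := by
  have hfst {P : Y → Prop} (h : ∀ᶠ q in 𝓝 p, P q) : ∀ᶠ y : Y × Y in 𝓝 (p, p), P y.1 := by
    rw [nhds_prod_eq]
    exact Filter.tendsto_fst.eventually h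
  have hsnd {P : Y → Prop} (h : ∀ᶠ q in 𝓝 p, P q) : ∀ᶠ y : Y × Y in 𝓝 (p, p), P y.2 := by
    rw [nhds_prod_eq]
    exact Filter.tendsto_snd.eventually h
  have hθne := hθ.continuousAt.eventually_ne hθp
  have hSne := Filter.eventually_all.2 fun i => (hS i).continuousAt.eventually_ne (hSp i)
  -- A cube root c of the ratio of the θ's is taken near 1. Then each c^m S/S' is near 1 and has
  -- cube 1, so it equals 1; this removes the ambiguity by cube roots of unity.
  have hclose : ∀ᶠ z : 𝕜 × Y × Y in 𝓝 (1, p, p), z.1 ≠ 0 ∧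
      ∀ i, ‖z.1 ^ m i * S i z.2.1 / S i z.2.2 - 1‖ < 1 / 2 := by
    refine (continuousAt_fst.eventually_ne one_ne_zero).and (Filter.eventually_all.2 fun i => ?_)
    have h1 : ContinuousAt (fun z : 𝕜 × Y × Y => z.1 ^ m i * S i z.2.1) (1, p, p) :=
      ((continuous_fst.pow _).mul ((hS i).comp (continuous_fst.comp continuous_snd))).continuousAt
    have h2 : ContinuousAt (fun z : 𝕜 × Y × Y => S i z.2.2) (1, p, p) :=
      ((hS i).comp (continuous_snd.comp continuous_snd)).continuousAt
    have h3 := ((h1.div h2 (hSp i)).sub (continuousAt_const (y := (1 : 𝕜)))).norm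
    refine h3.eventually (eventually_lt_nhds ?_)
    simp [hSp i]
  rw [nhds_prod_eq, Filter.eventually_prod_iff] at hclose
  obtain ⟨M, hM, N, hN, hMN⟩ := hclose
  have hroot : ∀ᶠ y : Y × Y in 𝓝 (p, p), ∃ c ∈ {c | M c}, c ^ 3 = θ y.2 / θ y.1 := by
    have h : ContinuousAt (fun y : Y × Y => θ y.2 / θ y.1) (p, p) :=
      (hθ.comp continuous_snd).continuousAt.div (hθ.comp continuous_fst).continuousAt hθp
    have h1 : θ p / θ p = 1 := div_self hθp
    have h2 := exists_cube_root_nhds hM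
    rw [← h1] at h2
    exact h.eventually h2
  filter_upwards [hfst hθne, hsnd hSne, hN, hroot] with y h1 h4 hyN ⟨c, hcM, hc⟩ H
  obtain ⟨hc0, hci⟩ := hMN hcM hyN
  have h3 : θ y.2 = c ^ 3 * θ y.1 := by rw [hc, div_mul_cancel₀ _ h1]
  refine ⟨c, hc0, h3, fun i => ?_⟩
  have h5 := H i
  have h6 := eq_one_of_cube_eq_one (x := c ^ m i * S i y.1 / S i y.2) ?_ (hci i)
  · exact ((div_eq_one_iff_eq (h4 i)).1 h6).symm
  · rw [h3, mul_pow, ← pow_mul, div_eq_div_iff (pow_ne_zero _ h1)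
      (mul_ne_zero (pow_ne_zero _ hc0) (pow_ne_zero _ h1))] at h5
    rw [div_pow, div_eq_one_iff_eq (pow_ne_zero _ (h4 i)), mul_pow, ← pow_mul, mul_comm _ 3]
    exact mul_right_cancel₀ (pow_ne_zero (m i) h1) (by linear_combination h5)

/-- The invariants form a submersion f at regular jets, with local section σ. Near p, the jets q and
σ(f(q)) have the same invariants, hence are equivalent, so F factors through f as F ∘ σ. -/
theorem isFundamentalOfOrder_absInvariant {hn : 2 < n} (hr : 2 ≤ r) {s : ℕ}
    {j : Fin s → Fin n × ℕ} (hj : Function.Injective j)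
    (hj' : ∀ i, i ∈ Set.range j ↔ IsInvariantIdx hn i ∧ i.2 + 2 ≤ r) :
    IsFundamentalOfOrder r fun k => absInvariant 𝕜 hn (j k) := by
  have hjk (k) : IsInvariantIdx hn (j k) ∧ (j k).2 + 2 ≤ r := (hj' _).1 ⟨k, rfl⟩
  refine ⟨regularJets 𝕜 hn r, isOpen_regularJets hn, dense_regularJets hn hr, fun p hp => ?_⟩
  set f : Jet 𝕜 n r → Fin s → 𝕜 := fun q k => (absInvariant 𝕜 hn (j k)).value (extendJet q) with hf
  have hfc : ContDiffAt 𝕜 ω f p := contDiffAt_pi.2 fun k => contDiffAt_absInvariant _ hp.1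
  set L : Fin s → Jet 𝕜 n r →L[𝕜] 𝕜 := fun k =>
    fderiv 𝕜 (fun q : Jet 𝕜 n r => (absInvariant 𝕜 hn (j k)).value (extendJet q)) p with hL
  have hfL : HasFDerivAt f (ContinuousLinearMap.pi L) p := hasFDerivAt_pi.2 fun k =>
    ((contDiffAt_absInvariant _ hp.1).differentiableAt (by simp)).hasFDerivAt
  have hsurj : Function.Surjective (ContinuousLinearMap.pi L) := by
    -- The sum of order and total index strictly increases along the partial order by order and
    -- total index, so it serves as rank.
    refine ContinuousLinearMap.pi_surjective_of_triangular L
      (fun k => truncJet r (Pi.single (pivot (j k)) 1))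
      (fun k => (j k).2 + ((j k).1.val + (j k).2)) (fun k k' hne hρ => ?_) fun k => ?_
    · refine fderiv_absInvariant_of_not_le (hjk k).1 (hjk k).2 (hjk k').1.1 (fun hle => ?_) hp.1
      refine hne (hj (Prod.ext (Fin.ext ?_) ?_)) <;> omega
    · exact fderiv_absInvariant_pivot_ne_zero (hjk k).1 (hjk k).2 hp.1
        (hp.2 _ (hjk k).1 (hjk k).2)
  refine ⟨fun k => absInvariant_mem_domain hp.1,
    ContinuousLinearMap.linearIndependent_of_pi_surjective L hsurj, fun U F hU hpU hFc hF => ?_⟩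
  obtain ⟨σ, hσc, hσp, hσ⟩ := exists_local_section hfc hfL hsurj
  -- Class ω at a point, unlike class ∞, yields one neighbourhood on which σ is smooth; hence the
  -- analytic version of the section.
  obtain ⟨u, hu, hpu, hσu⟩ := hσc.contDiffOn' (m := ∞) le_top fun _ => rfl
  simp only [Set.insert_eq_of_mem (Set.mem_univ _), Set.univ_inter] at hσu
  refine ⟨u ∩ σ ⁻¹' U, F ∘ σ, hσu.continuousOn.isOpen_inter_preimage hu hU,
    ⟨hpu, by rw [Set.mem_preimage]; exact hσp.symm ▸ hpU⟩,
    hFc.comp (hσu.mono Set.inter_subset_left) fun x hx => hx.2, ?_⟩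
  have hfcont := hfc.continuousAt
  have h1 : ContinuousAt (fun q => (q, σ (f q))) p :=
    continuousAt_id.prodMk (ContinuousAt.comp hσc.continuousAt hfcont)
  have hθc := contDiff_reduced_thetaIdx (𝕜 := 𝕜) (r := r) hn
  have h2 := eventually_exists_scale (fun k => relWeight 𝕜 hn (j k)) hθc.continuous
    (fun k => (contDiff_eval_extendJet (relPoly 𝕜 hn (j k))).continuous) hp.1
    (fun k => hp.2 _ (hjk k).1 (hjk k).2)
  have hθp := hθc.continuous.continuousAt.eventually_ne hp.1
  have h3 : ContinuousAt (fun q => σ (f q)) p := ContinuousAt.comp hσc.continuousAt hfcont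
  rw [ContinuousAt, hσp] at h1 h3
  filter_upwards [hU.mem_nhds hpU, h3.eventually_mem (hU.mem_nhds hpU),
    hfcont.eventually hσ, h1.eventually h2, hθp, h3.eventually hθp] with q hq hq' hqσ H hθ0 hθ1
  obtain ⟨c, hc, hθ, hS⟩ := H fun k => by
    rw [← absInvariant_value hθ0, ← absInvariant_value hθ1]
    exact (congrFun hqσ k).symm
  obtain ⟨h, g, hhg⟩ := exists_jetAct_eq_of_relPoly hn hc hθ0 hθ fun i hi hir => by
    obtain ⟨k, rfl⟩ := (hj' i).2 ⟨hi, hir⟩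
    exact hS k
  exact eq_of_isAbsoluteInvariantOn hF hq hq' hc hhg

theorem isFundamentalSet_absInvariant (hn : 2 < n) :
    IsFundamentalSet {f | ∃ i, IsInvariantIdx hn i ∧ f = absInvariant 𝕜 hn i} := by
  refine ⟨?_, fun r => ?_⟩
  · rintro _ ⟨i, hi, rfl⟩
    exact isAbsoluteInvariantOn_absInvariant hi
  · have := finite_isInvariantIdx hn r
    obtain ⟨s, ⟨e⟩⟩ := Finite.exists_equiv_fin {i : Fin n × ℕ // IsInvariantIdx hn i ∧ i.2 + 2 ≤ r}
    refine ⟨s, fun k => absInvariant 𝕜 hn (e.symm k).1, ?_, ?_⟩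
    · ext f
      constructor
      · rintro ⟨k, rfl⟩
        obtain ⟨h1, h2⟩ := (e.symm k).2
        exact ⟨⟨_, h1, rfl⟩, (absInvariant_orderLE_iff h1).2 h2⟩
      · rintro ⟨⟨i, hi, rfl⟩, h⟩
        exact ⟨e ⟨i, hi, (absInvariant_orderLE_iff hi).1 h⟩, by simp⟩
    · rcases Nat.lt_or_ge r 2 with hr | hr
      · obtain rfl : s = 0 := by
          by_contra hs
          have := (e.symm ⟨0, Nat.pos_of_ne_zero hs⟩).2.2
          omega
        exact isFundamentalOfOrder_of_isEmpty (Or.inr hr)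
      · refine isFundamentalOfOrder_absInvariant hr (j := fun k => (e.symm k).1)
          (Subtype.val_injective.comp e.symm.injective) fun i => ⟨?_, fun hi => ?_⟩
        · rintro ⟨k, rfl⟩
          exact (e.symm k).2
        · exact ⟨e ⟨i, hi⟩, by simp⟩

end

theorem theorem2p1 {𝕜 : Type*} [RCLike 𝕜] (n : ℕ) :
    ∃ B : Set (DiffRat 𝕜 n), IsFundamentalSet B ∧
      ∀ F ∈ B, ∃ (m : ℕ) (S₁ S₂ : DiffPoly 𝕜 n), S₂ ≠ 0 ∧
        F = algebraMap (DiffPoly 𝕜 n) (DiffRat 𝕜 n) S₁ /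
          algebraMap (DiffPoly 𝕜 n) (DiffRat 𝕜 n) S₂ ∧
        IsRelativeInvariantOfWeight S₁ m ∧ IsRelativeInvariantOfWeight S₂ m := by
  rcases Nat.lt_or_ge 2 n with hn | hn
  · refine ⟨_, isFundamentalSet_absInvariant hn, ?_⟩
    rintro _ ⟨i, hi, rfl⟩
    -- S³ and θ^(m_i) both have weight 3 m_i, since θ has weight 3.
    refine ⟨relWeight 𝕜 hn i * 3, _, _, pow_ne_zero _ (reducedPolyZero_thetaIdx_ne_zero hn), rfl,
      ((isJetInvariant_relPoly hn hi.1).pow 3).isRelativeInvariantOfWeight, ?_⟩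
    rw [mul_comm]
    exact ((isJetInvariant_theta hn).pow _).isRelativeInvariantOfWeight
  -- For n ≤ 2 the action is transitive on jets, so the empty set is fundamental.
  · refine ⟨∅, ⟨fun f hf => hf.elim, fun r => ⟨0, Fin.elim0, ?_,
      isFundamentalOfOrder_of_isEmpty (Or.inl hn)⟩⟩, fun F hF => hF.elim⟩
    simp [Set.range_eq_empty]
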